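/- \textbf{Definitions.} All manifolds are smooth, real, finite-dimensional, without boundary, Hausdorff and second countable, and $\Gamma(E)$ denotes smooth sections. A \emph{Courant algebroid} $(E,\mathfrak a,\rho,\langle\cdot,\cdot\rangle)$ over $M$ is a smooth real vector bundle $E\to M$ of finite rank with a smooth bundle map $\rho\colon E\to TM$ over the identity (the anchor), a smooth fibrewise nondegenerate symmetric bilinear pairing $\langle\cdot,\cdot\rangle$ and an $\mathbb R$-bilinear bracket $\mathfrak a=[\cdot,\cdot]$ on $\Gamma(E)$ such that for all $\alpha,\beta,\gamma\in\Gamma(E)$ and $f\in C^\infty(M)$: $[\alpha,f\beta]=f[\alpha,\beta]+(\rho(\alpha)f)\beta$; $[\alpha,[\beta,\gamma]]=[[\alpha,\beta],\gamma]+[\beta,[\alpha,\gamma]]$; $\rho(\alpha)\langle\beta,\gamma\rangle=\langle[\alpha,\beta],\gamma\rangle+\langle\beta,[\alpha,\gamma]\rangle$; and $[\alpha,\beta]+[\beta,\alpha]=\rho^*d\langle\alpha,\beta\rangle$, where $\langle\rho^*\xi,e\rangle=\xi(\rho(e))$. For $U\subseteq M$ open, $E|_U$ carries the unique Courant algebroid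 structure over $U$ compatible with restriction of sections. The \emph{standard Courant algebroid} $\mathbb TM=TM\oplus T^*M$ has the projection $\rho_M$ to $TM$ as anchor, the pairing $\langle X+\alpha,Y+\beta\rangle=\beta(X)+\alpha(Y)$ and the Courant--Dorfman bracket $\mathfrak a_M(X+\alpha,Y+\beta)=[X,Y]+\mathcal L_X\beta-i_Yd\alpha$. The \emph{direct product} of Courant algebroids $E_1\to M_1$ and $E_2\to M_2$ is the Courant algebroid $E_1\times E_2=\pi_1^*E_1\oplus\pi_2^*E_2$ over $M_1\times M_2$ with anchor $\rho_1\times\rho_2$ and the product pairing, whose bracket restricts to the given brackets on the images of $\Gamma(E_1)$ and $\Gamma(E_2)$ (embedded by $\sigma_1\mapsto(\sigma_1,0)$ and $\sigma_2\mapsto(0,\sigma_2)$), and for which $[\Gamma(E_1),\Gamma(E_2)]=[\Gamma(E_2),\Gamma(E_1)]=0$. An \emph{isomorphism} of Courant algebroids is a smooth vector bundle isomorphism, covering a diffeomorphism of the bases, that intertwines anchors, pairings and brackets. \textbf{Theorem.} Let $(E,\mathfrak a,\rho,\langle\cdot,\cdot\rangle)$ be a Courant algebroid over $M$ and let $p\in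 M$ be such that $\rho_p\neq0$. Then there exist an open neighbourhood $U$ of $p$, a nonempty open interval $I\subset\mathbb R$, an embedded hypersurface $S\subset M$ with $p\in S\subseteq U$ that is transverse to $\rho$ (that is, $T_sS+\rho(E_s)=T_sM$ for all $s\in S$), a Courant algebroid $(E',\mathfrak a',\rho',\langle\cdot,\cdot\rangle')$ over $S$, and a Courant algebroid isomorphism $$\varphi\colon(E,\mathfrak a,\rho,\langle\cdot,\cdot\rangle)|_U\longrightarrow\bigl(\mathbb TI\times E',\ \mathfrak a_I\times\mathfrak a',\ \rho_I\times\rho',\ \langle\cdot,\cdot\rangle_{\mathbb TI}\times\langle\cdot,\cdot\rangle'\bigr)$$ onto the direct product of the standard Courant algebroid $\mathbb TI$ and $E'$. Moreover, there is $t_0\in I$ such that the diffeomorphism $U\to I\times S$ covered by $\varphi$ maps each $s\in S$ to $(t_0,s)$. -/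

import Mathlib

open Bundle TopologicalSpace
open scoped Manifold ContDiff

noncomputable section

/-- Fibres of a pullback bundle are additive groups, with the structure of the original fibres. -/
instance Bundle.Pullback.instAddCommGroupFiber {B B' : Type*} (f : B' → B) (E : B → Type*)
    [∀ x, AddCommGroup (E x)] (x : B') : AddCommGroup ((f *ᵖ E) x) :=
  inferInstanceAs <| AddCommGroup (E (f x))

namespace CourantSplitting

section Sections

variable {EB : Type*} [NormedAddCommGroup EB] [NormedSpace ℝ EB]
  {H : Type*} [TopologicalSpace H] {I : ModelWithCorners ℝ EB H}
  {M : Type*} [TopologicalSpace M] [ChartedSpace H M]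
  {F : Type*} [NormedAddCommGroup F] [NormedSpace ℝ F]
  {E : M → Type*} [TopologicalSpace (TotalSpace F E)] [∀ x, AddCommGroup (E x)]
  [∀ x, Module ℝ (E x)] [∀ x, TopologicalSpace (E x)] [FiberBundle F E] [VectorBundle ℝ F E]

/-- The product `f σ` of a smooth function and a smooth section. -/
def fsmul (f : C^∞⟮I, M; ℝ⟯) (σ : Cₛ^∞⟮I; F, E⟯) : Cₛ^∞⟮I; F, E⟯ :=
  ⟨fun x => f x • σ x, f.contMDiff.smul_section σ.contMDiff⟩

variable {EB' : Type*} [NormedAddCommGroup EB'] [NormedSpace ℝ EB']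
  {H' : Type*} [TopologicalSpace H'] {I' : ModelWithCorners ℝ EB' H'}
  {M' : Type*} [TopologicalSpace M'] [ChartedSpace H' M']

/-- The pullback of a smooth section along a smooth map. -/
def pullbackSection (f : C^∞⟮I', M'; I, M⟯) (σ : Cₛ^∞⟮I; F, E⟯) :
    Cₛ^∞⟮I'; F, (f : M' → M) *ᵖ E⟯ :=
  ⟨fun x => σ (f x), by
    intro x₀
    refine (contMDiffAt_section (E := (f : M' → M) *ᵖ E) (s := fun x => σ (f x)) x₀).2 ?_
    have h := (contMDiffAt_section (IB := I) (n := ∞) (s := σ) (f x₀)).1 (σ.contMDiff (f x₀))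
    exact h.comp x₀ (f.contMDiff x₀)⟩

variable {F₂ : Type*} [NormedAddCommGroup F₂] [NormedSpace ℝ F₂]
  {E₂ : M → Type*} [TopologicalSpace (TotalSpace F₂ E₂)] [∀ x, AddCommGroup (E₂ x)]
  [∀ x, Module ℝ (E₂ x)] [∀ x, TopologicalSpace (E₂ x)] [FiberBundle F₂ E₂] [VectorBundle ℝ F₂ E₂]

/-- The section `(σ, τ)` of a Whitney sum. -/
def pairSection (σ : Cₛ^∞⟮I; F, E⟯) (τ : Cₛ^∞⟮I; F₂, E₂⟯) :
    Cₛ^∞⟮I; F × F₂, E ×ᵇ E₂⟯ :=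
  ⟨fun x => (σ x, τ x), by
    intro x₀
    rw [contMDiffAt_section]
    exact ((contMDiffAt_section (IB := I) (n := ∞) (s := σ) x₀).1 (σ.contMDiff x₀)).prodMk_space
      ((contMDiffAt_section (IB := I) (n := ∞) (s := τ) x₀).1 (τ.contMDiff x₀))⟩

end Sections

section Courant

variable {EB : Type*} [NormedAddCommGroup EB] [NormedSpace ℝ EB]
  {H : Type*} [TopologicalSpace H] (I : ModelWithCorners ℝ EB H)
  {M : Type*} [TopologicalSpace M] [ChartedSpace H M] [IsManifold I ∞ M]
  (F : Type*) [NormedAddCommGroup F] [NormedSpace ℝ F]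
  (E : M → Type*) [TopologicalSpace (TotalSpace F E)] [∀ x, AddCommGroup (E x)]
  [∀ x, Module ℝ (E x)] [∀ x, TopologicalSpace (E x)] [FiberBundle F E] [VectorBundle ℝ F E]
  [ContMDiffVectorBundle ∞ F E I]

/-- A Courant algebroid structure on the smooth vector bundle `E → M`.

The last axiom says `[α, β] + [β, α] = ρ^* d⟨α, β⟩`, where `ρ^* ξ` is the element of `E` with
`⟨ρ^* ξ, e⟩ = ξ (ρ e)`. Together with `leibniz` it gives the rule
`[f α, β] = f [α, β] - (ρ(β) f) α + ⟨α, β⟩ ρ^* df` for the first argument. -/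
structure CourantAlgebroid where
  /-- the anchor `ρ : E → TM` -/
  anchor : ∀ x, E x →ₗ[ℝ] TangentSpace I x
  contMDiff_anchor : ContMDiff (I.prod 𝓘(ℝ, F)) I.tangent ∞
    (fun v : TotalSpace F E => (⟨v.1, anchor v.1 v.2⟩ : TangentBundle I M))
  /-- the fibrewise pairing -/
  pairing : ∀ x, LinearMap.BilinForm ℝ (E x)
  pairing_symm : ∀ x v w, pairing x v w = pairing x w v
  pairing_nondegenerate : ∀ x v, (∀ w, pairing x v w = 0) → v = 0
  contMDiff_pairing : ∀ α β : Cₛ^∞⟮I; F, E⟯,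
    ContMDiff I 𝓘(ℝ, ℝ) ∞ (fun x => pairing x (α x) (β x))
  /-- the bracket on smooth sections -/
  bracket : Cₛ^∞⟮I; F, E⟯ →ₗ[ℝ] Cₛ^∞⟮I; F, E⟯ →ₗ[ℝ] Cₛ^∞⟮I; F, E⟯
  leibniz : ∀ (α β : Cₛ^∞⟮I; F, E⟯) (f : C^∞⟮I, M; ℝ⟯) (x : M),
    bracket α (fsmul f β) x = f x • bracket α β x + mvfderiv I f x (anchor x (α x)) • β x
  jacobi : ∀ α β γ : Cₛ^∞⟮I; F, E⟯,
    bracket (bracket α β) γ + bracket β (bracket α γ) - bracket α (bracket β γ) = 0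
  bracket_pairing : ∀ (α β γ : Cₛ^∞⟮I; F, E⟯) (x : M),
    mvfderiv I (fun y => pairing y (β y) (γ y)) x (anchor x (α x)) =
      pairing x (bracket α β x) (γ x) + pairing x (β x) (bracket α γ x)
  symmetrization : ∀ (α β : Cₛ^∞⟮I; F, E⟯) (x : M) (e : E x),
    pairing x (bracket α β x + bracket β α x) e =
      mvfderiv I (fun y => pairing y (α y) (β y)) x (anchor x e)

end Courant

section Restriction

variable {EB : Type*} [NormedAddCommGroup EB] [NormedSpace ℝ EB]
  {H : Type*} [TopologicalSpace H] (I : ModelWithCorners ℝ EB H)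
  {M : Type*} [TopologicalSpace M] [ChartedSpace H M]

/-- The inclusion of an open subset, as a smooth map. -/
def inclusion (U : Opens M) : C^∞⟮I, U; I, M⟯ := ⟨Subtype.val, contMDiff_subtype_val⟩

/-- The restriction `E|_U` of a bundle to an open subset. -/
abbrev Restrict (U : Opens M) (E : M → Type*) : U → Type _ := (inclusion I U : U → M) *ᵖ E

variable {I} [IsManifold I ∞ M]
  {F : Type*} [NormedAddCommGroup F] [NormedSpace ℝ F]
  {E : M → Type*} [TopologicalSpace (TotalSpace F E)] [∀ x, AddCommGroup (E x)]
  [∀ x, Module ℝ (E x)] [∀ x, TopologicalSpace (E x)] [FiberBundle F E] [VectorBundle ℝ F E]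
  [ContMDiffVectorBundle ∞ F E I]

/-- `CU` is the restriction of the Courant algebroid `C` to the open set `U`: anchor and pairing
are the restrictions of those of `C`, and the bracket is compatible with restriction of sections.
(Brackets being local, there is only one such structure.) -/
structure CourantAlgebroid.IsRestriction (C : CourantAlgebroid I F E) {U : Opens M}
    (CU : CourantAlgebroid I F (Restrict I U E)) : Prop where
  anchor : ∀ (x : U) (v : E x),
    mfderiv I I (Subtype.val : U → M) x (CU.anchor x v) = C.anchor x v
  pairing : ∀ (x : U) (v w : E x), CU.pairing x v w = C.pairing x v w
  bracket : ∀ α β : Cₛ^∞⟮I; F, E⟯,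
    CU.bracket (pullbackSection (inclusion I U) α) (pullbackSection (inclusion I U) β) =
      pullbackSection (inclusion I U) (C.bracket α β)

end Restriction

section Product

variable {EB₁ : Type*} [NormedAddCommGroup EB₁] [NormedSpace ℝ EB₁]
  {H₁ : Type*} [TopologicalSpace H₁] (I₁ : ModelWithCorners ℝ EB₁ H₁)
  {M₁ : Type*} [TopologicalSpace M₁] [ChartedSpace H₁ M₁]
  {EB₂ : Type*} [NormedAddCommGroup EB₂] [NormedSpace ℝ EB₂]
  {H₂ : Type*} [TopologicalSpace H₂] (I₂ : ModelWithCorners ℝ EB₂ H₂)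
  {M₂ : Type*} [TopologicalSpace M₂] [ChartedSpace H₂ M₂]

/-- The product bundle `E₁ × E₂ = π₁^* E₁ ⊕ π₂^* E₂` over `M₁ × M₂`. -/
abbrev BoxProd (E₁ : M₁ → Type*) (E₂ : M₂ → Type*) : M₁ × M₂ → Type _ :=
  ((ContMDiffMap.fst : C^∞⟮I₁.prod I₂, M₁ × M₂; I₁, M₁⟯) : M₁ × M₂ → M₁) *ᵖ E₁ ×ᵇ
    ((ContMDiffMap.snd : C^∞⟮I₁.prod I₂, M₁ × M₂; I₂, M₂⟯) : M₁ × M₂ → M₂) *ᵖ E₂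

variable {I₁ I₂} [IsManifold I₁ ∞ M₁] [IsManifold I₂ ∞ M₂]
  {F₁ : Type*} [NormedAddCommGroup F₁] [NormedSpace ℝ F₁]
  {E₁ : M₁ → Type*} [TopologicalSpace (TotalSpace F₁ E₁)] [∀ x, AddCommGroup (E₁ x)]
  [∀ x, Module ℝ (E₁ x)] [∀ x, TopologicalSpace (E₁ x)] [FiberBundle F₁ E₁]
  [VectorBundle ℝ F₁ E₁] [ContMDiffVectorBundle ∞ F₁ E₁ I₁]
  {F₂ : Type*} [NormedAddCommGroup F₂] [NormedSpace ℝ F₂]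
  {E₂ : M₂ → Type*} [TopologicalSpace (TotalSpace F₂ E₂)] [∀ x, AddCommGroup (E₂ x)]
  [∀ x, Module ℝ (E₂ x)] [∀ x, TopologicalSpace (E₂ x)] [FiberBundle F₂ E₂]
  [VectorBundle ℝ F₂ E₂] [ContMDiffVectorBundle ∞ F₂ E₂ I₂]

/-- The inclusion `Γ(E₁) → Γ(E₁ × E₂)`, `σ ↦ ((p, q) ↦ (σ p, 0))`. -/
def inclFst (σ : Cₛ^∞⟮I₁; F₁, E₁⟯) :
    Cₛ^∞⟮I₁.prod I₂; F₁ × F₂, BoxProd I₁ I₂ E₁ E₂⟯ :=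
  pairSection (pullbackSection ContMDiffMap.fst σ)
    (pullbackSection ContMDiffMap.snd (0 : Cₛ^∞⟮I₂; F₂, E₂⟯))

/-- The inclusion `Γ(E₂) → Γ(E₁ × E₂)`, `τ ↦ ((p, q) ↦ (0, τ q))`. -/
def inclSnd (τ : Cₛ^∞⟮I₂; F₂, E₂⟯) :
    Cₛ^∞⟮I₁.prod I₂; F₁ × F₂, BoxProd I₁ I₂ E₁ E₂⟯ :=
  pairSection (pullbackSection ContMDiffMap.fst (0 : Cₛ^∞⟮I₁; F₁, E₁⟯))
    (pullbackSection ContMDiffMap.snd τ)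

/-- `C` is the direct product of the Courant algebroids `C₁` and `C₂`: its anchor is `ρ₁ × ρ₂`, its
pairing is the product pairing, its bracket restricts to the brackets of `C₁` on `Γ(E₁)` and of
`C₂` on `Γ(E₂)`, and mixed brackets of `Γ(E₁)` and `Γ(E₂)` vanish. (The Leibniz rules then
determine the bracket on all sections of `E₁ × E₂`.) -/
structure CourantAlgebroid.IsDirectProduct
    (C : CourantAlgebroid (I₁.prod I₂) (F₁ × F₂) (BoxProd I₁ I₂ E₁ E₂))
    (C₁ : CourantAlgebroid I₁ F₁ E₁) (C₂ : CourantAlgebroid I₂ F₂ E₂) : Prop where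
  anchor_fst : ∀ (x : M₁ × M₂) (v : E₁ x.1) (w : E₂ x.2),
    mfderiv (I₁.prod I₂) I₁ Prod.fst x (C.anchor x (v, w)) = C₁.anchor x.1 v
  anchor_snd : ∀ (x : M₁ × M₂) (v : E₁ x.1) (w : E₂ x.2),
    mfderiv (I₁.prod I₂) I₂ Prod.snd x (C.anchor x (v, w)) = C₂.anchor x.2 w
  pairing : ∀ (x : M₁ × M₂) (v v' : E₁ x.1) (w w' : E₂ x.2),
    C.pairing x (v, w) (v', w') = C₁.pairing x.1 v v' + C₂.pairing x.2 w w'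
  bracket_fst : ∀ σ σ' : Cₛ^∞⟮I₁; F₁, E₁⟯,
    C.bracket (inclFst σ) (inclFst σ') = inclFst (C₁.bracket σ σ')
  bracket_snd : ∀ τ τ' : Cₛ^∞⟮I₂; F₂, E₂⟯,
    C.bracket (inclSnd τ) (inclSnd τ') = inclSnd (C₂.bracket τ τ')
  bracket_fst_snd : ∀ (σ : Cₛ^∞⟮I₁; F₁, E₁⟯) (τ : Cₛ^∞⟮I₂; F₂, E₂⟯),
    C.bracket (inclFst σ) (inclSnd τ) = 0
  bracket_snd_fst : ∀ (τ : Cₛ^∞⟮I₂; F₂, E₂⟯) (σ : Cₛ^∞⟮I₁; F₁, E₁⟯),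
    C.bracket (inclSnd τ) (inclFst σ) = 0

/-- Isomorphisms of Courant algebroids, over possibly different bases: smooth vector bundle
isomorphisms (the map `fiber` over the diffeomorphism `base`, with `total` the map of total spaces)
which intertwine anchors, pairings and brackets. -/
structure CourantIso (C₁ : CourantAlgebroid I₁ F₁ E₁) (C₂ : CourantAlgebroid I₂ F₂ E₂) where
  base : M₁ ≃ₘ^∞⟮I₁, I₂⟯ M₂
  fiber : ∀ x, E₁ x ≃ₗ[ℝ] E₂ (base x)
  total : TotalSpace F₁ E₁ ≃ₘ^∞⟮I₁.prod 𝓘(ℝ, F₁), I₂.prod 𝓘(ℝ, F₂)⟯ TotalSpace F₂ E₂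
  total_mk : ∀ x v, total ⟨x, v⟩ = ⟨base x, fiber x v⟩
  anchor : ∀ x v, C₂.anchor (base x) (fiber x v) = mfderiv I₁ I₂ base x (C₁.anchor x v)
  pairing : ∀ x v w, C₂.pairing (base x) (fiber x v) (fiber x w) = C₁.pairing x v w
  bracket : ∀ (σ σ' : Cₛ^∞⟮I₁; F₁, E₁⟯) (τ τ' : Cₛ^∞⟮I₂; F₂, E₂⟯),
    (∀ x, τ (base x) = fiber x (σ x)) → (∀ x, τ' (base x) = fiber x (σ' x)) →
      ∀ x, C₂.bracket τ τ' (base x) = fiber x (C₁.bracket σ σ' x)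

end Product

section Standard

variable {EB : Type*} [NormedAddCommGroup EB] [NormedSpace ℝ EB]
  {H : Type*} [TopologicalSpace H] (I : ModelWithCorners ℝ EB H)
  (M : Type*) [TopologicalSpace M] [ChartedSpace H M]

/-- The cotangent bundle `T^*M`. -/
abbrev Cotangent (x : M) : Type _ := TangentSpace I x →L[ℝ] Bundle.Trivial M ℝ x

/-- The generalized tangent bundle `𝕋M = TM ⊕ T^*M`. -/
abbrev GenTangent : M → Type _ := (TangentSpace I : M → Type _) ×ᵇ Cotangent I M

variable {M}

/-- `(L_X β)(Z) = X (β(Z)) - β([X, Z])` at `x`, for a 1-form `β` and vector fields `X`, `Z`. -/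
def lieDerivForm (X : ∀ x : M, TangentSpace I x) (β : ∀ x, Cotangent I M x)
    (Z : ∀ x : M, TangentSpace I x) (x : M) : ℝ :=
  mvfderiv I (fun y => (β y (Z y) : ℝ)) x (X x) - β x (VectorField.mlieBracket I X Z x)

/-- `dα(Y, Z) = Y (α(Z)) - Z (α(Y)) - α([Y, Z])` at `x`, for a 1-form `α` and vector fields
`Y`, `Z`. -/
def extDerivForm (α : ∀ x, Cotangent I M x) (Y Z : ∀ x : M, TangentSpace I x) (x : M) : ℝ :=
  mvfderiv I (fun y => (α y (Z y) : ℝ)) x (Y x) - mvfderiv I (fun y => (α y (Y y) : ℝ)) x (Z x)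
    - α x (VectorField.mlieBracket I Y Z x)

variable {I} [IsManifold I ∞ M]

/-- `C` is the standard Courant algebroid structure on `𝕋M`: the anchor is the projection to `TM`,
the pairing is `⟨X + α, Y + β⟩ = β(X) + α(Y)`, and the bracket is the Courant-Dorfman bracket
`[X + α, Y + β] = [X, Y] + L_X β - i_Y dα`. The 1-form part is tested on vector fields `Z`. -/
structure CourantAlgebroid.IsStandard
    (C : CourantAlgebroid I (EB × (EB →L[ℝ] ℝ)) (GenTangent I M)) : Prop where
  anchor : ∀ (x : M) (v : GenTangent I M x), C.anchor x v = v.1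
  pairing : ∀ (x : M) (v w : GenTangent I M x), C.pairing x v w = w.2 v.1 + v.2 w.1
  bracket_fst : ∀ (σ τ : Cₛ^∞⟮I; EB × (EB →L[ℝ] ℝ), GenTangent I M⟯) (x : M),
    (C.bracket σ τ x).1 = VectorField.mlieBracket I (fun y => (σ y).1) (fun y => (τ y).1) x
  bracket_snd : ∀ (σ τ : Cₛ^∞⟮I; EB × (EB →L[ℝ] ℝ), GenTangent I M⟯)
    (Z : Cₛ^∞⟮I; EB, (TangentSpace I : M → Type _)⟯) (x : M),
    (C.bracket σ τ x).2 (Z x) =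
      lieDerivForm I (fun y => (σ y).1) (fun y => (τ y).2) Z x
        - extDerivForm I (fun y => (σ y).2) (fun y => (τ y).1) Z x

/-- The open interval `(a, b)` as an open subset (hence open submanifold) of `ℝ`. -/
def interval (a b : ℝ) : Opens ℝ := ⟨Set.Ioo a b, isOpen_Ioo⟩

end Standard

/-- An embedded hypersurface of an `n`-dimensional manifold: a subset with the structure of an
`(n - 1)`-dimensional manifold for which the inclusion is a smooth embedding. -/
structure Hypersurface (n : ℕ) (M : Type*) [TopologicalSpace M]
    [ChartedSpace (EuclideanSpace ℝ (Fin n)) M] where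
  carrier : Set M
  dim : ℕ
  dim_add_one : dim + 1 = n
  chartedSpace : ChartedSpace (EuclideanSpace ℝ (Fin dim)) carrier
  isManifold : IsManifold (𝓡 dim) ∞ carrier
  isSmoothEmbedding :
    Manifold.IsSmoothEmbedding (𝓡 dim) (𝓡 n) ∞ (Subtype.val : carrier → M)

attribute [instance] Hypersurface.chartedSpace Hypersurface.isManifold

/-- The hypersurface `S` is transverse to the anchor of `C`: `T_sS + ρ(E_s) = T_sM` on `S`. -/
def Hypersurface.IsTransverse {n : ℕ} {M : Type*} [TopologicalSpace M]
    [ChartedSpace (EuclideanSpace ℝ (Fin n)) M] [IsManifold (𝓡 n) ∞ M]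
    {F : Type*} [NormedAddCommGroup F] [NormedSpace ℝ F]
    {E : M → Type*} [TopologicalSpace (TotalSpace F E)] [∀ x, AddCommGroup (E x)]
    [∀ x, Module ℝ (E x)] [∀ x, TopologicalSpace (E x)] [FiberBundle F E] [VectorBundle ℝ F E]
    [ContMDiffVectorBundle ∞ F E (𝓡 n)]
    (S : Hypersurface n M) (C : CourantAlgebroid (𝓡 n) F E) : Prop :=
  ∀ s : S.carrier,
    (mfderiv (𝓡 S.dim) (𝓡 n) (Subtype.val : S.carrier → M) s).range ⊔ (C.anchor s.1).range = ⊤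

end CourantSplitting

end

/-! This is a flow box theorem with a bracket. Write `ρ*df` for the gradient of `f`, the section
dual under the pairing to `e ↦ df(ρ(e))`. The Jacobi identity alone gives two facts: the anchor
respects brackets, and a symmetrized bracket `[α, β] + [β, α]` brackets to zero from the left, hence
differentiates every function to zero wherever some section is nonzero. If `⟨α, γ⟩ = 1` near `p`,
then `ρ*df` is there the symmetrized bracket of `α` and `fγ`. So gradients exist locally, are
isotropic, lie in the kernel of the anchor and are central on the left (`exists_gradient`).

Take a section with nonzero anchor at `p` and subtract a multiple of a gradient to make it
isotropic; call it `A`. Straighten `ρ(A)` to `∂_t` and put `B = ρ*dt`. Then `A` and `B` form a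
hyperbolic pair, with `[A, A] = [A, B] = 0` and `[B, ·] = 0`. Differentiating orthogonality
relations along `A` shows that the complement of `A, B` is stable under `[A, ·]`. On a frame of this
complement, `[A, ·]` is a first order linear operator in `t`, so solving a linear ordinary
differential equation gives a frame `e_i` with `[A, e_i] = 0` (`exists_adapted_frame`).

Call a section transversal if it is orthogonal to `A` and `B` and commutes with `A`. By Jacobi,
transversal sections are closed under the bracket. Their pairings, and their derivatives of
functions independent of `t`, are independent of `t`; their coefficients in the `e_i` are too. Hence
they are exactly the sections of a trivial bundle over the slice `t = 0`, which thereby becomes a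
Courant algebroid. The combinations of `A` and `B` over functions of `t` reproduce the standard
Courant algebroid of an interval, and commute with transversal sections.

In the formalization, the algebroid near `p` is carried to the product bundle by matching frames
(`CourantAlgebroid.transport`). Both factors are then cut out of it as spaces of sections closed
under the bracket (`Descent`). The analytic input, a smooth local flow, is obtained from the inverse
function theorem on a Banach space of paths (`exists_smooth_flow`). -/

noncomputable section

set_option linter.unusedSectionVars false

namespace CourantSplitting

/-! ### Superposition operators on spaces of continuous maps. -/

section Nemytskii

set_option synthInstance.maxHeartbeats 200000

universe u v
variable {K : Type v} [TopologicalSpace K] [CompactSpace K]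

/-- A continuous family of continuous linear maps, as an operator between spaces of continuous
maps. -/
def pointwiseCLM (E F : Type*) [NormedAddCommGroup E] [NormedSpace ℝ E] [NormedAddCommGroup F]
    [NormedSpace ℝ F] : C(K, E →L[ℝ] F) →L[ℝ] C(K, E) →L[ℝ] C(K, F) :=
  LinearMap.mkContinuous₂
    (LinearMap.mk₂ ℝ (fun (a : C(K, E →L[ℝ] F)) (γ : C(K, E)) =>
        (⟨fun t => a t (γ t), by fun_prop⟩ : C(K, F)))
      (fun a a' γ => by ext; simp) (fun c a γ => by ext; simp) (fun a γ γ' => by ext; simp)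
      (fun c a γ => by ext; simp)) 1 (fun (a : C(K, E →L[ℝ] F)) (γ : C(K, E)) => by
        rw [ContinuousMap.norm_le _ (by positivity)]
        intro t
        simp only [one_mul]
        exact (a t).le_of_opNorm_le_of_le (a.norm_coe_le_norm t) (γ.norm_coe_le_norm t))

/-- The mean value inequality is applied at each point of `K`. The estimate is uniform over `K`
because superposition with the derivative of `f` is continuous in the sup norm. -/
theorem hasFDerivAt_comp_continuousMap {E F : Type*} [NormedAddCommGroup E] [NormedSpace ℝ E]
    [NormedAddCommGroup F] [NormedSpace ℝ F] {f : E → F} (hf : ContDiff ℝ 1 f) (γ : C(K, E)) :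
    HasFDerivAt (fun γ : C(K, E) => (⟨f, hf.continuous⟩ : C(E, F)).comp γ)
      (pointwiseCLM E F ((⟨fderiv ℝ f, hf.continuous_fderiv one_ne_zero⟩ : C(E, E →L[ℝ] F)).comp γ))
      γ := by
  set f' : C(E, E →L[ℝ] F) := ⟨fderiv ℝ f, hf.continuous_fderiv one_ne_zero⟩
  rw [hasFDerivAt_iff_isLittleO, Asymptotics.isLittleO_iff]
  intro c hc
  have hcont : Continuous fun γ : C(K, E) => f'.comp γ := f'.continuous_postcomp
  obtain ⟨δ, hδ, H⟩ := (Metric.continuousAt_iff (f := fun γ : C(K, E) => f'.comp γ)).1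
    hcont.continuousAt c hc
  filter_upwards [Metric.ball_mem_nhds γ hδ] with η hη
  rw [ContinuousMap.norm_le _ (by positivity)]
  intro t
  have key : ∀ x ∈ segment ℝ (γ t) (η t), ‖fderiv ℝ f x - fderiv ℝ f (γ t)‖ ≤ c := by
    rintro _ ⟨a, b, ha, hb, hab, rfl⟩
    -- The intermediate point is a value of the whole path `a • γ + b • η`, which stays in the ball
    -- around `γ`. This is where uniformity in `t` comes from.
    have h1 : dist (a • γ + b • η) γ < δ := by
      have : a • γ + b • η - γ = b • (η - γ) := by
        have : a = 1 - b := by linarith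
        subst this; module
      rw [dist_eq_norm, this, norm_smul, Real.norm_of_nonneg hb, ← dist_eq_norm]
      exact (mul_le_of_le_one_left dist_nonneg (by linarith)).trans_lt hη
    have h2 := (ContinuousMap.dist_lt_iff hc).1 (H h1) t
    rw [dist_eq_norm] at h2
    exact h2.le
  have := (convex_segment (γ t) (η t)).norm_image_sub_le_of_norm_hasFDerivWithin_le'
    (φ := fderiv ℝ f (γ t)) (fun x _ => (hf.differentiable one_ne_zero x).hasFDerivAt.hasFDerivWithinAt)
    key (left_mem_segment ..) (right_mem_segment ..)
  refine this.trans ?_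
  gcongr
  exact (η - γ).norm_coe_le_norm t

/-- The superposition operator `γ ↦ f ∘ γ` on continuous maps is smooth if `f` is. -/
theorem contDiff_comp_continuousMap {E F : Type u} [NormedAddCommGroup E] [NormedSpace ℝ E]
    [NormedAddCommGroup F] [NormedSpace ℝ F] {f : E → F} (hf : ContDiff ℝ ∞ f) :
    ContDiff ℝ ∞ (fun γ : C(K, E) => (⟨f, hf.continuous⟩ : C(E, F)).comp γ) := by
  -- The induction runs over all targets at once, since the derivative takes values in `E →L[ℝ] F`;
  -- this is why `E` and `F` share a universe.
  have main : ∀ (n : ℕ) {F : Type u} [NormedAddCommGroup F] [NormedSpace ℝ F] {f : E → F}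
      (hf : ContDiff ℝ ∞ f),
      ContDiff ℝ n (fun γ : C(K, E) => (⟨f, hf.continuous⟩ : C(E, F)).comp γ) := by
    intro n
    induction n with
    | zero =>
      intro F _ _ f hf
      exact contDiff_zero.2 (ContinuousMap.continuous_postcomp _)
    | succ n ih =>
      intro F _ _ f hf
      rw [Nat.cast_add, Nat.cast_one, contDiff_succ_iff_hasFDerivAt]
      refine ⟨_, ?_, fun γ => hasFDerivAt_comp_continuousMap (hf.of_le (by simp)) γ⟩
      exact (pointwiseCLM E F).contDiff.comp (ih (hf.fderiv_right (m := ∞) (by simp)))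
  exact contDiff_infty.2 fun n => main n hf

end Nemytskii

/-! ### Smooth dependence of integral curves on time and initial value. -/

section Flow

set_option synthInstance.maxHeartbeats 200000

variable {E : Type*} [NormedAddCommGroup E] [NormedSpace ℝ E]

/-- The closed interval `[-1, 1]`. -/
abbrev SymmInterval := Set.Icc (-1 : ℝ) 1

/-- Extension of a path on `[-1, 1]` by constants. -/
abbrev extendPath (γ : C(SymmInterval, E)) : ℝ → E := Set.IccExtend (by norm_num : (-1 : ℝ) ≤ 1) γ

/-- Integration from `0`, as an operator on paths. -/
def primitive : C(SymmInterval, E) →L[ℝ] C(SymmInterval, E) :=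
  LinearMap.mkContinuous
    { toFun := fun γ => ⟨fun t => ∫ s in (0 : ℝ)..t, extendPath γ s,
        (intervalIntegral.continuous_primitive
          (fun a b => (γ.continuous.Icc_extend' (h := _)).intervalIntegrable a b) 0).comp
            continuous_subtype_val⟩
      map_add' := fun γ η => by
        ext t
        exact intervalIntegral.integral_add ((γ.continuous.Icc_extend' (h := _)).intervalIntegrable ..)
          ((η.continuous.Icc_extend' (h := _)).intervalIntegrable ..)
      map_smul' := fun c γ => by
        ext t
        exact intervalIntegral.integral_smul c _ } 1 (fun γ => by
    rw [ContinuousMap.norm_le _ (by positivity)]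
    intro t
    have := intervalIntegral.norm_integral_le_of_norm_le_const (a := 0) (b := t) (C := ‖γ‖)
      (f := extendPath γ) (fun s _ => γ.norm_coe_le_norm _)
    refine this.trans ?_
    rw [one_mul, sub_zero]
    exact mul_le_of_le_one_right (norm_nonneg _) (abs_le.2 t.2))

theorem primitive_apply (γ : C(SymmInterval, E)) (t : SymmInterval) :
    primitive γ t = ∫ s in (0 : ℝ)..t, extendPath γ s := rfl

/-- Multiplication by `τ ∈ [-1, 1]` on `[-1, 1]`. -/
def scaleInterval (τ : SymmInterval) : C(SymmInterval, SymmInterval) :=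
  ⟨fun s => ⟨τ * s, by
    have h1 : |(τ : ℝ) * s| ≤ 1 := by
      rw [abs_mul]; exact mul_le_one₀ (abs_le.2 τ.2) (abs_nonneg _) (abs_le.2 s.2)
    exact abs_le.1 h1⟩, by fun_prop⟩

/-- Substitution in the integral. It expresses that slowing down an integral curve of `f` by the
factor `τ` gives an integral curve of `τ • f`. -/
theorem primitive_comp_scaleInterval (γ : C(SymmInterval, E)) (τ : SymmInterval) :
    (τ : ℝ) • primitive (γ.comp (scaleInterval τ)) = (primitive γ).comp (scaleInterval τ) := by
  ext s
  rw [ContinuousMap.smul_apply, ContinuousMap.comp_apply, primitive_apply, primitive_apply]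
  have h : ∀ r ∈ Set.uIcc (0 : ℝ) s, extendPath (γ.comp (scaleInterval τ)) r = extendPath γ (τ * r) := by
    intro r hr
    have hr' : r ∈ SymmInterval := by
      have h0 : (0 : ℝ) ∈ SymmInterval := by norm_num
      exact Set.uIcc_subset_Icc h0 s.2 hr
    have hr'' : (τ : ℝ) * r ∈ SymmInterval := (scaleInterval τ ⟨r, hr'⟩).2
    rw [extendPath, Set.IccExtend_of_mem _ _ hr', extendPath, Set.IccExtend_of_mem _ _ hr'']
    rfl
  rw [intervalIntegral.integral_congr h, intervalIntegral.smul_integral_comp_mul_left, mul_zero]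
  rfl

/-- The map whose zeros in the second component are the integral curves of `p.1.1 • f` starting at
`p.1.2`. -/
def picardMap (f : C(E, E)) (p : (ℝ × E) × C(SymmInterval, E)) : (ℝ × E) × C(SymmInterval, E) :=
  (p.1, p.2 - ContinuousLinearMap.const ℝ SymmInterval p.1.2 - p.1.1 • primitive (f.comp p.2))

theorem picardMap_eq_iff {f : C(E, E)} {p : (ℝ × E) × C(SymmInterval, E)} {q : ℝ × E} :
    picardMap f p = (q, 0) ↔ p.1 = q ∧ p.2 = ContinuousMap.const SymmInterval q.2 +
      q.1 • primitive (f.comp p.2) := by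
  constructor
  · intro h
    obtain ⟨h1, h2⟩ := Prod.ext_iff.1 h
    obtain rfl : p.1 = q := h1
    refine ⟨rfl, ?_⟩
    have h3 : p.2 - ContinuousMap.const SymmInterval p.1.2 - p.1.1 • primitive (f.comp p.2) = 0 := h2
    rwa [sub_sub, sub_eq_zero] at h3
  · rintro ⟨rfl, h⟩
    refine Prod.ext rfl ?_
    change p.2 - ContinuousMap.const SymmInterval p.1.2 - p.1.1 • primitive (f.comp p.2) = 0
    rwa [sub_sub, sub_eq_zero]

theorem contDiff_picardMap {f : C(E, E)} (hf : ContDiff ℝ ∞ f) :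
    ContDiff ℝ ∞ (picardMap f) := by
  have h1 : ContDiff ℝ ∞ (fun γ : C(SymmInterval, E) => f.comp γ) := contDiff_comp_continuousMap hf
  refine contDiff_fst.prodMk (.sub (.sub contDiff_snd ?_) (ContDiff.smul
    (f := fun p : (ℝ × E) × C(SymmInterval, E) => p.1.1)
    (g := fun p => primitive (f.comp p.2)) ?_ ?_))
  · exact (ContinuousLinearMap.const ℝ SymmInterval : E →L[ℝ] C(SymmInterval, E)).contDiff.comp
      (contDiff_snd.comp contDiff_fst)
  · exact contDiff_fst.comp contDiff_fst
  · exact (primitive (E := E)).contDiff.comp (h1.comp contDiff_snd)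

/-- The shear `(q, γ) ↦ (q, γ - A q)`. -/
def shear {V W : Type*} [NormedAddCommGroup V] [NormedSpace ℝ V] [NormedAddCommGroup W]
    [NormedSpace ℝ W] (A : V →L[ℝ] W) : (V × W) ≃L[ℝ] (V × W) :=
  ContinuousLinearEquiv.equivOfInverse
    ((ContinuousLinearMap.fst ℝ V W).prod
      (ContinuousLinearMap.snd ℝ V W - A.comp (ContinuousLinearMap.fst ℝ V W)))
    ((ContinuousLinearMap.fst ℝ V W).prod
      (ContinuousLinearMap.snd ℝ V W + A.comp (ContinuousLinearMap.fst ℝ V W)))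
    (fun p => by ext <;> simp) (fun p => by ext <;> simp)

/-- At time parameter `0` the integral term carries the factor `0`, so the derivative of `f` drops
out. What is left is a shear, invertible whatever `f` is, and the inverse function theorem applies
without any smallness condition. -/
theorem hasFDerivAt_picardMap {f : C(E, E)} (hf : ContDiff ℝ ∞ f) (x₀ : E) (γ : C(SymmInterval, E)) :
    HasFDerivAt (picardMap f)
      (shear ((ContinuousLinearMap.const ℝ SymmInterval).comp (ContinuousLinearMap.snd ℝ ℝ E) +
        (ContinuousLinearMap.fst ℝ ℝ E).smulRight (primitive (f.comp γ))) :
        ((ℝ × E) × C(SymmInterval, E)) →L[ℝ] ((ℝ × E) × C(SymmInterval, E))) ((0, x₀), γ) := by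
  have h1 : ContDiff ℝ ∞ (fun γ : C(SymmInterval, E) => f.comp γ) := contDiff_comp_continuousMap hf
  have h2 := (h1.differentiable (by simp) γ).hasFDerivAt
  have h3 : HasFDerivAt (fun p : (ℝ × E) × C(SymmInterval, E) => primitive (f.comp p.2)) _
      ((0, x₀), γ) :=
    HasFDerivAt.comp (f := fun p : (ℝ × E) × C(SymmInterval, E) => f.comp p.2)
      (((0 : ℝ), x₀), γ) (primitive (E := E)).hasFDerivAt
      (HasFDerivAt.comp (f := fun p : (ℝ × E) × C(SymmInterval, E) => p.2) (((0 : ℝ), x₀), γ) h2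
        hasFDerivAt_snd)
  have h4 : HasFDerivAt (fun p : (ℝ × E) × C(SymmInterval, E) => p.1.1)
      ((ContinuousLinearMap.fst ℝ ℝ E).comp (ContinuousLinearMap.fst ℝ _ _)) ((0, x₀), γ) :=
    ((ContinuousLinearMap.fst ℝ ℝ E).comp
      (ContinuousLinearMap.fst ℝ (ℝ × E) C(SymmInterval, E))).hasFDerivAt
  have h5 : HasFDerivAt (fun p : (ℝ × E) × C(SymmInterval, E) =>
      (ContinuousLinearMap.const ℝ SymmInterval p.1.2 : C(SymmInterval, E)))
      (((ContinuousLinearMap.const ℝ SymmInterval : E →L[ℝ] C(SymmInterval, E)).comp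
        (ContinuousLinearMap.snd ℝ ℝ E)).comp (ContinuousLinearMap.fst ℝ _ _)) ((0, x₀), γ) :=
    (((ContinuousLinearMap.const ℝ SymmInterval : E →L[ℝ] C(SymmInterval, E)).comp
      (ContinuousLinearMap.snd ℝ ℝ E)).comp
        (ContinuousLinearMap.fst ℝ (ℝ × E) C(SymmInterval, E))).hasFDerivAt
  refine (hasFDerivAt_fst.prodMk ((hasFDerivAt_snd.sub h5).sub (h4.smul h3))).congr_fderiv ?_
  refine ContinuousLinearMap.ext fun p => Prod.ext rfl ?_
  simp [shear, ContinuousLinearEquiv.equivOfInverse]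
  abel

variable [CompleteSpace E]

/-- A smooth vector field has a smooth local flow. -/
theorem exists_smooth_flow {f : E → E} (hf : ContDiff ℝ ∞ f) (x₀ : E) :
    ∃ φ : ℝ × E → E, (∀ᶠ p in nhds (0, x₀), ContDiffAt ℝ ∞ φ p) ∧
      (∀ᶠ x in nhds x₀, φ (0, x) = x) ∧
      ∀ᶠ p in nhds ((0 : ℝ), x₀), HasDerivAt (fun t => φ (t, p.2)) (f (φ p)) p.1 := by
  let g : C(E, E) := ⟨f, hf.continuous⟩
  let γ₀ : C(SymmInterval, E) := ContinuousMap.const _ x₀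
  have hG := contDiff_picardMap (f := g) hf
  have hG' := hasFDerivAt_picardMap (f := g) hf x₀ γ₀
  have hG0 : picardMap g ((0, x₀), γ₀) = ((0, x₀), 0) := by
    rw [picardMap_eq_iff]; simp [γ₀]
  let h := hG.contDiffAt.toOpenPartialHomeomorph (picardMap g) hG' (by simp)
  have hh : ∀ p, h p = picardMap g p := fun _ => rfl
  have hsrc : ((0, x₀), γ₀) ∈ h.source := hG.contDiffAt.mem_toOpenPartialHomeomorph_source hG' (by simp)
  have htgt : ((0, x₀), (0 : C(SymmInterval, E))) ∈ h.target := by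
    rw [← hG0]; exact h.map_source hsrc
  have hsymm0 : h.symm ((0, x₀), 0) = ((0, x₀), γ₀) := by
    rw [← hG0]; exact h.left_inv hsrc
  -- The inverse is smooth wherever the derivative of `picardMap` is invertible. This is an open
  -- condition, so smoothness holds near the base point and not only at it.
  have hsmooth : ∀ᶠ q in nhds ((0, x₀), (0 : C(SymmInterval, E))), ContDiffAt ℝ ∞ h.symm q := by
    have hopen := ContinuousLinearEquiv.isOpen (𝕜 := ℝ) (E := (ℝ × E) × C(SymmInterval, E))
      (F := (ℝ × E) × C(SymmInterval, E))
    have hc : ContinuousAt (fun q => fderiv ℝ (picardMap g) (h.symm q)) ((0, x₀), 0) :=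
      ContinuousAt.comp (hG.continuous_fderiv (by simp)).continuousAt (h.continuousAt_symm htgt)
    have hmem := hc.preimage_mem_nhds (hopen.mem_nhds ⟨_, by rw [hsymm0]; exact hG'.fderiv.symm⟩)
    filter_upwards [hmem, h.open_target.mem_nhds htgt] with q ⟨e, he⟩ hq
    refine h.contDiffAt_symm (f₀' := e) hq ?_ hG.contDiffAt
    rw [he]
    exact (hG.differentiable (by simp) _).hasFDerivAt
  let ι : ℝ × E → (ℝ × E) × C(SymmInterval, E) := fun p => (p, 0)
  have hι : ContDiff ℝ ∞ ι := contDiff_id.prodMk contDiff_const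
  let γ : ℝ × E → C(SymmInterval, E) := fun p => (h.symm (ι p)).2
  have one_mem : (1 : ℝ) ∈ SymmInterval := by norm_num
  have hγ : ∀ᶠ p in nhds (0, x₀), ContDiffAt ℝ ∞ γ p :=
    (hι.continuous.continuousAt.eventually hsmooth).mono fun p hp =>
      contDiffAt_snd.comp _ (hp.comp _ hι.contDiffAt)
  have hγ0 : γ (0, x₀) = γ₀ := congrArg Prod.snd hsymm0
  have heq : ∀ p : ℝ × E, ι p ∈ h.target → γ p = ContinuousMap.const SymmInterval p.2 +
      p.1 • primitive (g.comp (γ p)) ∧ h.symm (ι p) = (p, γ p) := by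
    intro p hp
    obtain ⟨h1, h2⟩ := picardMap_eq_iff.1 (h.right_inv hp)
    exact ⟨h2, Prod.ext h1 rfl⟩
  have htgt' : ∀ᶠ p in nhds (0, x₀), ι p ∈ h.target :=
    hι.continuous.continuousAt.eventually (h.open_target.mem_nhds htgt)
  -- The path with parameter `τ` solves the equation for `τ • f`, so its value at time `1` is the
  -- flow of `f` at time `τ`.
  refine ⟨fun p => γ p ⟨1, one_mem⟩, ?_, ?_, ?_⟩
  · filter_upwards [hγ] with p hp
    exact (ContinuousMap.evalCLM ℝ (⟨1, one_mem⟩ : SymmInterval)).contDiff.contDiffAt.comp _ hp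
  · have : Filter.Tendsto (fun x : E => ((0 : ℝ), x)) (nhds x₀) (nhds (0, x₀)) :=
      (by fun_prop : Continuous fun x : E => ((0 : ℝ), x)).continuousAt
    filter_upwards [this.eventually htgt'] with x hx
    rw [(heq _ hx).1]; simp
  · obtain ⟨δ, hδ, hball⟩ := Metric.isOpen_iff.1 h.open_source _ hsrc
    have hcont : ContinuousAt γ (0, x₀) := hγ.self_of_nhds.continuousAt
    have hnear : ∀ᶠ p in nhds (0, x₀), ι p ∈ h.target ∧ dist (γ p) γ₀ < δ := by
      refine htgt'.and (hcont.eventually (p := fun η => dist η γ₀ < δ) ?_)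
      rw [hγ0]; exact Metric.ball_mem_nhds _ hδ
    obtain ⟨η, hη, hnear⟩ := Metric.eventually_nhds_iff.1 hnear
    -- Strictly below both radii: `η`, within which the paths solve the equation and are close to
    -- the constant path, and `δ`, within which `h` is injective.
    set ε := min η δ / 2 with hε
    have hεpos : 0 < ε := by positivity
    have hεη : ε < η := by have := min_le_left η δ; linarith
    have hεδ : ε < δ := by have := min_le_right η δ; have := lt_min hη hδ; linarith
    -- The rescaled path solves the equation with parameter `ε * τ` and lies in the source of `h`,
    -- so injectivity identifies it with `γ (ε * τ, x)`.
    have repar : ∀ x, dist x x₀ < ε → ∀ τ : SymmInterval,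
        γ (ε * τ, x) = (γ (ε, x)).comp (scaleInterval τ) := by
      intro x hx τ
      have hτ : |(τ : ℝ)| ≤ 1 := abs_le.2 τ.2
      have habs : |ε * τ| ≤ ε := by
        rw [abs_mul, abs_of_pos hεpos]; exact mul_le_of_le_one_right hεpos.le hτ
      have hq : dist (ε * (τ : ℝ), x) ((0 : ℝ), x₀) < η := by
        rw [Prod.dist_eq, max_lt_iff, Real.dist_eq, sub_zero]
        exact ⟨habs.trans_lt hεη, hx.trans hεη⟩
      have hp : dist (ε, x) ((0 : ℝ), x₀) < η := by
        rw [Prod.dist_eq, max_lt_iff, Real.dist_eq, sub_zero, abs_of_pos hεpos]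
        exact ⟨hεη, hx.trans hεη⟩
      obtain ⟨e1, -⟩ := heq _ (hnear hp).1
      obtain ⟨-, e2⟩ := heq _ (hnear hq).1
      have hmem : ((ε * (τ : ℝ), x), (γ (ε, x)).comp (scaleInterval τ)) ∈ h.source := by
        apply hball
        rw [Metric.mem_ball, Prod.dist_eq, max_lt_iff, Prod.dist_eq, max_lt_iff, Real.dist_eq,
          sub_zero, ContinuousMap.dist_lt_iff hδ]
        refine ⟨⟨habs.trans_lt hεδ, hx.trans hεδ⟩, fun s => ?_⟩
        exact (ContinuousMap.dist_lt_iff hδ).1 (hnear hp).2 (scaleInterval τ s)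
      have hval : h ((ε * (τ : ℝ), x), (γ (ε, x)).comp (scaleInterval τ)) = ι (ε * τ, x) := by
        rw [hh, picardMap_eq_iff]
        refine ⟨rfl, ?_⟩
        change (γ (ε, x)).comp (scaleInterval τ) = _ + (ε * (τ : ℝ)) •
          primitive ((g.comp (γ (ε, x))).comp (scaleInterval τ))
        rw [mul_smul, primitive_comp_scaleInterval]
        conv_lhs => rw [e1]
        rfl
      have := h.left_inv hmem
      rw [hval, e2] at this
      exact congrArg Prod.snd this
    have hU : {p : ℝ × E | dist p (0, x₀) < ε} ∈ nhds ((0 : ℝ), x₀) := Metric.ball_mem_nhds _ hεpos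
    filter_upwards [hU] with p hp
    replace hp : dist p (0, x₀) < ε := hp
    rw [Prod.dist_eq, max_lt_iff, Real.dist_eq, sub_zero] at hp
    obtain ⟨hp1, hp2⟩ := hp
    set x := p.2
    have hεx : dist (ε, x) ((0 : ℝ), x₀) < η := by
      rw [Prod.dist_eq, max_lt_iff, Real.dist_eq, sub_zero, abs_of_pos hεpos]
      exact ⟨hεη, hp2.trans hεη⟩
    obtain ⟨e1, -⟩ := heq _ (hnear hεx).1
    -- All values of the flow from `x` are now read off the single path `γ (ε, x)`, whose integral
    -- equation is differentiated by the fundamental theorem of calculus.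
    have formula : ∀ t : ℝ, |t| < ε → γ (t, x) ⟨1, one_mem⟩ =
        x + ε • ∫ s in (0 : ℝ)..(t / ε), extendPath (g.comp (γ (ε, x))) s ∧
        γ (t, x) ⟨1, one_mem⟩ = extendPath (γ (ε, x)) (t / ε) := by
      intro t ht
      have hτ : t / ε ∈ SymmInterval := by
        refine abs_le.1 ?_
        rw [abs_div, abs_of_pos hεpos, div_le_one hεpos]; exact ht.le
      have h1 := repar x hp2 ⟨t / ε, hτ⟩
      have h2 : ε * (t / ε) = t := by field_simp
      simp only [h2] at h1
      have h3 : scaleInterval ⟨t / ε, hτ⟩ ⟨1, one_mem⟩ = ⟨t / ε, hτ⟩ := Subtype.ext (mul_one _)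
      constructor
      · rw [h1, ContinuousMap.comp_apply, h3]
        conv_lhs => rw [e1]
        rfl
      · rw [h1, ContinuousMap.comp_apply, h3, extendPath, Set.IccExtend_of_mem _ _ hτ]
    have hcts : Continuous (extendPath (g.comp (γ (ε, x)))) :=
      (g.comp (γ (ε, x))).continuous.Icc_extend'
    have hder : HasDerivAt (fun t : ℝ => x + ε • ∫ s in (0 : ℝ)..(t / ε),
        extendPath (g.comp (γ (ε, x))) s) (extendPath (g.comp (γ (ε, x))) (p.1 / ε)) p.1 := by
      have h1 := intervalIntegral.integral_hasDerivAt_right (hcts.intervalIntegrable 0 (p.1 / ε))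
        (hcts.stronglyMeasurableAtFilter _ _) hcts.continuousAt
      have h2 := (h1.scomp p.1 ((hasDerivAt_id p.1).div_const ε)).const_smul ε |>.const_add x
      refine h2.congr_deriv ?_
      rw [smul_smul, mul_one_div_cancel hεpos.ne', one_smul]
    have hev : (fun t => γ (t, x) ⟨1, one_mem⟩) =ᶠ[nhds p.1] fun t : ℝ => x + ε •
        ∫ s in (0 : ℝ)..(t / ε), extendPath (g.comp (γ (ε, x))) s := by
      filter_upwards [(isOpen_lt continuous_abs continuous_const).mem_nhds hp1] with t ht
      exact (formula t ht).1
    refine (hder.congr_of_eventuallyEq hev).congr_deriv ?_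
    change _ = f (γ (p.1, x) ⟨1, one_mem⟩)
    rw [(formula p.1 hp1).2]
    rfl

end Flow

/-! ### Straightening vector fields, and linear equations with parameters, in vector spaces. -/

section FlowBox

variable {V W : Type*} [NormedAddCommGroup V] [NormedSpace ℝ V] [FiniteDimensional ℝ V]
  [NormedAddCommGroup W] [NormedSpace ℝ W] [FiniteDimensional ℝ W]

/-- Flow box theorem: a nonvanishing smooth vector field can be straightened. -/
theorem exists_flowBox (hVW : Module.finrank ℝ (ℝ × W) = Module.finrank ℝ V) {f : V → V}
    (hf : ContDiff ℝ ∞ f) {x₀ : V} (hx₀ : f x₀ ≠ 0) :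
    ∃ Ψ : OpenPartialHomeomorph V (ℝ × W), x₀ ∈ Ψ.source ∧ Ψ x₀ = 0 ∧
      ContDiffOn ℝ ∞ Ψ Ψ.source ∧ ContDiffOn ℝ ∞ Ψ.symm Ψ.target ∧
      ∀ x ∈ Ψ.source, fderiv ℝ Ψ x (f x) = (1, 0) := by
  have : CompleteSpace V := FiniteDimensional.complete ℝ V
  have : CompleteSpace W := FiniteDimensional.complete ℝ W
  obtain ⟨φ, hφ, hφ0, hφt⟩ := exists_smooth_flow hf x₀
  let L₀ : (ℝ × W) ≃L[ℝ] V := ContinuousLinearEquiv.ofFinrankEq hVW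
  have hL₀ : L₀ (1, 0) ≠ 0 := by
    rw [Ne, EmbeddingLike.map_eq_zero_iff]; simp
  -- Some automorphism carries a given nonzero vector to any other, so the linear isomorphism can be
  -- normalized to send `(1, 0)` to `f x₀`.
  obtain ⟨A, hA⟩ := SeparatingDual.exists_continuousLinearEquiv_apply_eq (R := ℝ) hL₀ hx₀
  let L : (ℝ × W) ≃L[ℝ] V := L₀.trans A
  have hL : L (1, 0) = f x₀ := hA
  -- The flow is started on the affine hyperplane `x₀ + L (0, W)`, which is transverse to `f x₀`.
  let g : ℝ × W → ℝ × V := fun q => (q.1, x₀ + L (0, q.2))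
  have hg : ContDiff ℝ ∞ g := by fun_prop
  have hg0 : g 0 = (0, x₀) := by simp [g, ← Prod.zero_eq_mk]
  let Φ : ℝ × W → V := fun q => φ (g q)
  have hgt : Filter.Tendsto g (nhds 0) (nhds (0, x₀)) := by
    rw [← hg0]; exact hg.continuous.continuousAt
  have hΦ : ∀ᶠ q in nhds 0, ContDiffAt ℝ ∞ Φ q :=
    (hgt.eventually hφ).mono fun q hq => hq.comp q hg.contDiffAt
  have hΦt : ∀ᶠ q in nhds (0 : ℝ × W), fderiv ℝ Φ q (1, 0) = f (Φ q) := by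
    filter_upwards [hΦ, hgt.eventually hφt] with q hq hqt
    have h1 : HasDerivAt (fun t : ℝ => (t, q.2)) ((1 : ℝ), (0 : W)) q.1 :=
      (hasDerivAt_id q.1).prodMk (hasDerivAt_const _ _)
    have h2 := HasFDerivAt.comp_hasDerivAt (f := fun t : ℝ => (t, q.2)) q.1
      (hq.differentiableAt (by simp)).hasFDerivAt h1
    exact h2.unique hqt
  have hΦ0 : Φ 0 = x₀ := by
    change φ (g 0) = x₀
    rw [hg0]; exact hφ0.self_of_nhds
  -- The derivative is computed on the two summands: in the time direction it is the value of the
  -- field, in the direction of `W` it comes from the initial condition.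
  have hD : HasFDerivAt Φ (L : (ℝ × W) →L[ℝ] V) 0 := by
    have h1 := (hΦ.self_of_nhds.differentiableAt (by simp)).hasFDerivAt
    refine h1.congr_fderiv (ContinuousLinearMap.prod_ext ?_ ?_)
    · ext
      change fderiv ℝ Φ 0 (1, 0) = L (1, 0)
      rw [hΦt.self_of_nhds, hΦ0, hL]
    · have h2 : HasFDerivAt (fun w : W => Φ (0, w)) ((fderiv ℝ Φ 0).comp (.inr ℝ ℝ W)) 0 :=
        HasFDerivAt.comp (f := fun w : W => ((0 : ℝ), w)) 0 h1 (ContinuousLinearMap.inr ℝ ℝ W).hasFDerivAt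
      have h3 : HasFDerivAt (fun w : W => x₀ + L (0, w))
          ((L : (ℝ × W) →L[ℝ] V).comp (.inr ℝ ℝ W)) 0 :=
        ((L : (ℝ × W) →L[ℝ] V).comp (.inr ℝ ℝ W)).hasFDerivAt.const_add x₀
      refine h2.unique (h3.congr_of_eventuallyEq ?_)
      have : Filter.Tendsto (fun w : W => x₀ + L (0, w)) (nhds 0) (nhds x₀) := by
        have : Continuous fun w : W => x₀ + L (0, w) := by fun_prop
        simpa [← Prod.zero_eq_mk] using this.tendsto 0
      exact this.eventually hφ0
  let h := hΦ.self_of_nhds.toOpenPartialHomeomorph Φ hD (by simp)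
  have hsrc : (0 : ℝ × W) ∈ h.source := hΦ.self_of_nhds.mem_toOpenPartialHomeomorph_source hD (by simp)
  have hinv : ∀ᶠ q in nhds (0 : ℝ × W), ∃ e : (ℝ × W) ≃L[ℝ] V, (e : (ℝ × W) →L[ℝ] V) = fderiv ℝ Φ q := by
    have hc : ContinuousAt (fderiv ℝ Φ) 0 :=
      (hΦ.self_of_nhds.fderiv_right (m := ∞) (by simp)).continuousAt
    exact hc.preimage_mem_nhds (ContinuousLinearEquiv.isOpen.mem_nhds ⟨L, hD.fderiv.symm⟩)
  obtain ⟨O, hO, hOopen, h0O⟩ := eventually_nhds_iff.1 ((hΦ.and hΦt).and hinv)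
  let k := h.restrOpen O hOopen
  have hk : ∀ x ∈ k.target, k.symm x ∈ O ∧ Φ (k.symm x) = x := fun x hx =>
    ⟨(k.map_target hx).2, k.right_inv hx⟩
  have hkD : ∀ x ∈ k.target, ∃ e : (ℝ × W) ≃L[ℝ] V, (e : (ℝ × W) →L[ℝ] V) = fderiv ℝ Φ (k.symm x) ∧
      HasFDerivAt k (e : (ℝ × W) →L[ℝ] V) (k.symm x) := by
    intro x hx
    obtain ⟨⟨h1, -⟩, e, he⟩ := hO _ (hk x hx).1
    refine ⟨e, he, ?_⟩
    rw [he]; exact (h1.differentiableAt (by simp)).hasFDerivAt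
  -- The straightening chart is the inverse of the flow map, cut down to where that map is smooth
  -- with invertible derivative.
  refine ⟨k.symm, ?_, ?_, ?_, ?_, ?_⟩
  · have := k.map_source (x := 0) ⟨hsrc, h0O⟩
    rwa [show k 0 = x₀ from hΦ0] at this
  · have := k.left_inv (x := 0) ⟨hsrc, h0O⟩
    rwa [show k 0 = x₀ from hΦ0] at this
  · intro x hx
    obtain ⟨e, -, he⟩ := hkD x hx
    exact (k.contDiffAt_symm hx he (hO _ (hk x hx).1).1.1).contDiffWithinAt
  · exact fun q hq => (hO q hq.2).1.1.contDiffWithinAt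
  · intro x hx
    obtain ⟨e, he, he'⟩ := hkD x hx
    rw [(k.hasFDerivAt_symm hx he').fderiv]
    change e.symm (f x) = _
    rw [ContinuousLinearEquiv.symm_apply_eq, ← ContinuousLinearEquiv.coe_coe, he,
      (hO _ (hk x hx).1).1.2, (hk x hx).2]

/-- Linear ordinary differential equations depending smoothly on parameters have smooth local
solutions. -/
theorem exists_smooth_linear_ode {C : Type*} [NormedAddCommGroup C] [NormedSpace ℝ C]
    [FiniteDimensional ℝ C] {Γ : ℝ × W → C →L[ℝ] C} (hΓ : ContDiff ℝ ∞ Γ) (c₀ : C) :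
    ∃ c : ℝ × W → C, (∀ᶠ q in nhds 0, ContDiffAt ℝ ∞ c q) ∧ c 0 = c₀ ∧
      ∀ᶠ q in nhds 0, fderiv ℝ c q (1, 0) = Γ q (c q) := by
  have : CompleteSpace C := FiniteDimensional.complete ℝ C
  have : CompleteSpace W := FiniteDimensional.complete ℝ W
  -- Time and parameters become state variables, which turns the equation into an autonomous one.
  let f : (ℝ × W) × C → (ℝ × W) × C := fun p => ((1, 0), Γ p.1 p.2)
  have hf : ContDiff ℝ ∞ f := contDiff_const.prodMk ((hΓ.comp contDiff_fst).clm_apply contDiff_snd)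
  obtain ⟨φ, hφ, hφ0, hφt⟩ := exists_smooth_flow hf ((0, 0), c₀)
  let g : ℝ × W → ℝ × ((ℝ × W) × C) := fun q => (q.1, ((0, q.2), c₀))
  have hg : ContDiff ℝ ∞ g := by fun_prop
  have hgt : Filter.Tendsto g (nhds 0) (nhds (0, ((0, 0), c₀))) := hg.continuous.tendsto 0
  -- The first component moves with constant velocity `(1, 0)` from `(0, q.2)`. A ball is used so
  -- that the times between `0` and `q.1` stay in the domain.
  have hfst : ∀ᶠ q in nhds (0 : ℝ × W), (φ (g q)).1 = q := by
    have h2 : ∀ᶠ p in nhds ((0 : ℝ), (((0 : ℝ), (0 : W)), c₀)),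
        φ (0, p.2) = p.2 := (continuous_snd.tendsto ((0 : ℝ), (((0 : ℝ), (0 : W)), c₀))).eventually hφ0
    obtain ⟨δ, hδ, H⟩ := Metric.eventually_nhds_iff.1 ((hgt.eventually hφt).and (hgt.eventually h2))
    filter_upwards [Metric.ball_mem_nhds (0 : ℝ × W) hδ] with q hq
    rw [Metric.mem_ball, Prod.dist_eq, max_lt_iff] at hq
    have hH : ∀ t ∈ Metric.ball (0 : ℝ) δ, HasDerivAt (fun t => φ (t, ((0, q.2), c₀)))
        (f (φ (t, ((0, q.2), c₀)))) t := fun t ht =>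
      (H (y := (t, q.2)) (by rw [Prod.dist_eq, max_lt_iff]; exact ⟨ht, hq.2⟩)).1
    have hH' : ∀ t ∈ Metric.ball (0 : ℝ) δ, HasDerivAt (fun t => (φ (t, ((0, q.2), c₀))).1 - (t, 0))
        0 t := by
      intro t ht
      have h3 : HasDerivAt (fun t => (φ (t, ((0, q.2), c₀))).1) ((1 : ℝ), (0 : W)) t :=
        (ContinuousLinearMap.fst ℝ (ℝ × W) C).hasFDerivAt.comp_hasDerivAt t (hH t ht)
      have h4 : HasDerivAt (fun t : ℝ => (t, (0 : W))) ((1 : ℝ), (0 : W)) t :=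
        (hasDerivAt_id t).prodMk (hasDerivAt_const _ _)
      exact (h3.sub h4).congr_deriv (sub_self _)
    have h5 := Metric.isOpen_ball.is_const_of_deriv_eq_zero (convex_ball (0 : ℝ) δ).isPreconnected
      (fun t ht => (hH' t ht).differentiableAt.differentiableWithinAt)
      (fun t ht => (hH' t ht).deriv) hq.1 (Metric.mem_ball_self hδ)
    have h6 := (H (y := (0, q.2)) (by rw [Prod.dist_eq, max_lt_iff]; exact ⟨by simpa using hδ, hq.2⟩)).2
    have h7 : φ (0, ((0, q.2), c₀)) = ((0, q.2), c₀) := h6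
    simp only [h7] at h5
    have h8 := eq_add_of_sub_eq h5
    change (φ (q.1, ((0, q.2), c₀))).1 = q
    rw [h8]; simp
  refine ⟨fun q => (φ (g q)).2, ?_, ?_, ?_⟩
  · exact (hgt.eventually hφ).mono fun q hq => contDiffAt_snd.comp q (hq.comp q hg.contDiffAt)
  · change (φ (0, ((0, 0), c₀))).2 = c₀
    rw [hφ0.self_of_nhds]
  · filter_upwards [hgt.eventually hφ, hgt.eventually hφt, hfst] with q h1 h2 h3
    have h4 : HasDerivAt (fun t : ℝ => (t, q.2)) ((1 : ℝ), (0 : W)) q.1 :=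
      (hasDerivAt_id q.1).prodMk (hasDerivAt_const _ _)
    have h5 : DifferentiableAt ℝ (fun q => (φ (g q)).2) q :=
      (contDiffAt_snd.comp q (h1.comp q hg.contDiffAt)).differentiableAt (n := ∞) (by simp)
    have h6 := HasFDerivAt.comp_hasDerivAt (f := fun t : ℝ => (t, q.2)) q.1 h5.hasFDerivAt h4
    have h7 := (ContinuousLinearMap.snd ℝ (ℝ × W) C).hasFDerivAt.comp_hasDerivAt q.1 h2
    refine (h6.unique h7).trans ?_
    change Γ (φ (g q)).1 (φ (g q)).2 = _
    rw [h3]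

end FlowBox

/-! ### Extension of germs, and frames of vector bundles. -/

section BundleTools

variable {EB : Type*} [NormedAddCommGroup EB] [NormedSpace ℝ EB]
  {H : Type*} [TopologicalSpace H] {I : ModelWithCorners ℝ EB H}
  {M : Type*} [TopologicalSpace M] [ChartedSpace H M]

section Extension

variable [FiniteDimensional ℝ EB] [T2Space M] [IsManifold I ∞ M]

theorem exists_bump {x : M} {u : Set M} (hu : u ∈ nhds x) :
    ∃ χ : C^∞⟮I, M; ℝ⟯, (∀ᶠ y in nhds x, χ y = 1) ∧ tsupport χ ⊆ u := by
  obtain ⟨f, -, hf⟩ := (SmoothBumpFunction.nhds_basis_tsupport (I := I) x).mem_iff.1 hu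
  exact ⟨⟨f, f.contMDiff⟩, f.eventuallyEq_one, hf⟩

/-- Multiplication by a bump function. Brackets act on global sections only, so local constructions
are replaced throughout by global objects with the same germ. -/
theorem exists_function_eventuallyEq {V : Type*} [NormedAddCommGroup V] [NormedSpace ℝ V]
    {f : M → V} {x : M} (hf : ∀ᶠ y in nhds x, ContMDiffAt I 𝓘(ℝ, V) ∞ f y) :
    ∃ g : C^∞⟮I, M; 𝓘(ℝ, V), V⟯, ∀ᶠ y in nhds x, g y = f y := by
  obtain ⟨u, hu, huo, hxu⟩ := eventually_nhds_iff.1 hf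
  obtain ⟨χ, hχ, hχu⟩ := exists_bump (I := I) (huo.mem_nhds hxu)
  refine ⟨⟨fun y => χ y • f y, contMDiff_of_tsupport fun y hy => ?_⟩, ?_⟩
  · have hy' : y ∈ tsupport χ := closure_mono (Function.support_smul_subset_left χ f) hy
    exact χ.contMDiff.contMDiffAt.smul (hu y (hχu hy'))
  · filter_upwards [hχ] with y hy
    change χ y • f y = f y
    rw [hy, one_smul]

variable {F : Type*} [NormedAddCommGroup F] [NormedSpace ℝ F]
  {E : M → Type*} [TopologicalSpace (TotalSpace F E)] [∀ x, AddCommGroup (E x)]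
  [∀ x, Module ℝ (E x)] [∀ x, TopologicalSpace (E x)] [FiberBundle F E] [VectorBundle ℝ F E]

theorem exists_section_eventuallyEq {s : ∀ x, E x} {x : M}
    (hs : ∀ᶠ y in nhds x, ContMDiffAt I (I.prod 𝓘(ℝ, F)) ∞ (fun y => TotalSpace.mk' F y (s y)) y) :
    ∃ σ : Cₛ^∞⟮I; F, E⟯, ∀ᶠ y in nhds x, σ y = s y := by
  obtain ⟨u, hu, huo, hxu⟩ := eventually_nhds_iff.1 hs
  obtain ⟨χ, hχ, hχu⟩ := exists_bump (I := I) (huo.mem_nhds hxu)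
  refine ⟨⟨fun y => χ y • s y, ContMDiffOn.smul_section_of_tsupport χ.contMDiff.contMDiffOn huo hχu
    fun y hy => (hu y hy).contMDiffWithinAt⟩, ?_⟩
  filter_upwards [hχ] with y hy
  change χ y • s y = s y
  rw [hy, one_smul]

theorem exists_section_apply_eq [ContMDiffVectorBundle ∞ F E I] {x : M} (v : E x) :
    ∃ σ : Cₛ^∞⟮I; F, E⟯, σ x = v := by
  let e := trivializationAt F E x
  have hx : x ∈ e.baseSet := FiberBundle.mem_baseSet_trivializationAt' x
  have : ∀ᶠ y in nhds x, ContMDiffAt I (I.prod 𝓘(ℝ, F)) ∞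
      (fun y => TotalSpace.mk' F y (FiberBundle.extend F v y)) y := by
    filter_upwards [e.open_baseSet.mem_nhds hx] with y hy
    rw [e.contMDiffAt_section_iff hy]
    refine (contMDiffAt_const (c := (e ⟨x, v⟩).2)).congr_of_eventuallyEq ?_
    filter_upwards [e.open_baseSet.mem_nhds hy] with z hz
    simp [FiberBundle.extend, e, e.apply_mk_symm hz]
  obtain ⟨σ, hσ⟩ := exists_section_eventuallyEq this
  exact ⟨σ, by rw [hσ.self_of_nhds]; simp⟩

/-- Near each point of an open subset, a section over the open subset extends to a global one. -/
theorem exists_section_extending (U : Opens M) (σ : Cₛ^∞⟮I; F, Restrict I U E⟯) (x : U) :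
    ∃ σ' : Cₛ^∞⟮I; F, E⟯, ∀ᶠ y in nhds x, σ y = σ' (y : M) := by
  classical
  let s : ∀ y, E y := fun y => if h : y ∈ U then σ ⟨y, h⟩ else 0
  have hs : ∀ᶠ y in nhds (x : M), ContMDiffAt I (I.prod 𝓘(ℝ, F)) ∞
      (fun y => TotalSpace.mk' F y (s y)) y := by
    filter_upwards [U.isOpen.mem_nhds x.2] with y hy
    rw [contMDiffAt_section]
    have h := (contMDiffAt_section (IB := I) (n := ∞) (s := σ) ⟨y, hy⟩).1 (σ.contMDiff ⟨y, hy⟩)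
    refine (contMDiffAt_subtype_iff (U := U) (x := ⟨y, hy⟩)).1 (h.congr_of_eventuallyEq ?_)
    refine Filter.Eventually.of_forall fun z => ?_
    have hz : s z = σ z := dif_pos z.2
    simp only [hz]
    rfl
  obtain ⟨σ', hσ'⟩ := exists_section_eventuallyEq hs
  refine ⟨σ', ?_⟩
  filter_upwards [continuous_subtype_val.continuousAt.eventually hσ'] with y hy
  have hz : s y = σ y := dif_pos y.2
  exact hz.symm.trans hy.symm

end Extension

section Frames

variable {F : Type*} [NormedAddCommGroup F] [NormedSpace ℝ F]
  {E : M → Type*} [TopologicalSpace (TotalSpace F E)] [∀ x, AddCommGroup (E x)]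
  [∀ x, Module ℝ (E x)] [∀ x, TopologicalSpace (E x)] [FiberBundle F E] [VectorBundle ℝ F E]
  {ι : Type*} [Fintype ι]

/-- The sections `s i` form a basis of the fibre at `x`. -/
def IsFrameAt (s : ι → ∀ x, E x) (x : M) : Prop :=
  Function.Bijective (Fintype.linearCombination ℝ (fun i => s i x))

/-- The coordinates on the fibre given by a frame. -/
def IsFrameAt.equiv {s : ι → ∀ x, E x} {x : M} (h : IsFrameAt s x) : (ι → ℝ) ≃ₗ[ℝ] E x :=
  LinearEquiv.ofBijective _ h

theorem IsFrameAt.equiv_apply {s : ι → ∀ x, E x} {x : M} (h : IsFrameAt s x) (c : ι → ℝ) :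
    h.equiv c = ∑ i, c i • s i x := rfl

theorem IsFrameAt.ext {s : ι → ∀ x, E x} {x : M} (h : IsFrameAt s x) {c c' : ι → ℝ}
    (hc : ∑ i, c i • s i x = ∑ i, c' i • s i x) : c = c' := h.1 hc

/-- The family `s` at `y`, read in the trivialization at `x`. -/
def frameInTrivialization (s : ι → Cₛ^∞⟮I; F, E⟯) (x y : M) : (ι → ℝ) →L[ℝ] F :=
  ∑ i, (ContinuousLinearMap.proj i).smulRight (trivializationAt F E x ⟨y, s i y⟩).2

theorem contMDiffAt_frameInTrivialization [ContMDiffVectorBundle ∞ F E I]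
    (s : ι → Cₛ^∞⟮I; F, E⟯) {x y : M}
    (hy : y ∈ (trivializationAt F E x).baseSet) :
    ContMDiffAt I 𝓘(ℝ, (ι → ℝ) →L[ℝ] F) ∞ (frameInTrivialization s x) y := by
  refine ContMDiffAt.sum fun i _ => ?_
  have h := ((trivializationAt F E x).contMDiffAt_section_iff (IB := I) (n := ∞) (s := s i) hy).1
    ((s i).contMDiff y)
  exact ((ContinuousLinearMap.smulRightL ℝ (ι → ℝ) F (ContinuousLinearMap.proj i)).contMDiff _).comp
    _ h

theorem frameInTrivialization_apply (s : ι → Cₛ^∞⟮I; F, E⟯) {x y : M}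
    (hy : y ∈ (trivializationAt F E x).baseSet) (c : ι → ℝ) :
    frameInTrivialization s x y c =
      (trivializationAt F E x).linearEquivAt ℝ y hy (∑ i, c i • s i y) := by
  simp [frameInTrivialization]

theorem isFrameAt_iff (s : ι → Cₛ^∞⟮I; F, E⟯) {x y : M}
    (hy : y ∈ (trivializationAt F E x).baseSet) :
    IsFrameAt (fun i => s i) y ↔ Function.Bijective (frameInTrivialization s x y) := by
  have : ⇑(frameInTrivialization s x y) = (trivializationAt F E x).linearEquivAt ℝ y hy ∘
      Fintype.linearCombination ℝ (fun i => s i y) := by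
    ext c
    rw [frameInTrivialization_apply s hy]; rfl
  rw [this, Function.Bijective.of_comp_iff' (LinearEquiv.bijective _)]
  rfl

variable [ContMDiffVectorBundle ∞ F E I]

theorem IsFrameAt.exists_equiv [FiniteDimensional ℝ F] {s : ι → Cₛ^∞⟮I; F, E⟯} {x : M}
    (h : IsFrameAt (fun i => s i) x) :
    ∃ L : (ι → ℝ) ≃L[ℝ] F, (L : (ι → ℝ) →L[ℝ] F) = frameInTrivialization s x x := by
  have h' := (isFrameAt_iff s (FiberBundle.mem_baseSet_trivializationAt' x)).1 h
  exact ⟨(LinearEquiv.ofBijective (frameInTrivialization s x x : (ι → ℝ) →ₗ[ℝ] F)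
    h').toContinuousLinearEquiv, by ext; rfl⟩

/-- In a trivialization the frame is a continuous family of linear maps, and invertibility is an
open condition. -/
theorem IsFrameAt.eventually [FiniteDimensional ℝ F] {s : ι → Cₛ^∞⟮I; F, E⟯} {x : M}
    (h : IsFrameAt (fun i => s i) x) : ∀ᶠ y in nhds x, IsFrameAt (fun i => s i) y := by
  have : CompleteSpace F := FiniteDimensional.complete ℝ F
  obtain ⟨L, hL⟩ := h.exists_equiv
  have hx : x ∈ (trivializationAt F E x).baseSet := FiberBundle.mem_baseSet_trivializationAt' x
  have hc := (contMDiffAt_frameInTrivialization s hx).continuousAt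
  filter_upwards [hc.preimage_mem_nhds (ContinuousLinearEquiv.isOpen.mem_nhds ⟨L, hL⟩),
    (trivializationAt F E x).open_baseSet.mem_nhds hx] with y ⟨L', hL'⟩ hy
  rw [isFrameAt_iff s hy, ← hL']
  exact L'.bijective

variable {EB' : Type*} [NormedAddCommGroup EB'] [NormedSpace ℝ EB']
  {H' : Type*} [TopologicalSpace H'] {I' : ModelWithCorners ℝ EB' H'}
  {N : Type*} [TopologicalSpace N] [ChartedSpace H' N]

/-- The coefficients of a smooth map to the total space in a frame are smooth. -/
theorem IsFrameAt.contMDiffAt_coeff [FiniteDimensional ℝ F] {s : ι → Cₛ^∞⟮I; F, E⟯}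
    {v : N → TotalSpace F E} {y : N} (h : IsFrameAt (fun i => s i) (v y).proj)
    (hv : ContMDiffAt I' (I.prod 𝓘(ℝ, F)) ∞ v y) {c : N → ι → ℝ}
    (hc : ∀ᶠ z in nhds y, (v z).2 = ∑ i, c z i • s i (v z).proj) :
    ContMDiffAt I' 𝓘(ℝ, ι → ℝ) ∞ c y := by
  have : CompleteSpace F := FiniteDimensional.complete ℝ F
  set x := (v y).proj with hx'
  obtain ⟨L, hL⟩ := h.exists_equiv
  have hx : x ∈ (trivializationAt F E x).baseSet := FiberBundle.mem_baseSet_trivializationAt' x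
  obtain ⟨h1, h2⟩ := contMDiffAt_totalSpace.1 hv
  have h3 : ContMDiffAt I' 𝓘(ℝ, (ι → ℝ) →L[ℝ] F) ∞
      (fun z => frameInTrivialization s x (v z).proj) y :=
    ContMDiffAt.comp (I' := I) (f := fun z => (v z).proj) (g := frameInTrivialization s x) y
      (contMDiffAt_frameInTrivialization s hx) h1
  -- By Cramer's principle the coefficients are the inverse of the frame matrix applied to the
  -- trivialized vector, and inversion is smooth at an invertible operator.
  have h4 : ContMDiffAt I' 𝓘(ℝ, F →L[ℝ] (ι → ℝ)) ∞
      (fun z => (frameInTrivialization s x (v z).proj).inverse) y := by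
    refine ContMDiffAt.comp (I' := 𝓘(ℝ, (ι → ℝ) →L[ℝ] F))
      (g := ContinuousLinearMap.inverse) y ?_ h3
    rw [← hx', ← hL]
    exact (contDiffAt_map_inverse L).contMDiffAt
  refine (h4.clm_apply h2).congr_of_eventuallyEq ?_
  filter_upwards [hc, h3.continuousAt.preimage_mem_nhds
    (ContinuousLinearEquiv.isOpen.mem_nhds ⟨L, hL⟩),
    h1.continuousAt.preimage_mem_nhds ((trivializationAt F E x).open_baseSet.mem_nhds hx)]
    with z hz ⟨L', hL'⟩ hzb
  have hL'' : (L' : (ι → ℝ) →L[ℝ] F) = frameInTrivialization s x (v z).proj := hL'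
  have hzb' : (v z).proj ∈ (trivializationAt F E x).baseSet := hzb
  have : (trivializationAt F E x (v z)).2 = L' (c z) := by
    have e1 : L' (c z) = frameInTrivialization s x (v z).proj (c z) := by
      rw [← hL'']; rfl
    rw [e1, frameInTrivialization_apply s hzb', ← hz]
    rfl
  rw [← hx', ← hL'', ContinuousLinearMap.inverse_equiv, this]
  simp

/-- Coefficients make sense only where the family is a frame. They are set to `0` elsewhere, then
replaced by global smooth functions with the same germ at `x`. -/
theorem IsFrameAt.exists_coeff [FiniteDimensional ℝ F] [FiniteDimensional ℝ EB] [T2Space M]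
    [IsManifold I ∞ M] {s : ι → Cₛ^∞⟮I; F, E⟯} {x : M} (h : IsFrameAt (fun i => s i) x)
    (σ : Cₛ^∞⟮I; F, E⟯) :
    ∃ c : ι → C^∞⟮I, M; ℝ⟯, ∀ᶠ y in nhds x, σ y = ∑ i, c i y • s i y := by
  classical
  let c : M → ι → ℝ := fun y => if hy : IsFrameAt (fun i => s i) y then hy.equiv.symm (σ y) else 0
  have hc : ∀ y, IsFrameAt (fun i => s i) y → σ y = ∑ i, c y i • s i y := by
    intro y hy
    simp only [c, dif_pos hy]
    rw [← IsFrameAt.equiv_apply (s := fun i => s i) hy, LinearEquiv.apply_symm_apply]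
  have hsm : ∀ᶠ y in nhds x, ContMDiffAt I 𝓘(ℝ, ι → ℝ) ∞ c y := by
    filter_upwards [h.eventually.eventually_nhds] with y hy
    exact hy.self_of_nhds.contMDiffAt_coeff (v := fun y => ⟨y, σ y⟩) (σ.contMDiff y) (hy.mono hc)
  obtain ⟨g, hg⟩ := exists_function_eventuallyEq hsm
  refine ⟨fun i => ⟨fun y => g y i, fun y => contMDiffAt_pi_space.1 (g.contMDiff y) i⟩, ?_⟩
  filter_upwards [h.eventually, hg] with y hy hgy
  rw [hc y hy, ← hgy]
  rfl

variable {F' : Type*} [NormedAddCommGroup F'] [NormedSpace ℝ F']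
  {E' : N → Type*} [TopologicalSpace (TotalSpace F' E')] [∀ x, AddCommGroup (E' x)]
  [∀ x, Module ℝ (E' x)] [∀ x, TopologicalSpace (E' x)] [FiberBundle F' E'] [VectorBundle ℝ F' E']

/-- The map of total spaces with coordinates `f` on the base and the identity in frames is smooth. -/
theorem contMDiff_frameTransport [FiniteDimensional ℝ F] {s : ι → Cₛ^∞⟮I; F, E⟯}
    (hs : ∀ x, IsFrameAt (fun i => s i) x) (s' : ι → Cₛ^∞⟮I'; F', E'⟯)
    {f : M → N} (hf : ContMDiff I I' ∞ f) :
    ContMDiff (I.prod 𝓘(ℝ, F)) (I'.prod 𝓘(ℝ, F')) ∞ (fun v : TotalSpace F E =>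
      (⟨f v.1, ∑ i, (hs v.1).equiv.symm v.2 i • s' i (f v.1)⟩ : TotalSpace F' E')) := by
  intro v
  have h1 : ContMDiffAt (I.prod 𝓘(ℝ, F)) 𝓘(ℝ, ι → ℝ) ∞
      (fun v : TotalSpace F E => (hs v.1).equiv.symm v.2) v := by
    refine IsFrameAt.contMDiffAt_coeff (s := s) (v := id) (hs v.1) contMDiffAt_id ?_
    refine Filter.Eventually.of_forall fun w => ?_
    exact ((hs w.1).equiv.apply_symm_apply w.2).symm
  have h2 : ContMDiff (I.prod 𝓘(ℝ, F)) I' ∞ (fun v : TotalSpace F E => f v.1) :=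
    hf.comp (contMDiff_proj E)
  refine contMDiffAt_totalSpace.2 ⟨h2 v, ?_⟩
  have hbase : f v.1 ∈ (trivializationAt F' E' (f v.1)).baseSet :=
    FiberBundle.mem_baseSet_trivializationAt' _
  have h3 : ContMDiffAt (I.prod 𝓘(ℝ, F)) 𝓘(ℝ, F') ∞ (fun w : TotalSpace F E =>
      ∑ i, (hs w.1).equiv.symm w.2 i • (trivializationAt F' E' (f v.1) ⟨f w.1, s' i (f w.1)⟩).2) v := by
    refine ContMDiffAt.sum fun i _ => ContMDiffAt.smul (contMDiffAt_pi_space.1 h1 i) ?_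
    exact ContMDiffAt.comp (I' := I') (f := fun w : TotalSpace F E => f w.1)
      (g := fun z => (trivializationAt F' E' (f v.1) ⟨z, s' i z⟩).2) v
      ((contMDiffAt_section (f v.1)).1 ((s' i).contMDiff (f v.1))) (h2 v)
  refine h3.congr_of_eventuallyEq ?_
  filter_upwards [(h2 v).continuousAt.preimage_mem_nhds
    ((trivializationAt F' E' (f v.1)).open_baseSet.mem_nhds hbase)] with w hw
  have := map_sum ((trivializationAt F' E' (f v.1)).linearEquivAt ℝ (f w.1) hw)
    (fun i => (hs w.1).equiv.symm w.2 i • s' i (f w.1)) Finset.univ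
  simp only [map_smul] at this
  exact this

end Frames
end BundleTools

/-! ### Formal consequences of the Courant algebroid axioms. -/

section Algebra

variable {EB : Type*} [NormedAddCommGroup EB] [NormedSpace ℝ EB]
  {H : Type*} [TopologicalSpace H] {I : ModelWithCorners ℝ EB H}
  {M : Type*} [TopologicalSpace M] [ChartedSpace H M] [IsManifold I ∞ M]

theorem contMDiff_mvfderiv_apply {V : Type*} [NormedAddCommGroup V] [NormedSpace ℝ V]
    {f : M → V} (hf : ContMDiff I 𝓘(ℝ, V) ∞ f) {X : ∀ x : M, TangentSpace I x}
    (hX : ContMDiff I I.tangent ∞ (fun x => (⟨x, X x⟩ : TangentBundle I M))) :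
    ContMDiff I 𝓘(ℝ, V) ∞ (fun x => mvfderiv I f x (X x)) := by
  have : IsManifold I 1 M := IsManifold.of_le (n := ∞) (by simp)
  have h1 := (hf.contMDiff_tangentMap (m := ∞) (by simp)).comp hX
  exact (contMDiff_snd_tangentBundle_modelSpace V 𝓘(ℝ, V)).comp h1

variable {F : Type*} [NormedAddCommGroup F] [NormedSpace ℝ F]
  {E : M → Type*} [TopologicalSpace (TotalSpace F E)] [∀ x, AddCommGroup (E x)]
  [∀ x, Module ℝ (E x)] [∀ x, TopologicalSpace (E x)] [FiberBundle F E] [VectorBundle ℝ F E]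

@[simp] theorem fsmul_apply (f : C^∞⟮I, M; ℝ⟯) (σ : Cₛ^∞⟮I; F, E⟯) (x : M) :
    fsmul f σ x = f x • σ x := rfl

@[simp] theorem section_add_apply (σ τ : Cₛ^∞⟮I; F, E⟯) (x : M) : (σ + τ) x = σ x + τ x := rfl

@[simp] theorem section_sub_apply (σ τ : Cₛ^∞⟮I; F, E⟯) (x : M) : (σ - τ) x = σ x - τ x := rfl

@[simp] theorem section_neg_apply (σ : Cₛ^∞⟮I; F, E⟯) (x : M) : (-σ) x = -σ x := rfl

@[simp] theorem section_zero_apply (x : M) : (0 : Cₛ^∞⟮I; F, E⟯) x = 0 := rfl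

@[simp] theorem section_sum_apply {ι : Type*} (t : Finset ι) (σ : ι → Cₛ^∞⟮I; F, E⟯) (x : M) :
    (∑ i ∈ t, σ i) x = ∑ i ∈ t, σ i x := by
  classical
  induction t using Finset.induction_on with
  | empty => simp
  | insert a t ha ih => simp [Finset.sum_insert ha, ih]

variable [ContMDiffVectorBundle ∞ F E I]

namespace CourantAlgebroid

variable (C : CourantAlgebroid I F E)

theorem contMDiff_anchor_section (σ : Cₛ^∞⟮I; F, E⟯) :
    ContMDiff I I.tangent ∞ (fun x => (⟨x, C.anchor x (σ x)⟩ : TangentBundle I M)) :=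
  C.contMDiff_anchor.comp σ.contMDiff

/-- The derivative of a smooth function along the anchor of a section. -/
def lie (σ : Cₛ^∞⟮I; F, E⟯) (f : C^∞⟮I, M; ℝ⟯) : C^∞⟮I, M; ℝ⟯ :=
  ⟨fun x => mvfderiv I f x (C.anchor x (σ x)),
    contMDiff_mvfderiv_apply f.contMDiff (C.contMDiff_anchor_section σ)⟩

theorem lie_apply (σ : Cₛ^∞⟮I; F, E⟯) (f : C^∞⟮I, M; ℝ⟯) (x : M) :
    C.lie σ f x = mvfderiv I f x (C.anchor x (σ x)) := rfl

/-- The pairing of two sections. -/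
def pair (σ τ : Cₛ^∞⟮I; F, E⟯) : C^∞⟮I, M; ℝ⟯ :=
  ⟨fun x => C.pairing x (σ x) (τ x), C.contMDiff_pairing σ τ⟩

@[simp] theorem pair_apply (σ τ : Cₛ^∞⟮I; F, E⟯) (x : M) :
    C.pair σ τ x = C.pairing x (σ x) (τ x) := rfl

theorem eq_of_pairing {x : M} {v v' : E x} (h : ∀ w, C.pairing x v w = C.pairing x v' w) :
    v = v' := by
  rw [← sub_eq_zero]
  exact C.pairing_nondegenerate x _ fun w => by rw [map_sub, LinearMap.sub_apply, h, sub_self]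

theorem bracket_fsmul (α β : Cₛ^∞⟮I; F, E⟯) (f : C^∞⟮I, M; ℝ⟯) :
    C.bracket α (fsmul f β) = fsmul f (C.bracket α β) + fsmul (C.lie α f) β :=
  ContMDiffSection.ext fun x => C.leibniz α β f x

theorem bracket_bracket (α β γ : Cₛ^∞⟮I; F, E⟯) :
    C.bracket (C.bracket α β) γ = C.bracket α (C.bracket β γ) - C.bracket β (C.bracket α γ) := by
  have := C.jacobi α β γ
  rw [← sub_eq_zero, ← this]; abel

theorem lie_add_section (σ τ : Cₛ^∞⟮I; F, E⟯) (f : C^∞⟮I, M; ℝ⟯) (x : M) :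
    C.lie (σ + τ) f x = C.lie σ f x + C.lie τ f x := by
  simp [lie_apply]

theorem lie_fsmul (g : C^∞⟮I, M; ℝ⟯) (σ : Cₛ^∞⟮I; F, E⟯) (f : C^∞⟮I, M; ℝ⟯) (x : M) :
    C.lie (fsmul g σ) f x = g x * C.lie σ f x := by
  simp [lie_apply]

theorem mdifferentiableAt_fun (f : C^∞⟮I, M; ℝ⟯) (x : M) : MDifferentiableAt I 𝓘(ℝ, ℝ) f x :=
  (f.contMDiff x).mdifferentiableAt (by simp)

theorem lie_eq_zero_of_eventually_const {f : C^∞⟮I, M; ℝ⟯} {c : ℝ} {x : M}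
    (h : ∀ᶠ y in nhds x, f y = c) (σ : Cₛ^∞⟮I; F, E⟯) : C.lie σ f x = 0 := by
  have h' : (f : M → ℝ) =ᶠ[nhds x] fun _ => c := h
  rw [lie_apply, mvfderiv, h'.mfderiv_eq, mfderiv_const]
  rfl

theorem lie_pair (α β γ : Cₛ^∞⟮I; F, E⟯) (x : M) :
    C.lie α (C.pair β γ) x = C.pairing x (C.bracket α β x) (γ x) +
      C.pairing x (β x) (C.bracket α γ x) := C.bracket_pairing α β γ x

theorem symmetrization' (α β : Cₛ^∞⟮I; F, E⟯) (x : M) (e : E x) :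
    C.pairing x (C.bracket α β x) e + C.pairing x (C.bracket β α x) e =
      mvfderiv I (C.pair α β) x (C.anchor x e) := by
  rw [← LinearMap.add_apply, ← map_add]
  exact C.symmetrization α β x e

/-- The anchor is a morphism of brackets, tested on functions. -/
theorem lie_bracket {γ : Cₛ^∞⟮I; F, E⟯} {x : M} (hγ : γ x ≠ 0) (α β : Cₛ^∞⟮I; F, E⟯)
    (f : C^∞⟮I, M; ℝ⟯) :
    C.lie (C.bracket α β) f x = C.lie α (C.lie β f) x - C.lie β (C.lie α f) x := by
  -- The Jacobi identity for `fγ` minus `f` times the one for `γ` is the claimed identity multiplied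
  -- by `γ`. Hence the need for a section with `γ x ≠ 0`.
  have h := congrArg (fun σ : Cₛ^∞⟮I; F, E⟯ => σ x) (C.bracket_bracket α β (fsmul f γ))
  have h' := congrArg (fun σ : Cₛ^∞⟮I; F, E⟯ => σ x) (C.bracket_bracket α β γ)
  simp only [bracket_fsmul, map_add, section_add_apply, section_sub_apply, fsmul_apply] at h h'
  rw [h'] at h
  have h2 : (C.lie (C.bracket α β) f x - (C.lie α (C.lie β f) x - C.lie β (C.lie α f) x)) • γ x = 0 := by
    rw [← sub_eq_zero] at h
    rw [← h]
    module
  exact sub_eq_zero.1 ((smul_eq_zero.1 h2).resolve_right hγ)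

/-- Symmetrized brackets are central on the left. -/
theorem bracket_symm_bracket (α β γ : Cₛ^∞⟮I; F, E⟯) :
    C.bracket (C.bracket α β + C.bracket β α) γ = 0 := by
  rw [map_add, LinearMap.add_apply, bracket_bracket, bracket_bracket]
  abel

/-- The commutators of derivations belonging to `[α, β]` and `[β, α]` cancel. Consequently the
anchor kills gradients. -/
theorem lie_symm_bracket {γ : Cₛ^∞⟮I; F, E⟯} {x : M} (hγ : γ x ≠ 0) (α β : Cₛ^∞⟮I; F, E⟯)
    (f : C^∞⟮I, M; ℝ⟯) : C.lie (C.bracket α β + C.bracket β α) f x = 0 := by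
  rw [lie_add_section, C.lie_bracket hγ, C.lie_bracket hγ]
  ring

section Locality

variable [FiniteDimensional ℝ EB] [T2Space M]

/-- If a bump function `χ` is `1` near `x` and supported where `β` vanishes, then `β = (1 - χ) β`.
Both terms of the Leibniz rule vanish at `x`. -/
theorem bracket_eq_zero_right {α β : Cₛ^∞⟮I; F, E⟯} {x : M} (h : ∀ᶠ y in nhds x, β y = 0) :
    C.bracket α β x = 0 := by
  obtain ⟨χ, hχ, hχs⟩ := exists_bump (I := I) h
  have h1 : fsmul (1 - χ) β = β := by
    ext y
    by_cases hy : y ∈ tsupport χ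
    · have : β y = 0 := hχs hy
      simp [this]
    · have : χ y = 0 := image_eq_zero_of_notMem_tsupport hy
      simp [this]
  have h2 : ∀ᶠ y in nhds x, (1 - χ) y = 0 := hχ.mono fun y hy => by
    change 1 - χ y = 0
    rw [hy, sub_self]
  rw [← h1, bracket_fsmul, section_add_apply, fsmul_apply, fsmul_apply,
    C.lie_eq_zero_of_eventually_const h2, h2.self_of_nhds, zero_smul, zero_smul, add_zero]

/-- The Leibniz axiom concerns the second argument only. Symmetrization transfers locality to the
first one, since `⟨α, β⟩` vanishes near `x`. -/
theorem bracket_eq_zero_left {α β : Cₛ^∞⟮I; F, E⟯} {x : M} (h : ∀ᶠ y in nhds x, α y = 0) :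
    C.bracket α β x = 0 := by
  refine C.pairing_nondegenerate x _ fun e => ?_
  obtain ⟨e', rfl⟩ := exists_section_apply_eq (F := F) (I := I) e
  have h1 := C.symmetrization' α β x (e' x)
  have h2 : C.lie e' (C.pair α β) x = 0 :=
    C.lie_eq_zero_of_eventually_const (c := 0) (h.mono fun y hy => by simp [hy]) e'
  rw [lie_apply] at h2
  rw [h2, C.bracket_eq_zero_right h] at h1
  simpa using h1

theorem bracket_congr {α α' β β' : Cₛ^∞⟮I; F, E⟯} {x : M} (hα : ∀ᶠ y in nhds x, α y = α' y)
    (hβ : ∀ᶠ y in nhds x, β y = β' y) : C.bracket α β x = C.bracket α' β' x := by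
  have h1 : C.bracket (α - α') β x = 0 :=
    C.bracket_eq_zero_left (hα.mono fun y hy => by simp [hy])
  have h2 : C.bracket α' (β - β') x = 0 :=
    C.bracket_eq_zero_right (hβ.mono fun y hy => by simp [hy])
  rw [map_sub, LinearMap.sub_apply, section_sub_apply, sub_eq_zero] at h1
  rw [map_sub, section_sub_apply, sub_eq_zero] at h2
  rw [h1, h2]

end Locality

end CourantAlgebroid
end Algebra

/-! ### Tangent vectors of open submanifolds. -/

section OpenSubset

variable {EB : Type*} [NormedAddCommGroup EB] [NormedSpace ℝ EB]
  {H : Type*} [TopologicalSpace H] {I : ModelWithCorners ℝ EB H}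
  {M : Type*} [TopologicalSpace M] [ChartedSpace H M] [IsManifold I ∞ M]

theorem extChartAt_opens (U : Opens M) (x y : U) :
    extChartAt I x y = extChartAt I (x : M) (y : M) := rfl

/-- The charts of an open subset are restrictions of charts of `M`, so the inclusion is the identity
in coordinates. Tangent spaces of `U` and `M` are the same model space, with the identity as
derivative. -/
theorem hasMFDerivAt_opens_val (U : Opens M) (x : U) :
    HasMFDerivAt I I (Subtype.val : U → M) x (ContinuousLinearMap.id ℝ EB) := by
  refine ⟨continuous_subtype_val.continuousAt, ?_⟩
  refine (hasFDerivWithinAt_id _ _).congr_of_eventuallyEq ?_ ?_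
  · filter_upwards [extChartAt_target_mem_nhdsWithin (I := I) x] with z hz
    change extChartAt I (x : M) ((extChartAt I x).symm z : M) = z
    rw [← extChartAt_opens]
    exact (extChartAt I x).right_inv hz
  · change extChartAt I (x : M) ((extChartAt I x).symm (extChartAt I x x) : M) = extChartAt I x x
    rw [← extChartAt_opens]
    exact (extChartAt I x).right_inv (mem_extChartAt_target x)

theorem mfderiv_opens_val_apply (U : Opens M) (x : U) (v : TangentSpace I x) :
    mfderiv I I (Subtype.val : U → M) x v = (v : EB) := by
  rw [(hasMFDerivAt_opens_val U x).mfderiv]; rfl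

variable {EB' : Type*} [NormedAddCommGroup EB'] [NormedSpace ℝ EB']
  {H' : Type*} [TopologicalSpace H'] {I' : ModelWithCorners ℝ EB' H'}
  {N : Type*} [TopologicalSpace N] [ChartedSpace H' N] [IsManifold I' ∞ N]
  {EP : Type*} [NormedAddCommGroup EP] [NormedSpace ℝ EP]
  {HP : Type*} [TopologicalSpace HP] {IP : ModelWithCorners ℝ EP HP}
  {P : Type*} [TopologicalSpace P] [ChartedSpace HP P]

theorem trivializationAt_tangent_apply {x y : M} (hy : y ∈ (chartAt H x).source)
    (v : TangentSpace I y) :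
    (trivializationAt EB (TangentSpace I) x ⟨y, v⟩).2 = mfderiv I 𝓘(ℝ, EB) (extChartAt I x) y v := by
  have : IsManifold I 1 M := IsManifold.of_le (n := ∞) (by simp)
  rw [← TangentBundle.continuousLinearMapAt_trivializationAt hy]
  exact (Trivialization.continuousLinearMapAt_apply_of_mem ℝ _ (by simpa using hy) v).symm

/-- A family of tangent vectors is smooth if its base points are smooth, and its image under the
derivatives of the charts is smooth. -/
theorem contMDiffAt_tangent_iff {b : P → M} {v : ∀ p, TangentSpace I (b p)} {p : P} :
    ContMDiffAt IP I.tangent ∞ (fun p => (⟨b p, v p⟩ : TangentBundle I M)) p ↔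
      ContMDiffAt IP I ∞ b p ∧
      ContMDiffAt IP 𝓘(ℝ, EB) ∞
        (fun q => (mfderiv I 𝓘(ℝ, EB) (extChartAt I (b p)) (b q) (v q) : EB)) p := by
  rw [contMDiffAt_totalSpace]
  refine and_congr_right fun hb => ?_
  have : ∀ᶠ q in nhds p, b q ∈ (chartAt H (b p)).source :=
    hb.continuousAt.eventually ((chartAt H (b p)).open_source.mem_nhds (mem_chart_source H (b p)))
  exact Filter.EventuallyEq.contMDiffAt_iff
    (this.mono fun q hq => trivializationAt_tangent_apply hq (v q))

/-- Smoothness of tangent vectors to an open subset. -/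
theorem contMDiffAt_tangent_opens {U : Opens M} {b : P → U} {v : ∀ p, TangentSpace I (b p)} {p : P}
    (hb : ContMDiffAt IP I ∞ b p)
    (h : ContMDiffAt IP I.tangent ∞
      (fun q => (⟨(b q : M), mfderiv I I (Subtype.val : U → M) (b q) (v q)⟩ : TangentBundle I M)) p) :
    ContMDiffAt IP I.tangent ∞ (fun p => (⟨b p, v p⟩ : TangentBundle I U)) p := by
  refine contMDiffAt_tangent_iff.2 ⟨hb, ?_⟩
  refine (contMDiffAt_tangent_iff (b := fun q => (b q : M)).1 h).2.congr_of_eventuallyEq ?_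
  have : ∀ᶠ q in nhds p, b q ∈ (chartAt H (b p)).source :=
    hb.continuousAt.eventually ((chartAt H (b p)).open_source.mem_nhds (mem_chart_source H (b p)))
  have I1 : IsManifold I 1 M := IsManifold.of_le (n := ∞) (by simp)
  filter_upwards [this] with q hq
  have hq' : (b q : M) ∈ (chartAt H (b p : M)).source := by
    have := hq
    simp only [TopologicalSpace.Opens.chartAt_eq, OpenPartialHomeomorph.subtypeRestr_source] at this
    exact this
  have hd : MDifferentiableAt I 𝓘(ℝ, EB) (extChartAt I (b p : M)) (b q : M) :=
    mdifferentiableAt_extChartAt hq'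
  have e : (extChartAt I (b p) : U → EB) = extChartAt I (b p : M) ∘ (Subtype.val : U → M) := rfl
  rw [e]
  exact mfderiv_comp_apply (b q) hd (hasMFDerivAt_opens_val U (b q)).mdifferentiableAt (v q)

theorem mvfderiv_comp_opens_val {V : Type*} [NormedAddCommGroup V] [NormedSpace ℝ V] {U : Opens M}
    {f : M → V} {x : U} (hf : MDifferentiableAt I 𝓘(ℝ, V) f (x : M)) (v : TangentSpace I x) :
    mvfderiv I (fun y : U => f y) x v = mvfderiv I f (x : M) (v : EB) := by
  have h := mfderiv_comp_apply (f := (Subtype.val : U → M)) (g := f) (I := I) (I' := I)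
    (I'' := 𝓘(ℝ, V)) x hf (hasMFDerivAt_opens_val U x).mdifferentiableAt v
  rw [mfderiv_opens_val_apply] at h
  exact h

end OpenSubset

/-! ### Restriction of a Courant algebroid to an open subset. -/

section Restriction

variable {EB : Type*} [NormedAddCommGroup EB] [NormedSpace ℝ EB] [FiniteDimensional ℝ EB]
  {H : Type*} [TopologicalSpace H] {I : ModelWithCorners ℝ EB H}
  {M : Type*} [TopologicalSpace M] [T2Space M] [ChartedSpace H M] [IsManifold I ∞ M]
  {F : Type*} [NormedAddCommGroup F] [NormedSpace ℝ F]
  {E : M → Type*} [TopologicalSpace (TotalSpace F E)] [∀ x, AddCommGroup (E x)]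
  [∀ x, Module ℝ (E x)] [∀ x, TopologicalSpace (E x)] [FiberBundle F E] [VectorBundle ℝ F E]
  [ContMDiffVectorBundle ∞ F E I]

theorem exists_function_extending (U : Opens M) (f : C^∞⟮I, U; ℝ⟯) (x : U) :
    ∃ f' : C^∞⟮I, M; ℝ⟯, ∀ᶠ y in nhds x, f y = f' (y : M) := by
  classical
  let s : M → ℝ := fun y => if h : y ∈ U then f ⟨y, h⟩ else 0
  have hz : ∀ z : U, s z = f z := fun z => dif_pos z.2
  have hs : ∀ᶠ y in nhds (x : M), ContMDiffAt I 𝓘(ℝ, ℝ) ∞ s y := by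
    filter_upwards [U.isOpen.mem_nhds x.2] with y hy
    refine (contMDiffAt_subtype_iff (U := U) (x := ⟨y, hy⟩)).1 ?_
    simp only [hz]
    exact f.contMDiff _
  obtain ⟨f', hf'⟩ := exists_function_eventuallyEq hs
  refine ⟨f', ?_⟩
  filter_upwards [continuous_subtype_val.continuousAt.eventually hf'] with y hy
  rw [hy, hz]

theorem eventually_nhds_opens {U : Opens M} {x : U} {p : M → Prop} :
    (∀ᶠ y in nhds x, p (y : U)) ↔ ∀ᶠ y in nhds (x : M), p y := by
  rw [← U.isOpen.isOpenEmbedding_subtypeVal.map_nhds_eq x, Filter.eventually_map]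
  exact Iff.rfl

variable {U : Opens M}

/-- The global section `σ'` extends the germ at `x` of the section `σ` over `U`. -/
def ExtendsAt (σ : Cₛ^∞⟮I; F, Restrict I U E⟯) (σ' : Cₛ^∞⟮I; F, E⟯) (x : U) : Prop :=
  ∀ᶠ y in nhds x, σ y = σ' (y : M)

theorem ExtendsAt.eventually {σ : Cₛ^∞⟮I; F, Restrict I U E⟯} {σ' : Cₛ^∞⟮I; F, E⟯} {x : U}
    (h : ExtendsAt σ σ' x) : ∀ᶠ y in nhds x, ExtendsAt σ σ' y := h.eventually_nhds

theorem ExtendsAt.eq {σ : Cₛ^∞⟮I; F, Restrict I U E⟯} {σ' : Cₛ^∞⟮I; F, E⟯} {x : U}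
    (h : ExtendsAt σ σ' x) : σ x = σ' (x : M) := h.self_of_nhds

theorem ExtendsAt.congr {σ : Cₛ^∞⟮I; F, Restrict I U E⟯} {σ' σ'' : Cₛ^∞⟮I; F, E⟯} {x : U}
    (h : ExtendsAt σ σ' x) (h' : ExtendsAt σ σ'' x) : ∀ᶠ y in nhds (x : M), σ' y = σ'' y := by
  refine eventually_nhds_opens.1 ?_
  filter_upwards [h, h'] with y h1 h2
  rw [← h1, ← h2]

theorem extendsAt_pullbackSection (σ : Cₛ^∞⟮I; F, E⟯) (x : U) :
    ExtendsAt (pullbackSection (inclusion I U) σ) σ x := Filter.Eventually.of_forall fun _ => rfl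

theorem ExtendsAt.add {σ τ : Cₛ^∞⟮I; F, Restrict I U E⟯} {σ' τ' : Cₛ^∞⟮I; F, E⟯} {x : U}
    (h : ExtendsAt σ σ' x) (h' : ExtendsAt τ τ' x) : ExtendsAt (σ + τ) (σ' + τ') x := by
  filter_upwards [h, h'] with y h1 h2
  rw [section_add_apply, section_add_apply, h1, h2]; rfl

theorem ExtendsAt.const_smul {σ : Cₛ^∞⟮I; F, Restrict I U E⟯} {σ' : Cₛ^∞⟮I; F, E⟯} {x : U} (c : ℝ)
    (h : ExtendsAt σ σ' x) : ExtendsAt (c • σ) (c • σ') x := by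
  filter_upwards [h] with y h1
  change c • σ y = c • σ' y
  rw [h1]; rfl

variable (C : CourantAlgebroid I F E)

variable (U) in
/-- The bracket of sections over an open subset. -/
def restrictBracketFun (σ τ : Cₛ^∞⟮I; F, Restrict I U E⟯) (x : U) : Restrict I U E x :=
  C.bracket (exists_section_extending U σ x).choose (exists_section_extending U τ x).choose (x : M)

/-- Locality of the bracket makes the value independent of the chosen global extensions. -/
theorem restrictBracketFun_eq {σ τ : Cₛ^∞⟮I; F, Restrict I U E⟯} {σ' τ' : Cₛ^∞⟮I; F, E⟯} {x : U}
    (h : ExtendsAt σ σ' x) (h' : ExtendsAt τ τ' x) :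
    restrictBracketFun U C σ τ x = C.bracket σ' τ' (x : M) :=
  C.bracket_congr (ExtendsAt.congr (exists_section_extending U σ x).choose_spec h)
    (ExtendsAt.congr (exists_section_extending U τ x).choose_spec h')

variable (U) in
/-- The bracket of sections over an open subset, as a smooth section. -/
def restrictBracketSection (σ τ : Cₛ^∞⟮I; F, Restrict I U E⟯) : Cₛ^∞⟮I; F, Restrict I U E⟯ :=
  ⟨restrictBracketFun U C σ τ, fun x => by
    obtain ⟨σ', h⟩ := exists_section_extending U σ x
    obtain ⟨τ', h'⟩ := exists_section_extending U τ x
    refine ((pullbackSection (inclusion I U) (C.bracket σ' τ')).contMDiff x).congr_of_eventuallyEq ?_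
    filter_upwards [ExtendsAt.eventually h, ExtendsAt.eventually h'] with y h1 h2
    rw [restrictBracketFun_eq C h1 h2]
    rfl⟩

/-- The agreement holds on a neighbourhood and not only at `x`, so iterated brackets can also be
computed with extensions. Each axiom then follows from the one on `M`. -/
theorem extendsAt_restrictBracketSection {σ τ : Cₛ^∞⟮I; F, Restrict I U E⟯}
    {σ' τ' : Cₛ^∞⟮I; F, E⟯} {x : U} (h : ExtendsAt σ σ' x) (h' : ExtendsAt τ τ' x) :
    ExtendsAt (restrictBracketSection U C σ τ) (C.bracket σ' τ') x := by
  filter_upwards [h.eventually, h'.eventually] with y h1 h2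
  exact restrictBracketFun_eq C h1 h2

/-- The bracket of sections over an open subset, as a bilinear map. -/
def restrictBracket (U : Opens M) : Cₛ^∞⟮I; F, Restrict I U E⟯ →ₗ[ℝ]
    Cₛ^∞⟮I; F, Restrict I U E⟯ →ₗ[ℝ] Cₛ^∞⟮I; F, Restrict I U E⟯ :=
  LinearMap.mk₂ ℝ (restrictBracketSection U C)
    (fun σ₁ σ₂ τ => by
      ext x
      obtain ⟨σ₁', h₁⟩ := exists_section_extending U σ₁ x
      obtain ⟨σ₂', h₂⟩ := exists_section_extending U σ₂ x
      obtain ⟨τ', h'⟩ := exists_section_extending U τ x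
      rw [section_add_apply, (extendsAt_restrictBracketSection C (ExtendsAt.add h₁ h₂) h').eq,
        (extendsAt_restrictBracketSection C h₁ h').eq, (extendsAt_restrictBracketSection C h₂ h').eq,
        map_add]
      rfl)
    (fun c σ τ => by
      ext x
      obtain ⟨σ', h⟩ := exists_section_extending U σ x
      obtain ⟨τ', h'⟩ := exists_section_extending U τ x
      change _ = c • restrictBracketSection U C σ τ x
      rw [(extendsAt_restrictBracketSection C (ExtendsAt.const_smul c h) h').eq,
        (extendsAt_restrictBracketSection C h h').eq, map_smul]
      rfl)
    (fun σ τ₁ τ₂ => by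
      ext x
      obtain ⟨σ', h⟩ := exists_section_extending U σ x
      obtain ⟨τ₁', h₁⟩ := exists_section_extending U τ₁ x
      obtain ⟨τ₂', h₂⟩ := exists_section_extending U τ₂ x
      rw [section_add_apply, (extendsAt_restrictBracketSection C h (ExtendsAt.add h₁ h₂)).eq,
        (extendsAt_restrictBracketSection C h h₁).eq, (extendsAt_restrictBracketSection C h h₂).eq,
        map_add]
      rfl)
    (fun c σ τ => by
      ext x
      obtain ⟨σ', h⟩ := exists_section_extending U σ x
      obtain ⟨τ', h'⟩ := exists_section_extending U τ x
      change _ = c • restrictBracketSection U C σ τ x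
      rw [(extendsAt_restrictBracketSection C h (ExtendsAt.const_smul c h')).eq,
        (extendsAt_restrictBracketSection C h h').eq, map_smul]
      rfl)

theorem extendsAt_restrictBracket {σ τ : Cₛ^∞⟮I; F, Restrict I U E⟯}
    {σ' τ' : Cₛ^∞⟮I; F, E⟯} {x : U} (h : ExtendsAt σ σ' x) (h' : ExtendsAt τ τ' x) :
    ExtendsAt (restrictBracket C U σ τ) (C.bracket σ' τ') x :=
  extendsAt_restrictBracketSection C h h'

theorem mvfderiv_congr {V : Type*} [NormedAddCommGroup V] [NormedSpace ℝ V] {f g : M → V} {x : M}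
    (h : ∀ᶠ y in nhds x, f y = g y) (v : TangentSpace I x) : mvfderiv I f x v = mvfderiv I g x v := by
  have h' : f =ᶠ[nhds x] g := h
  rw [mvfderiv, mvfderiv, h'.mfderiv_eq]
  rfl

theorem mvfderiv_of_extends {f : U → ℝ} {f' : C^∞⟮I, M; ℝ⟯} {x : U}
    (h : ∀ᶠ y in nhds x, f y = f' (y : M)) (v : TangentSpace I x) :
    mvfderiv I f x v = mvfderiv I f' (x : M) (v : EB) := by
  rw [mvfderiv_congr (g := fun y : U => f' y) h,
    mvfderiv_comp_opens_val (CourantAlgebroid.mdifferentiableAt_fun f' x)]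

theorem contMDiff_restrict_totalMap (U : Opens M) :
    ContMDiff (I.prod 𝓘(ℝ, F)) (I.prod 𝓘(ℝ, F)) ∞
      (fun v : TotalSpace F (Restrict I U E) => (⟨(v.1 : M), v.2⟩ : TotalSpace F E)) := by
  intro v
  have hv := contMDiffAt_totalSpace.1
    (contMDiffAt_id : ContMDiffAt (I.prod 𝓘(ℝ, F)) (I.prod 𝓘(ℝ, F)) ∞ id v)
  exact contMDiffAt_totalSpace.2 ⟨contMDiff_subtype_val.contMDiffAt.comp v hv.1, hv.2⟩

/-- The restriction of a Courant algebroid to an open subset. -/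
def CourantAlgebroid.restrict (U : Opens M) : CourantAlgebroid I F (Restrict I U E) where
  anchor x := C.anchor (x : M)
  contMDiff_anchor v := by
    refine contMDiffAt_tangent_opens (contMDiff_proj _ v) ?_
    have := (C.contMDiff_anchor.comp (contMDiff_restrict_totalMap (I := I) (F := F) (E := E) U)) v
    refine this.congr_of_eventuallyEq (Filter.Eventually.of_forall fun w => ?_)
    simp only [mfderiv_opens_val_apply]
    rfl
  pairing x := C.pairing (x : M)
  pairing_symm x := C.pairing_symm (x : M)
  pairing_nondegenerate x := C.pairing_nondegenerate (x : M)
  contMDiff_pairing σ τ x := by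
    obtain ⟨σ', h⟩ := exists_section_extending U σ x
    obtain ⟨τ', h'⟩ := exists_section_extending U τ x
    refine (((C.contMDiff_pairing σ' τ').comp contMDiff_subtype_val) x).congr_of_eventuallyEq ?_
    filter_upwards [h, h'] with y h1 h2
    rw [h1, h2]
    rfl
  bracket := restrictBracket C U
  leibniz σ τ f x := by
    obtain ⟨σ', h⟩ := exists_section_extending U σ x
    obtain ⟨τ', h'⟩ := exists_section_extending U τ x
    obtain ⟨f', hf⟩ := exists_function_extending U f x
    have hfτ : ExtendsAt (fsmul f τ) (fsmul f' τ') x := by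
      filter_upwards [hf, h'] with y h1 h2
      rw [fsmul_apply, fsmul_apply, h1, h2]; rfl
    rw [(extendsAt_restrictBracket C h hfτ).eq, (extendsAt_restrictBracket C h h').eq,
      mvfderiv_of_extends hf, hf.self_of_nhds, ExtendsAt.eq h, ExtendsAt.eq h']
    exact C.leibniz σ' τ' f' x
  jacobi α β γ := by
    ext x
    obtain ⟨α', hα⟩ := exists_section_extending U α x
    obtain ⟨β', hβ⟩ := exists_section_extending U β x
    obtain ⟨γ', hγ⟩ := exists_section_extending U γ x
    have hb := fun {σ τ : Cₛ^∞⟮I; F, Restrict I U E⟯} {σ' τ' : Cₛ^∞⟮I; F, E⟯} =>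
      extendsAt_restrictBracket C (σ := σ) (τ := τ) (σ' := σ') (τ' := τ') (x := x)
    rw [section_sub_apply, section_add_apply, (hb (hb hα hβ) hγ).eq, (hb hβ (hb hα hγ)).eq,
      (hb hα (hb hβ hγ)).eq]
    exact congrArg (fun σ : Cₛ^∞⟮I; F, E⟯ => σ (x : M)) (C.jacobi α' β' γ')
  bracket_pairing α β γ x := by
    obtain ⟨α', hα⟩ := exists_section_extending U α x
    obtain ⟨β', hβ⟩ := exists_section_extending U β x
    obtain ⟨γ', hγ⟩ := exists_section_extending U γ x
    have h : ∀ᶠ y : U in nhds x, C.pairing (y : M) (β y) (γ y) = C.pair β' γ' (y : M) := by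
      filter_upwards [hβ, hγ] with y h1 h2
      rw [h1, h2]; rfl
    refine (mvfderiv_of_extends h _).trans ?_
    rw [(extendsAt_restrictBracket C hα hβ).eq,
      (extendsAt_restrictBracket C hα hγ).eq, ExtendsAt.eq hα, ExtendsAt.eq hβ, ExtendsAt.eq hγ]
    exact C.bracket_pairing α' β' γ' x
  symmetrization α β x e := by
    obtain ⟨α', hα⟩ := exists_section_extending U α x
    obtain ⟨β', hβ⟩ := exists_section_extending U β x
    have h : ∀ᶠ y : U in nhds x, C.pairing (y : M) (α y) (β y) = C.pair α' β' (y : M) := by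
      filter_upwards [hα, hβ] with y h1 h2
      rw [h1, h2]; rfl
    refine Eq.trans ?_ (mvfderiv_of_extends h _).symm
    rw [(extendsAt_restrictBracket C hα hβ).eq,
      (extendsAt_restrictBracket C hβ hα).eq]
    exact C.symmetrization α' β' x e

theorem CourantAlgebroid.isRestriction_restrict (U : Opens M) :
    C.IsRestriction (C.restrict U) where
  anchor x v := by rw [mfderiv_opens_val_apply]; rfl
  pairing _ _ _ := rfl
  bracket α β := by
    ext x
    exact (extendsAt_restrictBracket C (extendsAt_pullbackSection α x)
      (extendsAt_pullbackSection β x)).eq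

end Restriction

/-! ### Smooth functions separate tangent vectors. -/

section Separation

variable {EB : Type*} [NormedAddCommGroup EB] [NormedSpace ℝ EB] [FiniteDimensional ℝ EB]
  {H : Type*} [TopologicalSpace H] {I : ModelWithCorners ℝ EB H} [I.Boundaryless]
  {M : Type*} [TopologicalSpace M] [T2Space M] [ChartedSpace H M] [IsManifold I ∞ M]

/-- Tangent vectors are determined by the derivatives of smooth functions. -/
theorem tangent_ext {x : M} {v w : TangentSpace I x}
    (h : ∀ f : C^∞⟮I, M; ℝ⟯, mvfderiv I f x v = mvfderiv I f x w) : v = w := by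
  have I1 : IsManifold I 1 M := IsManifold.of_le (n := ∞) (by simp)
  have hinj : Function.Injective (mfderiv I 𝓘(ℝ, EB) (extChartAt I x) x) :=
    (isInvertible_mfderiv_extChartAt (mem_extChartAt_source x)).injective
  refine hinj ((SeparatingDual.eq_iff_forall_dual_eq (R := ℝ) (V := EB)).2 fun ℓ => ?_)
  have hd : MDifferentiableAt I 𝓘(ℝ, EB) (extChartAt I x) x :=
    mdifferentiableAt_extChartAt (mem_chart_source H x)
  have hs : ∀ᶠ y in nhds x, ContMDiffAt I 𝓘(ℝ, ℝ) ∞ (ℓ ∘ extChartAt I x) y := by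
    filter_upwards [(chartAt H x).open_source.mem_nhds (mem_chart_source H x)] with y hy
    exact (ℓ.contMDiff _).comp y (contMDiffAt_extChartAt' hy)
  obtain ⟨f, hf⟩ := exists_function_eventuallyEq hs
  have key : ∀ u : TangentSpace I x, mvfderiv I f x u = ℓ (mfderiv I 𝓘(ℝ, EB) (extChartAt I x) x u) := by
    intro u
    rw [mvfderiv_congr hf]
    refine (mvfderiv_comp_apply x (g := ℓ) ℓ.mdifferentiableAt hd u).trans ?_
    rw [mvfderiv, ContinuousLinearMap.mfderiv_eq]
    rfl
  rw [← key, ← key, h]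

end Separation

/-! ### Transport of Courant algebroids along a diffeomorphism by matching frames. -/

section Transport

variable {EB₁ : Type*} [NormedAddCommGroup EB₁] [NormedSpace ℝ EB₁]
  {H₁ : Type*} [TopologicalSpace H₁] {I₁ : ModelWithCorners ℝ EB₁ H₁}
  {M₁ : Type*} [TopologicalSpace M₁] [ChartedSpace H₁ M₁] [IsManifold I₁ ∞ M₁]
  {EB₂ : Type*} [NormedAddCommGroup EB₂] [NormedSpace ℝ EB₂]
  {H₂ : Type*} [TopologicalSpace H₂] {I₂ : ModelWithCorners ℝ EB₂ H₂}
  {M₂ : Type*} [TopologicalSpace M₂] [ChartedSpace H₂ M₂] [IsManifold I₂ ∞ M₂]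
  {F₁ : Type*} [NormedAddCommGroup F₁] [NormedSpace ℝ F₁] [FiniteDimensional ℝ F₁]
  {E₁ : M₁ → Type*} [TopologicalSpace (TotalSpace F₁ E₁)] [∀ x, AddCommGroup (E₁ x)]
  [∀ x, Module ℝ (E₁ x)] [∀ x, TopologicalSpace (E₁ x)] [FiberBundle F₁ E₁]
  [VectorBundle ℝ F₁ E₁] [ContMDiffVectorBundle ∞ F₁ E₁ I₁]
  {F₂ : Type*} [NormedAddCommGroup F₂] [NormedSpace ℝ F₂] [FiniteDimensional ℝ F₂]
  {E₂ : M₂ → Type*} [TopologicalSpace (TotalSpace F₂ E₂)] [∀ x, AddCommGroup (E₂ x)]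
  [∀ x, Module ℝ (E₂ x)] [∀ x, TopologicalSpace (E₂ x)] [FiberBundle F₂ E₂]
  [VectorBundle ℝ F₂ E₂] [ContMDiffVectorBundle ∞ F₂ E₂ I₂]
  {ι : Type*} [Fintype ι] {s₁ : ι → Cₛ^∞⟮I₁; F₁, E₁⟯} {s₂ : ι → Cₛ^∞⟮I₂; F₂, E₂⟯}

/-- The isomorphism of fibres that matches two frames. -/
def frameEquiv (h₁ : ∀ x, IsFrameAt (fun i => s₁ i) x) (h₂ : ∀ x, IsFrameAt (fun i => s₂ i) x)
    (x : M₁) (y : M₂) : E₁ x ≃ₗ[ℝ] E₂ y := (h₁ x).equiv.symm.trans (h₂ y).equiv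

variable (h₁ : ∀ x, IsFrameAt (fun i => s₁ i) x) (h₂ : ∀ x, IsFrameAt (fun i => s₂ i) x)

theorem frameEquiv_symm (x : M₁) (y : M₂) : (frameEquiv h₁ h₂ x y).symm = frameEquiv h₂ h₁ y x := rfl

theorem IsFrameAt.equiv_single [DecidableEq ι] {x : M₁} (h : IsFrameAt (fun i => s₁ i) x) (i : ι) :
    h.equiv (Pi.single i 1) = s₁ i x := by
  rw [IsFrameAt.equiv_apply, Finset.sum_eq_single i]
  · simp
  · intro j _ hj; simp [Pi.single_eq_of_ne hj]
  · simp

theorem frameEquiv_apply_frame (x : M₁) (y : M₂) (i : ι) :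
    frameEquiv h₁ h₂ x y (s₁ i x) = s₂ i y := by
  classical
  rw [← (h₁ x).equiv_single, ← (h₂ y).equiv_single]
  simp [frameEquiv]

theorem contMDiff_frameEquiv {f : M₁ → M₂} (hf : ContMDiff I₁ I₂ ∞ f) :
    ContMDiff (I₁.prod 𝓘(ℝ, F₁)) (I₂.prod 𝓘(ℝ, F₂)) ∞ (fun v : TotalSpace F₁ E₁ =>
      (⟨f v.1, frameEquiv h₁ h₂ v.1 (f v.1) v.2⟩ : TotalSpace F₂ E₂)) :=
  contMDiff_frameTransport h₁ s₂ hf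

variable (Φ : M₁ ≃ₘ^∞⟮I₁, I₂⟯ M₂)

/-- The diffeomorphism of total spaces that covers `Φ` and matches two frames. -/
def frameDiffeomorph :
    TotalSpace F₁ E₁ ≃ₘ^∞⟮I₁.prod 𝓘(ℝ, F₁), I₂.prod 𝓘(ℝ, F₂)⟯ TotalSpace F₂ E₂ where
  toFun v := ⟨Φ v.1, frameEquiv h₁ h₂ v.1 (Φ v.1) v.2⟩
  invFun w := ⟨Φ.symm w.1, frameEquiv h₂ h₁ w.1 (Φ.symm w.1) w.2⟩
  left_inv := by
    rintro ⟨x, v⟩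
    -- The points `Φ.symm (Φ x)` and `x` are only propositionally equal, and the fibres depend on
    -- them. Generalizing the point allows a substitution.
    have key : ∀ x', x' = x → (⟨x', frameEquiv h₂ h₁ (Φ x) x' (frameEquiv h₁ h₂ x (Φ x) v)⟩ :
        TotalSpace F₁ E₁) = ⟨x, v⟩ := by
      rintro _ rfl
      rw [← frameEquiv_symm, LinearEquiv.symm_apply_apply]
    exact key _ (Φ.symm_apply_apply x)
  right_inv := by
    rintro ⟨y, w⟩
    have key : ∀ y', y' = y → (⟨y', frameEquiv h₁ h₂ (Φ.symm y) y' (frameEquiv h₂ h₁ y (Φ.symm y) w)⟩ :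
        TotalSpace F₂ E₂) = ⟨y, w⟩ := by
      rintro _ rfl
      rw [← frameEquiv_symm, LinearEquiv.symm_apply_apply]
    exact key _ (Φ.apply_symm_apply y)
  contMDiff_toFun := contMDiff_frameEquiv h₁ h₂ Φ.contMDiff
  contMDiff_invFun := contMDiff_frameEquiv h₂ h₁ Φ.symm.contMDiff

/-- The transport of a section along a diffeomorphism of the bases that matches two frames. -/
def transportSection : Cₛ^∞⟮I₁; F₁, E₁⟯ →ₗ[ℝ] Cₛ^∞⟮I₂; F₂, E₂⟯ where
  toFun σ := ⟨fun y => frameEquiv h₁ h₂ (Φ.symm y) y (σ (Φ.symm y)), by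
    have h := (frameDiffeomorph h₁ h₂ Φ).contMDiff.comp (σ.contMDiff.comp Φ.symm.contMDiff)
    refine h.congr fun y => ?_
    have key : ∀ y', y' = y → (⟨y, frameEquiv h₁ h₂ (Φ.symm y) y (σ (Φ.symm y))⟩ : TotalSpace F₂ E₂) =
        ⟨y', frameEquiv h₁ h₂ (Φ.symm y) y' (σ (Φ.symm y))⟩ := by
      rintro _ rfl; rfl
    exact key _ (Φ.apply_symm_apply y)⟩
  map_add' σ τ := by
    ext y
    exact map_add (frameEquiv h₁ h₂ (Φ.symm y) y) _ _
  map_smul' c σ := by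
    ext y
    exact map_smul (frameEquiv h₁ h₂ (Φ.symm y) y) c _

theorem transportSection_apply (σ : Cₛ^∞⟮I₁; F₁, E₁⟯) (y : M₂) :
    transportSection h₁ h₂ Φ σ y = frameEquiv h₁ h₂ (Φ.symm y) y (σ (Φ.symm y)) := rfl

theorem transportSection_apply_apply (σ : Cₛ^∞⟮I₁; F₁, E₁⟯) (x : M₁) :
    transportSection h₁ h₂ Φ σ (Φ x) = frameEquiv h₁ h₂ x (Φ x) (σ x) := by
  have key : ∀ x', x' = x → frameEquiv h₁ h₂ x' (Φ x) (σ x') = frameEquiv h₁ h₂ x (Φ x) (σ x) := by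
    rintro _ rfl; rfl
  exact key _ (Φ.symm_apply_apply x)

theorem transportSection_symm (τ : Cₛ^∞⟮I₂; F₂, E₂⟯) :
    transportSection h₁ h₂ Φ (transportSection h₂ h₁ Φ.symm τ) = τ := by
  ext y
  have key : ∀ y', y' = y →
      frameEquiv h₁ h₂ (Φ.symm y) y (frameEquiv h₂ h₁ y' (Φ.symm y) (τ y')) = τ y := by
    rintro _ rfl
    rw [← frameEquiv_symm, LinearEquiv.symm_apply_apply]
  exact key _ (Φ.apply_symm_apply y)

theorem transportSection_symm' (σ : Cₛ^∞⟮I₁; F₁, E₁⟯) :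
    transportSection h₂ h₁ Φ.symm (transportSection h₁ h₂ Φ σ) = σ :=
  transportSection_symm h₂ h₁ Φ.symm σ

theorem transportSection_frame (i : ι) : transportSection h₁ h₂ Φ (s₁ i) = s₂ i := by
  ext y
  exact frameEquiv_apply_frame h₁ h₂ (Φ.symm y) y i

theorem transportSection_eq_iff {σ : Cₛ^∞⟮I₁; F₁, E₁⟯} {τ : Cₛ^∞⟮I₂; F₂, E₂⟯} :
    transportSection h₂ h₁ Φ.symm τ = σ ↔ ∀ x, τ (Φ x) = frameEquiv h₁ h₂ x (Φ x) (σ x) := by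
  constructor
  · rintro rfl x
    rw [← transportSection_apply_apply h₁ h₂ Φ, transportSection_symm]
  · intro h
    ext x
    refine (transportSection_apply h₂ h₁ Φ.symm τ x).trans ?_
    change frameEquiv h₂ h₁ (Φ x) x (τ (Φ x)) = _
    rw [h, ← frameEquiv_symm, LinearEquiv.symm_apply_apply]

theorem transportSection_fsmul (f : C^∞⟮I₁, M₁; ℝ⟯) (σ : Cₛ^∞⟮I₁; F₁, E₁⟯) :
    transportSection h₁ h₂ Φ (fsmul f σ) =
      fsmul (f.comp ⟨Φ.symm, Φ.symm.contMDiff⟩) (transportSection h₁ h₂ Φ σ) := by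
  ext y
  exact map_smul (frameEquiv h₁ h₂ (Φ.symm y) y) _ _

variable (C : CourantAlgebroid I₁ F₁ E₁)

/-- The anchor of the transported Courant algebroid. -/
def transportAnchor (y : M₂) : E₂ y →ₗ[ℝ] TangentSpace I₂ y where
  toFun w := (mfderiv I₁ I₂ Φ (Φ.symm y)
    (C.anchor (Φ.symm y) (frameEquiv h₂ h₁ y (Φ.symm y) w)) : EB₂)
  map_add' v w := by
    rw [map_add, map_add, map_add]; rfl
  map_smul' c w := by
    rw [map_smul, map_smul, map_smul]; rfl

theorem mvfderiv_transportAnchor (f : C^∞⟮I₂, M₂; ℝ⟯) (y : M₂) (w : E₂ y) :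
    mvfderiv I₂ f y (transportAnchor h₁ h₂ Φ C y w) =
      mvfderiv I₁ (f.comp ⟨Φ, Φ.contMDiff⟩) (Φ.symm y)
        (C.anchor (Φ.symm y) (frameEquiv h₂ h₁ y (Φ.symm y) w)) := by
  have hΦ : MDifferentiableAt I₁ I₂ Φ (Φ.symm y) := (Φ.contMDiff _).mdifferentiableAt (by simp)
  have h := mvfderiv_comp_apply (Φ.symm y) (CourantAlgebroid.mdifferentiableAt_fun f _) hΦ
    (C.anchor (Φ.symm y) (frameEquiv h₂ h₁ y (Φ.symm y) w))
  refine Eq.trans ?_ h.symm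
  have key : ∀ (y' : M₂) (v : EB₂), y' = y →
      (mvfderiv I₂ f y : EB₂ →L[ℝ] ℝ) v = (mvfderiv I₂ f y' : EB₂ →L[ℝ] ℝ) v := by
    rintro _ _ rfl; rfl
  exact key _ _ (Φ.apply_symm_apply y)

theorem contMDiff_transportAnchor : ContMDiff (I₂.prod 𝓘(ℝ, F₂)) I₂.tangent ∞
    (fun v : TotalSpace F₂ E₂ =>
      (⟨v.1, transportAnchor h₁ h₂ Φ C v.1 v.2⟩ : TangentBundle I₂ M₂)) := by
  have h := (Φ.contMDiff.contMDiff_tangentMap (m := ∞) (by simp)).comp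
    (C.contMDiff_anchor.comp (frameDiffeomorph h₁ h₂ Φ).symm.contMDiff)
  refine h.congr fun v => ?_
  have key : ∀ (y' : M₂) (w : EB₂), y' = v.1 →
      (⟨v.1, w⟩ : TangentBundle I₂ M₂) = ⟨y', w⟩ := by
    rintro _ _ rfl; rfl
  exact key _ _ (Φ.apply_symm_apply v.1)

theorem transportSection_symm_apply (α : Cₛ^∞⟮I₂; F₂, E₂⟯) (y : M₂) :
    transportSection h₂ h₁ Φ.symm α (Φ.symm y) = frameEquiv h₂ h₁ y (Φ.symm y) (α y) :=
  transportSection_apply_apply h₂ h₁ Φ.symm α y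

/-- The pairing of the transported Courant algebroid. -/
def transportPairing (y : M₂) : LinearMap.BilinForm ℝ (E₂ y) :=
  (C.pairing (Φ.symm y)).compl₁₂ (frameEquiv h₂ h₁ y (Φ.symm y) : _ →ₗ[ℝ] _)
    (frameEquiv h₂ h₁ y (Φ.symm y) : _ →ₗ[ℝ] _)

theorem transportPairing_apply (y : M₂) (v w : E₂ y) : transportPairing h₁ h₂ Φ C y v w =
    C.pairing (Φ.symm y) (frameEquiv h₂ h₁ y (Φ.symm y) v) (frameEquiv h₂ h₁ y (Φ.symm y) w) := rfl

theorem transportPairing_section (α β : Cₛ^∞⟮I₂; F₂, E₂⟯) (y : M₂) :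
    transportPairing h₁ h₂ Φ C y (α y) (β y) =
      C.pair (transportSection h₂ h₁ Φ.symm α) (transportSection h₂ h₁ Φ.symm β) (Φ.symm y) := by
  rw [CourantAlgebroid.pair_apply, transportSection_symm_apply, transportSection_symm_apply]
  rfl

theorem contMDiff_transportPairing (α β : Cₛ^∞⟮I₂; F₂, E₂⟯) :
    ContMDiff I₂ 𝓘(ℝ, ℝ) ∞ (fun y => transportPairing h₁ h₂ Φ C y (α y) (β y)) :=
  ((C.pair (transportSection h₂ h₁ Φ.symm α) (transportSection h₂ h₁ Φ.symm β)).contMDiff.comp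
    Φ.symm.contMDiff).congr (transportPairing_section h₁ h₂ Φ C α β)

theorem mvfderiv_transportPairing (α β : Cₛ^∞⟮I₂; F₂, E₂⟯) (y : M₂) (w : E₂ y) :
    mvfderiv I₂ (fun z => transportPairing h₁ h₂ Φ C z (α z) (β z)) y
      (transportAnchor h₁ h₂ Φ C y w) =
    mvfderiv I₁ (C.pair (transportSection h₂ h₁ Φ.symm α) (transportSection h₂ h₁ Φ.symm β))
      (Φ.symm y) (C.anchor (Φ.symm y) (frameEquiv h₂ h₁ y (Φ.symm y) w)) := by
  refine (mvfderiv_transportAnchor h₁ h₂ Φ C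
    ⟨_, contMDiff_transportPairing h₁ h₂ Φ C α β⟩ y w).trans ?_
  congr 2
  ext x
  refine (transportPairing_section h₁ h₂ Φ C α β (Φ x)).trans ?_
  rw [Φ.symm_apply_apply]

/-- Transport of a Courant algebroid along a diffeomorphism of the bases, by matching frames. -/
def CourantAlgebroid.transport : CourantAlgebroid I₂ F₂ E₂ where
  anchor := transportAnchor h₁ h₂ Φ C
  contMDiff_anchor := contMDiff_transportAnchor h₁ h₂ Φ C
  pairing := transportPairing h₁ h₂ Φ C
  pairing_symm y v w := C.pairing_symm _ _ _
  pairing_nondegenerate y v h := by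
    rw [← (frameEquiv h₂ h₁ y (Φ.symm y)).map_eq_zero_iff]
    refine C.pairing_nondegenerate _ _ fun w => ?_
    have := h ((frameEquiv h₂ h₁ y (Φ.symm y)).symm w)
    rwa [transportPairing_apply, LinearEquiv.apply_symm_apply] at this
  contMDiff_pairing := contMDiff_transportPairing h₁ h₂ Φ C
  bracket := (C.bracket.compl₁₂ (transportSection h₂ h₁ Φ.symm)
    (transportSection h₂ h₁ Φ.symm)).compr₂ (transportSection h₁ h₂ Φ)
  leibniz α β f y := by
    have h := congrArg (fun σ => transportSection h₁ h₂ Φ σ y) (C.bracket_fsmul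
      (transportSection h₂ h₁ Φ.symm α) (transportSection h₂ h₁ Φ.symm β)
      (f.comp ⟨Φ, Φ.contMDiff⟩))
    rw [mvfderiv_transportAnchor, ← transportSection_symm_apply]
    simp only [LinearMap.compr₂_apply, LinearMap.compl₁₂_apply] at h ⊢
    rw [transportSection_fsmul]
    refine h.trans ?_
    rw [map_add, transportSection_fsmul, transportSection_fsmul, transportSection_symm]
    have e : f (Φ (Φ.symm y)) = f y := by rw [Φ.apply_symm_apply]
    rw [section_add_apply, fsmul_apply, fsmul_apply]
    change f (Φ (Φ.symm y)) • _ + _ = _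
    rw [e]
    rfl
  jacobi α β γ := by
    have h := congrArg (transportSection h₁ h₂ Φ) (C.jacobi (transportSection h₂ h₁ Φ.symm α)
      (transportSection h₂ h₁ Φ.symm β) (transportSection h₂ h₁ Φ.symm γ))
    simp only [LinearMap.compr₂_apply, LinearMap.compl₁₂_apply, transportSection_symm',
      map_add, map_sub, map_zero] at h ⊢
    exact h
  bracket_pairing α β γ y := by
    rw [mvfderiv_transportPairing, transportPairing_section, transportPairing_section,
      ← transportSection_symm_apply]
    simp only [LinearMap.compr₂_apply, LinearMap.compl₁₂_apply, transportSection_symm']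
    exact C.lie_pair _ _ _ _
  symmetrization α β y e := by
    rw [mvfderiv_transportPairing, transportPairing_apply, ← section_add_apply,
      ← transportSection_symm_apply]
    simp only [LinearMap.compr₂_apply, LinearMap.compl₁₂_apply, map_add, transportSection_symm']
    exact C.symmetrization _ _ _ _

/-- The isomorphism onto the transported Courant algebroid. -/
def CourantAlgebroid.transportIso : CourantIso C (C.transport h₁ h₂ Φ) where
  base := Φ
  fiber x := frameEquiv h₁ h₂ x (Φ x)
  total := frameDiffeomorph h₁ h₂ Φ
  total_mk _ _ := rfl
  anchor x v := by
    have key : ∀ x', x' = x → (mfderiv I₁ I₂ Φ x' (C.anchor x' (frameEquiv h₂ h₁ (Φ x) x'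
        (frameEquiv h₁ h₂ x (Φ x) v))) : EB₂) = mfderiv I₁ I₂ Φ x (C.anchor x v) := by
      rintro _ rfl
      rw [← frameEquiv_symm, LinearEquiv.symm_apply_apply]
    exact key _ (Φ.symm_apply_apply x)
  pairing x v w := by
    have key : ∀ x', x' = x → C.pairing x' (frameEquiv h₂ h₁ (Φ x) x' (frameEquiv h₁ h₂ x (Φ x) v))
        (frameEquiv h₂ h₁ (Φ x) x' (frameEquiv h₁ h₂ x (Φ x) w)) = C.pairing x v w := by
      rintro _ rfl
      rw [← frameEquiv_symm, LinearEquiv.symm_apply_apply, LinearEquiv.symm_apply_apply]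
    exact key _ (Φ.symm_apply_apply x)
  bracket σ σ' τ τ' h h' x := by
    rw [← transportSection_eq_iff h₁ h₂ Φ] at h h'
    refine Eq.trans ?_ (transportSection_apply_apply h₁ h₂ Φ (C.bracket σ σ') x)
    rw [← h, ← h']
    rfl

theorem CourantAlgebroid.transport_bracket_frame (i j : ι) :
    (C.transport h₁ h₂ Φ).bracket (s₂ i) (s₂ j) = transportSection h₁ h₂ Φ (C.bracket (s₁ i) (s₁ j)) := by
  rw [← transportSection_frame h₂ h₁ Φ.symm i, ← transportSection_frame h₂ h₁ Φ.symm j]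
  rfl

theorem CourantAlgebroid.transport_pairing_frame (i j : ι) (y : M₂) :
    (C.transport h₁ h₂ Φ).pairing y (s₂ i y) (s₂ j y) =
      C.pairing (Φ.symm y) (s₁ i (Φ.symm y)) (s₁ j (Φ.symm y)) := by
  rw [← frameEquiv_apply_frame h₂ h₁ y (Φ.symm y) i, ← frameEquiv_apply_frame h₂ h₁ y (Φ.symm y) j]
  rfl

end Transport

/-! ### Courant algebroids on a retract of the base, from sections closed under the bracket. -/

section Descent

variable {EB : Type*} [NormedAddCommGroup EB] [NormedSpace ℝ EB]
  {H : Type*} [TopologicalSpace H] {I : ModelWithCorners ℝ EB H}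
  {M : Type*} [TopologicalSpace M] [ChartedSpace H M] [IsManifold I ∞ M]
  {EB' : Type*} [NormedAddCommGroup EB'] [NormedSpace ℝ EB']
  {H' : Type*} [TopologicalSpace H'] {I' : ModelWithCorners ℝ EB' H'}
  {N : Type*} [TopologicalSpace N] [ChartedSpace H' N] [IsManifold I' ∞ N]
  {F : Type*} [NormedAddCommGroup F] [NormedSpace ℝ F]
  {E : M → Type*} [TopologicalSpace (TotalSpace F E)] [∀ x, AddCommGroup (E x)]
  [∀ x, Module ℝ (E x)] [∀ x, TopologicalSpace (E x)] [FiberBundle F E]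
  [VectorBundle ℝ F E] [ContMDiffVectorBundle ∞ F E I]
  {F' : Type*} [NormedAddCommGroup F'] [NormedSpace ℝ F']
  {E' : N → Type*} [TopologicalSpace (TotalSpace F' E')] [∀ x, AddCommGroup (E' x)]
  [∀ x, Module ℝ (E' x)] [∀ x, TopologicalSpace (E' x)] [FiberBundle F' E']
  [VectorBundle ℝ F' E'] [ContMDiffVectorBundle ∞ F' E' I']

/-- Data that exhibit the sections of `E' → N` as a subspace of the sections of `E → M` which is
closed under the bracket of a Courant algebroid, where `N` is a retract of `M`. -/
structure Descent (C : CourantAlgebroid I F E) (F' : Type*) [NormedAddCommGroup F']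
    [NormedSpace ℝ F'] (E' : N → Type*) [TopologicalSpace (TotalSpace F' E')]
    [∀ x, AddCommGroup (E' x)] [∀ x, Module ℝ (E' x)] [∀ x, TopologicalSpace (E' x)]
    [FiberBundle F' E'] [VectorBundle ℝ F' E'] where
  emb : C^∞⟮I', N; I, M⟯
  retr : C^∞⟮I, M; I', N⟯
  retr_emb : ∀ q, retr (emb q) = q
  incl : Cₛ^∞⟮I'; F', E'⟯ →ₗ[ℝ] Cₛ^∞⟮I; F, E⟯
  fib : ∀ q, E' q →ₗ[ℝ] E (emb q)
  contMDiff_fib : ContMDiff (I'.prod 𝓘(ℝ, F')) (I.prod 𝓘(ℝ, F)) ∞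
    (fun v : TotalSpace F' E' => (⟨emb v.1, fib v.1 v.2⟩ : TotalSpace F E))
  incl_emb : ∀ σ q, incl σ (emb q) = fib q (σ q)
  incl_fsmul : ∀ (f : C^∞⟮I', N; ℝ⟯) σ, incl (fsmul f σ) = fsmul (f.comp retr) (incl σ)
  pairing_basic : ∀ σ τ x, C.pairing x (incl σ x) (incl τ x) =
    C.pairing (emb (retr x)) (incl σ (emb (retr x))) (incl τ (emb (retr x)))
  nondegenerate : ∀ q v, (∀ w, C.pairing (emb q) (fib q v) (fib q w) = 0) → v = 0
  closed : ∀ σ τ, ∃ υ, C.bracket (incl σ) (incl τ) = incl υ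

namespace Descent

variable {C : CourantAlgebroid I F E} (D : Descent (I' := I') (N := N) C F' E')

/-- A vector in the kernel pairs to zero with everything, so the nondegeneracy of the pairing on the
image suffices. -/
theorem fib_injective (q : N) : Function.Injective (D.fib q) := by
  rw [← LinearMap.ker_eq_bot, LinearMap.ker_eq_bot']
  intro v hv
  exact D.nondegenerate q v fun w => by rw [hv, map_zero, LinearMap.zero_apply]

theorem incl_injective : Function.Injective D.incl := fun σ τ h => by
  ext q
  apply D.fib_injective q
  rw [← D.incl_emb, h, D.incl_emb]

/-- The descended bracket. -/
def bracketFun (σ τ : Cₛ^∞⟮I'; F', E'⟯) : Cₛ^∞⟮I'; F', E'⟯ := (D.closed σ τ).choose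

theorem incl_bracketFun (σ τ : Cₛ^∞⟮I'; F', E'⟯) :
    D.incl (D.bracketFun σ τ) = C.bracket (D.incl σ) (D.incl τ) := (D.closed σ τ).choose_spec.symm

/-- The descended bracket, as a bilinear map. -/
def bracket : Cₛ^∞⟮I'; F', E'⟯ →ₗ[ℝ] Cₛ^∞⟮I'; F', E'⟯ →ₗ[ℝ] Cₛ^∞⟮I'; F', E'⟯ :=
  LinearMap.mk₂ ℝ D.bracketFun
    (fun _ _ _ => D.incl_injective (by
      simp only [map_add, LinearMap.add_apply, incl_bracketFun]))
    (fun _ _ _ => D.incl_injective (by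
      simp only [map_smul, LinearMap.smul_apply, incl_bracketFun]))
    (fun _ _ _ => D.incl_injective (by simp only [map_add, incl_bracketFun]))
    (fun _ _ _ => D.incl_injective (by simp only [map_smul, incl_bracketFun]))

theorem incl_bracket (σ τ : Cₛ^∞⟮I'; F', E'⟯) :
    D.incl (D.bracket σ τ) = C.bracket (D.incl σ) (D.incl τ) := D.incl_bracketFun σ τ

theorem fib_bracket (σ τ : Cₛ^∞⟮I'; F', E'⟯) (q : N) :
    D.fib q (D.bracket σ τ q) = C.bracket (D.incl σ) (D.incl τ) (D.emb q) := by
  rw [← D.incl_bracket, D.incl_emb]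

/-- The descended anchor. -/
def anchor (q : N) : E' q →ₗ[ℝ] TangentSpace I' q where
  toFun v := (mfderiv I I' D.retr (D.emb q) (C.anchor (D.emb q) (D.fib q v)) : EB')
  map_add' v w := by
    rw [map_add, map_add, map_add]; rfl
  map_smul' c w := by
    rw [map_smul, map_smul, map_smul]; rfl

/-- The chain rule for the retraction. It turns each derivative in the axioms on `N` into one on
`M`, taken of a pulled back function. -/
theorem mvfderiv_anchor (f : C^∞⟮I', N; ℝ⟯) (q : N) (v : E' q) :
    mvfderiv I' f q (D.anchor q v) =
      mvfderiv I (f.comp D.retr) (D.emb q) (C.anchor (D.emb q) (D.fib q v)) := by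
  refine (mvfderiv_comp_apply_of_eq (D.emb q) (CourantAlgebroid.mdifferentiableAt_fun f _)
    ((D.retr.contMDiff _).mdifferentiableAt (by simp)) (D.retr_emb q) _).symm

theorem contMDiff_anchor : ContMDiff (I'.prod 𝓘(ℝ, F')) I'.tangent ∞
    (fun v : TotalSpace F' E' => (⟨v.1, D.anchor v.1 v.2⟩ : TangentBundle I' N)) := by
  have h := (D.retr.contMDiff.contMDiff_tangentMap (m := ∞) (by simp)).comp
    (C.contMDiff_anchor.comp D.contMDiff_fib)
  refine h.congr fun v => ?_
  have key : ∀ (y' : N) (w : EB'), y' = v.1 → (⟨v.1, w⟩ : TangentBundle I' N) = ⟨y', w⟩ := by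
    rintro _ _ rfl; rfl
  exact key _ _ (D.retr_emb v.1)

/-- The descended pairing. -/
def pairing (q : N) : LinearMap.BilinForm ℝ (E' q) :=
  (C.pairing (D.emb q)).compl₁₂ (D.fib q) (D.fib q)

theorem pairing_apply (q : N) (v w : E' q) :
    D.pairing q v w = C.pairing (D.emb q) (D.fib q v) (D.fib q w) := rfl

theorem pairing_section (σ τ : Cₛ^∞⟮I'; F', E'⟯) (q : N) :
    D.pairing q (σ q) (τ q) = C.pair (D.incl σ) (D.incl τ) (D.emb q) := by
  rw [pairing_apply, CourantAlgebroid.pair_apply, D.incl_emb, D.incl_emb]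

theorem contMDiff_pairing (σ τ : Cₛ^∞⟮I'; F', E'⟯) :
    ContMDiff I' 𝓘(ℝ, ℝ) ∞ (fun q => D.pairing q (σ q) (τ q)) :=
  ((C.pair (D.incl σ) (D.incl τ)).contMDiff.comp D.emb.contMDiff).congr (D.pairing_section σ τ)

/-- By `pairing_basic` the pairing of included sections is itself pulled back along the retraction,
so the preceding chain rule applies to it. -/
theorem mvfderiv_pairing (σ τ : Cₛ^∞⟮I'; F', E'⟯) (q : N) (v : E' q) :
    mvfderiv I' (fun q => D.pairing q (σ q) (τ q)) q (D.anchor q v) =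
      mvfderiv I (C.pair (D.incl σ) (D.incl τ)) (D.emb q) (C.anchor (D.emb q) (D.fib q v)) := by
  refine (D.mvfderiv_anchor ⟨_, D.contMDiff_pairing σ τ⟩ q v).trans ?_
  congr 2
  ext x
  refine (D.pairing_section σ τ (D.retr x)).trans ?_
  exact (D.pairing_basic σ τ x).symm

/-- The Courant algebroid on the retract. -/
def courantAlgebroid : CourantAlgebroid I' F' E' where
  anchor := D.anchor
  contMDiff_anchor := D.contMDiff_anchor
  pairing := D.pairing
  pairing_symm q v w := C.pairing_symm _ _ _
  pairing_nondegenerate q v h := D.nondegenerate q v h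
  contMDiff_pairing := D.contMDiff_pairing
  bracket := D.bracket
  leibniz α β f q := by
    apply D.fib_injective q
    rw [D.fib_bracket, D.incl_fsmul, C.bracket_fsmul, mvfderiv_anchor, map_add, map_smul, map_smul,
      D.fib_bracket, ← D.incl_emb, ← D.incl_emb, section_add_apply, fsmul_apply, fsmul_apply]
    change f (D.retr (D.emb q)) • _ + _ = _
    rw [D.retr_emb]
    rfl
  jacobi α β γ := by
    apply D.incl_injective
    simp only [map_add, map_sub, map_zero, incl_bracket]
    exact C.jacobi _ _ _
  bracket_pairing α β γ q := by
    rw [mvfderiv_pairing, pairing_section, pairing_section, ← D.incl_emb, D.incl_bracket,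
      D.incl_bracket]
    exact C.lie_pair _ _ _ _
  symmetrization α β q e := by
    rw [mvfderiv_pairing, pairing_apply, ← section_add_apply, ← D.incl_emb, map_add, D.incl_bracket,
      D.incl_bracket]
    exact C.symmetrization _ _ _ _

end Descent
end Descent

/-! ### Coefficients in a global frame. -/

section GlobalFrame

variable {EB : Type*} [NormedAddCommGroup EB] [NormedSpace ℝ EB]
  {H : Type*} [TopologicalSpace H] {I : ModelWithCorners ℝ EB H}
  {M : Type*} [TopologicalSpace M] [ChartedSpace H M] [IsManifold I ∞ M]
  {F : Type*} [NormedAddCommGroup F] [NormedSpace ℝ F] [FiniteDimensional ℝ F]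
  {E : M → Type*} [TopologicalSpace (TotalSpace F E)] [∀ x, AddCommGroup (E x)]
  [∀ x, Module ℝ (E x)] [∀ x, TopologicalSpace (E x)] [FiberBundle F E]
  [VectorBundle ℝ F E] [ContMDiffVectorBundle ∞ F E I] {ι : Type*} [Fintype ι]
  {s : ι → Cₛ^∞⟮I; F, E⟯}

/-- The coefficients of a section in a global frame. -/
def frameCoeff (hs : ∀ x, IsFrameAt (fun i => s i) x) (σ : Cₛ^∞⟮I; F, E⟯) (i : ι) : C^∞⟮I, M; ℝ⟯ :=
  ⟨fun x => (hs x).equiv.symm (σ x) i, fun x => contMDiffAt_pi_space.1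
    ((hs x).contMDiffAt_coeff (v := fun y => ⟨y, σ y⟩) (c := fun y => (hs y).equiv.symm (σ y))
      (σ.contMDiff x) (Filter.Eventually.of_forall fun y =>
        ((hs y).equiv.apply_symm_apply (σ y)).symm)) i⟩

theorem sum_frameCoeff_apply (hs : ∀ x, IsFrameAt (fun i => s i) x) (σ : Cₛ^∞⟮I; F, E⟯) (x : M) :
    ∑ i, frameCoeff hs σ i x • s i x = σ x := (hs x).equiv.apply_symm_apply (σ x)

theorem sum_frameCoeff (hs : ∀ x, IsFrameAt (fun i => s i) x) (σ : Cₛ^∞⟮I; F, E⟯) :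
    ∑ i, fsmul (frameCoeff hs σ i) (s i) = σ := by
  ext x
  rw [section_sum_apply]
  exact sum_frameCoeff_apply hs σ x

end GlobalFrame

/-! ### Calculus on an open interval and the frame of its generalized tangent bundle. -/

section Interval

variable {a b : ℝ}

theorem mem_chart_source_interval (x y : interval a b) : y ∈ (chartAt ℝ x).source := by
  simp only [TopologicalSpace.Opens.chartAt_eq, OpenPartialHomeomorph.subtypeRestr_source]
  exact Set.mem_univ (y : ℝ)

/-- Every chart of the interval is the inclusion into `ℝ`, so the tangent trivializations are the
identity and constant coefficients are smooth. -/
theorem trivializationAt_interval_apply (x y : interval a b) (v : TangentSpace 𝓘(ℝ, ℝ) y) :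
    (trivializationAt ℝ (TangentSpace 𝓘(ℝ, ℝ) : interval a b → Type _) x ⟨y, v⟩).2 = (v : ℝ) := by
  rw [trivializationAt_tangent_apply (mem_chart_source_interval x y)]
  have e : (extChartAt 𝓘(ℝ, ℝ) x : interval a b → ℝ) = Subtype.val := rfl
  rw [e, mfderiv_opens_val_apply]

/-- The coordinate vector field of an interval. -/
def intervalVectorField (a b : ℝ) :
    Cₛ^∞⟮𝓘(ℝ, ℝ); ℝ, (TangentSpace 𝓘(ℝ, ℝ) : interval a b → Type _)⟯ :=
  ⟨fun _ => (1 : ℝ), fun x => (contMDiffAt_section x).2 <|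
    (contMDiffAt_const (c := (1 : ℝ))).congr_of_eventuallyEq <| Filter.Eventually.of_forall fun y =>
      trivializationAt_interval_apply x y _⟩

/-- The coordinate 1-form of an interval. -/
def intervalForm (a b : ℝ) :
    Cₛ^∞⟮𝓘(ℝ, ℝ); ℝ →L[ℝ] ℝ, (Cotangent 𝓘(ℝ, ℝ) (interval a b))⟯ :=
  ⟨fun _ => ContinuousLinearMap.id ℝ ℝ, fun x => by
    rw [contMDiffAt_hom_bundle]
    refine ⟨contMDiffAt_id, (contMDiffAt_const (c := ContinuousLinearMap.id ℝ ℝ)).congr_of_eventuallyEq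
      (Filter.Eventually.of_forall fun y => ?_)⟩
    ext
    have hy : y ∈ (trivializationAt ℝ (TangentSpace 𝓘(ℝ, ℝ) : interval a b → Type _) x).baseSet := by
      change y ∈ (chartAt ℝ x).source
      exact mem_chart_source_interval x y
    have h := (trivializationAt ℝ (TangentSpace 𝓘(ℝ, ℝ) : interval a b → Type _) x).apply_mk_symm hy
      (1 : ℝ)
    have h' := congrArg Prod.snd h
    rw [trivializationAt_interval_apply] at h'
    have e1 : (trivializationAt ℝ (TangentSpace 𝓘(ℝ, ℝ) : interval a b → Type _) x).symmL ℝ y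
        (1 : ℝ) = (1 : ℝ) := (Trivialization.symmL_apply _ hy _).trans h'
    have e2 : (trivializationAt ℝ (Bundle.Trivial (interval a b) ℝ) x).continuousLinearMapAt ℝ y
      (1 : ℝ) = (1 : ℝ) := Trivialization.continuousLinearMapAt_apply_of_mem ℝ
        (trivializationAt ℝ (Bundle.Trivial (interval a b) ℝ) x) (b := y) (Set.mem_univ y) (1 : ℝ)
    simp only [ContinuousLinearMap.inCoordinates]
    rw [ContinuousLinearMap.comp_apply]
    refine Eq.trans ?_ e2
    exact congrArg (fun r : ℝ => (trivializationAt ℝ (Bundle.Trivial (interval a b) ℝ)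
      x).continuousLinearMapAt ℝ y r) e1⟩

/-- The vector field `∂_t` as a section of the generalized tangent bundle. -/
def ddt (a b : ℝ) : Cₛ^∞⟮𝓘(ℝ, ℝ); ℝ × (ℝ →L[ℝ] ℝ), GenTangent 𝓘(ℝ, ℝ) (interval a b)⟯ :=
  pairSection (intervalVectorField a b) 0

/-- The form `dt` as a section of the generalized tangent bundle. -/
def dt (a b : ℝ) : Cₛ^∞⟮𝓘(ℝ, ℝ); ℝ × (ℝ →L[ℝ] ℝ), GenTangent 𝓘(ℝ, ℝ) (interval a b)⟯ :=
  pairSection 0 (intervalForm a b)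

/-- The derivative of a function on an interval. -/
def intervalDeriv (f : C^∞⟮𝓘(ℝ, ℝ), interval a b; ℝ⟯) : C^∞⟮𝓘(ℝ, ℝ), interval a b; ℝ⟯ :=
  ⟨fun s => mvfderiv 𝓘(ℝ, ℝ) f s (intervalVectorField a b s),
    contMDiff_mvfderiv_apply f.contMDiff (intervalVectorField a b).contMDiff⟩

theorem mvfderiv_interval (f : C^∞⟮𝓘(ℝ, ℝ), interval a b; ℝ⟯) (s : interval a b) (v : ℝ) :
    mvfderiv 𝓘(ℝ, ℝ) f s v = v * intervalDeriv f s := by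
  have h := map_smul (mvfderiv 𝓘(ℝ, ℝ) f s) v (intervalVectorField a b s)
  have e : v • intervalVectorField a b s = v := mul_one v
  rw [e] at h
  exact h

/-- Extended by `0` to the real line, the function has zero derivative on the connected set `Set.Ioo
a b`. -/
theorem eq_of_intervalDeriv_eq_zero {f : C^∞⟮𝓘(ℝ, ℝ), interval a b; ℝ⟯}
    (h : ∀ s, intervalDeriv f s = 0) (s s' : interval a b) : f s = f s' := by
  classical
  let g : ℝ → ℝ := fun r => if h : r ∈ interval a b then f ⟨r, h⟩ else 0
  have hg : ∀ r : interval a b, g r = f r := fun r => dif_pos r.2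
  have hd : ∀ r ∈ Set.Ioo a b, HasDerivAt g 0 r := by
    intro r hr
    obtain ⟨f', hf'⟩ := exists_function_extending (interval a b) f ⟨r, hr⟩
    have h1 : g =ᶠ[nhds r] f' := by
      refine (eventually_nhds_opens (U := interval a b) (x := ⟨r, hr⟩)).1 ?_
      filter_upwards [hf'] with y hy
      rw [hg, hy]
    have h2 : DifferentiableAt ℝ f' r :=
      (f'.contMDiff.contDiff.differentiable (by simp)) r
    have h3 : deriv f' r = 0 := by
      have e := mvfderiv_of_extends hf' (intervalVectorField a b ⟨r, hr⟩)
      have e0 := h ⟨r, hr⟩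
      change mvfderiv 𝓘(ℝ, ℝ) f ⟨r, hr⟩ _ = 0 at e0
      rw [e0] at e
      rw [← fderiv_apply_one_eq_deriv]
      rw [mvfderiv, mfderiv_eq_fderiv] at e
      exact e.symm
    exact (h3 ▸ h2.hasDerivAt).congr_of_eventuallyEq h1
  have := (isOpen_Ioo (a := a) (b := b)).is_const_of_deriv_eq_zero isPreconnected_Ioo
    (fun r hr => (hd r hr).differentiableAt.differentiableWithinAt) (fun r hr => (hd r hr).deriv)
    s.2 s'.2
  rwa [hg, hg] at this

/-- The frame `∂_t`, `dt` of the generalized tangent bundle of an interval. -/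
def intervalFrame (a b : ℝ) :
    Fin 2 → Cₛ^∞⟮𝓘(ℝ, ℝ); ℝ × (ℝ →L[ℝ] ℝ), GenTangent 𝓘(ℝ, ℝ) (interval a b)⟯ := ![ddt a b, dt a b]

theorem genTangent_interval_eq (s : interval a b) (r c : ℝ) :
    r • ddt a b s + c • dt a b s = ((r : ℝ), c • ContinuousLinearMap.id ℝ ℝ) := by
  have e1 : r • (1 : ℝ) + c • (0 : ℝ) = r := by simp
  have e2 : r • (0 : ℝ →L[ℝ] ℝ) + c • ContinuousLinearMap.id ℝ ℝ = c • ContinuousLinearMap.id ℝ ℝ := by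
    rw [smul_zero, zero_add]
  exact Prod.ext e1 e2

theorem isFrameAt_interval (s : interval a b) : IsFrameAt (fun i => intervalFrame a b i) s := by
  have key : ∀ c : Fin 2 → ℝ, Fintype.linearCombination ℝ (fun i => intervalFrame a b i s) c =
      ((c 0 : ℝ), c 1 • ContinuousLinearMap.id ℝ ℝ) := by
    intro c
    rw [Fintype.linearCombination_apply, Fin.sum_univ_two]
    exact genTangent_interval_eq s _ _
  constructor
  · intro c c' h
    rw [key, key] at h
    have h1 : c 0 = c' 0 := congrArg Prod.fst h
    have h2 : c 1 • ContinuousLinearMap.id ℝ ℝ = c' 1 • ContinuousLinearMap.id ℝ ℝ :=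
      congrArg Prod.snd h
    have h3 : c 1 * 1 = c' 1 * 1 := congrArg (fun β : ℝ →L[ℝ] ℝ => β 1) h2
    ext i
    fin_cases i
    · exact h1
    · simpa using h3
  · rintro ⟨p, β⟩
    refine ⟨![(p : ℝ), (show ℝ →L[ℝ] ℝ from β) 1], (key _).trans ?_⟩
    refine Prod.ext rfl ?_
    change (show ℝ →L[ℝ] ℝ from β) 1 • ContinuousLinearMap.id ℝ ℝ = (show ℝ →L[ℝ] ℝ from β)
    ext
    simp

/-- The vector field component of a section of the generalized tangent bundle of an interval. -/
def vectorCoeff (σ : Cₛ^∞⟮𝓘(ℝ, ℝ); ℝ × (ℝ →L[ℝ] ℝ), GenTangent 𝓘(ℝ, ℝ) (interval a b)⟯) :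
    C^∞⟮𝓘(ℝ, ℝ), interval a b; ℝ⟯ := frameCoeff (s := intervalFrame a b) isFrameAt_interval σ 0

/-- The 1-form component of a section of the generalized tangent bundle of an interval. -/
def formCoeff (σ : Cₛ^∞⟮𝓘(ℝ, ℝ); ℝ × (ℝ →L[ℝ] ℝ), GenTangent 𝓘(ℝ, ℝ) (interval a b)⟯) :
    C^∞⟮𝓘(ℝ, ℝ), interval a b; ℝ⟯ := frameCoeff (s := intervalFrame a b) isFrameAt_interval σ 1

theorem section_interval_eq
    (σ : Cₛ^∞⟮𝓘(ℝ, ℝ); ℝ × (ℝ →L[ℝ] ℝ), GenTangent 𝓘(ℝ, ℝ) (interval a b)⟯) :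
    σ = fsmul (vectorCoeff σ) (ddt a b) + fsmul (formCoeff σ) (dt a b) := by
  refine (sum_frameCoeff (s := intervalFrame a b) isFrameAt_interval σ).symm.trans ?_
  rw [Fin.sum_univ_two]
  rfl

theorem fst_section_interval
    (σ : Cₛ^∞⟮𝓘(ℝ, ℝ); ℝ × (ℝ →L[ℝ] ℝ), GenTangent 𝓘(ℝ, ℝ) (interval a b)⟯) (s : interval a b) :
    (σ s).1 = vectorCoeff σ s • intervalVectorField a b s := by
  conv_lhs => rw [section_interval_eq σ]
  change vectorCoeff σ s • intervalVectorField a b s +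
    formCoeff σ s • (0 : TangentSpace 𝓘(ℝ, ℝ) s) = _
  rw [smul_zero, add_zero]

theorem snd_section_interval
    (σ : Cₛ^∞⟮𝓘(ℝ, ℝ); ℝ × (ℝ →L[ℝ] ℝ), GenTangent 𝓘(ℝ, ℝ) (interval a b)⟯) (s : interval a b) :
    (σ s).2 = formCoeff σ s • intervalForm a b s := by
  conv_lhs => rw [section_interval_eq σ]
  change vectorCoeff σ s • (0 : Cotangent 𝓘(ℝ, ℝ) (interval a b) s) +
    formCoeff σ s • intervalForm a b s = _
  rw [smul_zero]
  exact zero_add _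

theorem mdifferentiableAt_intervalVectorField (s : interval a b) :
    MDifferentiableAt 𝓘(ℝ, ℝ) (𝓘(ℝ, ℝ).prod 𝓘(ℝ, ℝ))
      (fun y => (⟨y, intervalVectorField a b y⟩ : TangentBundle 𝓘(ℝ, ℝ) (interval a b))) s :=
  ((intervalVectorField a b).contMDiff s).mdifferentiableAt (by simp)

/-- Leibniz in both arguments, with `[∂_t, ∂_t] = 0`. -/
theorem mlieBracket_interval (f g : C^∞⟮𝓘(ℝ, ℝ), interval a b; ℝ⟯) (s : interval a b) :
    VectorField.mlieBracket 𝓘(ℝ, ℝ) (fun y => f y • intervalVectorField a b y)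
      (fun y => g y • intervalVectorField a b y) s =
    (f s * intervalDeriv g s - g s * intervalDeriv f s) • intervalVectorField a b s := by
  have I1 : IsManifold 𝓘(ℝ, ℝ) (minSmoothness ℝ 2) (interval a b) :=
    IsManifold.of_le (n := ∞) (by rw [minSmoothness_of_isRCLikeNormedField]; exact ENat.LEInfty.out)
  have hX := mdifferentiableAt_intervalVectorField s
  have hf := CourantAlgebroid.mdifferentiableAt_fun f s
  have hg := CourantAlgebroid.mdifferentiableAt_fun g s
  have h1 := VectorField.mlieBracket_smul_left (V := intervalVectorField a b)
    (W := intervalVectorField a b) hf hX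
  rw [VectorField.mlieBracket_self] at h1
  have h2 := VectorField.mlieBracket_smul_right (V := (f : interval a b → ℝ) •
    (intervalVectorField a b : ∀ s : interval a b, TangentSpace 𝓘(ℝ, ℝ) s)) (W := intervalVectorField a b) hg hX
  rw [h1] at h2
  refine h2.trans ?_
  have e : mvfderiv 𝓘(ℝ, ℝ) g s (f s • intervalVectorField a b s) = f s * intervalDeriv g s := by
    rw [map_smul]; rfl
  change mvfderiv 𝓘(ℝ, ℝ) g s (f s • intervalVectorField a b s) • _ +
    g s • (-(intervalDeriv f s) • intervalVectorField a b s + f s • (0 : TangentSpace 𝓘(ℝ, ℝ) s)) = _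
  rw [e]
  module

end Interval

/-! ### The product of an interval with a manifold, and frames of the product bundle. -/

section Product

variable {a b : ℝ}
  {EB : Type*} [NormedAddCommGroup EB] [NormedSpace ℝ EB]
  {H : Type*} [TopologicalSpace H] {I : ModelWithCorners ℝ EB H}
  {N : Type*} [TopologicalSpace N] [ChartedSpace H N] [IsManifold I ∞ N]

/-- Restriction to the line through `q` reduces this to the statement on an interval. -/
theorem eq_of_mvfderiv_fst_eq_zero {g : C^∞⟮𝓘(ℝ, ℝ).prod I, interval a b × N; ℝ⟯}
    (h : ∀ x, mvfderiv (𝓘(ℝ, ℝ).prod I) g x ((1 : ℝ), (0 : EB)) = 0) (s s' : interval a b) (q : N) :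
    g (s, q) = g (s', q) := by
  let j : C^∞⟮𝓘(ℝ, ℝ), interval a b; 𝓘(ℝ, ℝ).prod I, interval a b × N⟯ :=
    ⟨fun s => (s, q), contMDiff_id.prodMk contMDiff_const⟩
  refine eq_of_intervalDeriv_eq_zero (f := g.comp j) (fun r => ?_) s s'
  refine (mvfderiv_comp_apply r (CourantAlgebroid.mdifferentiableAt_fun g (j r))
    ((j.contMDiff r).mdifferentiableAt (by simp)) _).trans ?_
  have e : mfderiv 𝓘(ℝ, ℝ) (𝓘(ℝ, ℝ).prod I) j r (intervalVectorField a b r) =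
      ((1 : ℝ), (0 : EB)) := by
    change mfderiv 𝓘(ℝ, ℝ) (𝓘(ℝ, ℝ).prod I) (fun s : interval a b => (s, q)) r _ = _
    rw [mfderiv_prod_left]
    rfl
  rw [e]
  exact h _

theorem mvfderiv_comp_fst (f : C^∞⟮𝓘(ℝ, ℝ), interval a b; ℝ⟯) (x : interval a b × N)
    (v : TangentSpace (𝓘(ℝ, ℝ).prod I) x) :
    mvfderiv (𝓘(ℝ, ℝ).prod I) (f.comp (ContMDiffMap.fst :
      C^∞⟮𝓘(ℝ, ℝ).prod I, interval a b × N; 𝓘(ℝ, ℝ), interval a b⟯)) x v =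
      (v : ℝ × EB).1 * intervalDeriv f x.1 := by
  refine (mvfderiv_comp_apply x (CourantAlgebroid.mdifferentiableAt_fun f x.1)
    (f := (ContMDiffMap.fst :
      C^∞⟮𝓘(ℝ, ℝ).prod I, interval a b × N; 𝓘(ℝ, ℝ), interval a b⟯))
    (ContMDiffMap.fst.contMDiff.mdifferentiableAt (by simp)) v).trans ?_
  have e : mfderiv (𝓘(ℝ, ℝ).prod I) 𝓘(ℝ, ℝ) (Prod.fst : interval a b × N → interval a b) x v =
      (v : ℝ × EB).1 := by
    rw [mfderiv_fst]; rfl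
  exact (congrArg (mvfderiv 𝓘(ℝ, ℝ) f x.1) e).trans (mvfderiv_interval f x.1 (v : ℝ × EB).1)

theorem mvfderiv_comp_snd (f : C^∞⟮I, N; ℝ⟯) (x : interval a b × N)
    (v : TangentSpace (𝓘(ℝ, ℝ).prod I) x) :
    mvfderiv (𝓘(ℝ, ℝ).prod I) (f.comp (ContMDiffMap.snd :
      C^∞⟮𝓘(ℝ, ℝ).prod I, interval a b × N; I, N⟯)) x v =
      mvfderiv I f x.2 (v : ℝ × EB).2 := by
  refine (mvfderiv_comp_apply x (CourantAlgebroid.mdifferentiableAt_fun f x.2)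
    (f := (ContMDiffMap.snd :
      C^∞⟮𝓘(ℝ, ℝ).prod I, interval a b × N; I, N⟯))
    (ContMDiffMap.snd.contMDiff.mdifferentiableAt (by simp)) v).trans ?_
  have e : mfderiv (𝓘(ℝ, ℝ).prod I) I (Prod.snd : interval a b × N → N) x v =
      (v : ℝ × EB).2 := by
    rw [mfderiv_snd]; rfl
  exact congrArg (mvfderiv I f x.2) e

variable {F : Type*} [NormedAddCommGroup F] [NormedSpace ℝ F] [FiniteDimensional ℝ F]
  {E : N → Type*} [TopologicalSpace (TotalSpace F E)] [∀ x, AddCommGroup (E x)]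
  [∀ x, Module ℝ (E x)] [∀ x, TopologicalSpace (E x)] [FiberBundle F E]
  [VectorBundle ℝ F E] [ContMDiffVectorBundle ∞ F E I] {ι : Type*} [Fintype ι]

/-- Sections of the generalized tangent bundle of an interval. -/
abbrev IntervalSection (a b : ℝ) : Type :=
  Cₛ^∞⟮𝓘(ℝ, ℝ); ℝ × (ℝ →L[ℝ] ℝ), GenTangent 𝓘(ℝ, ℝ) (interval a b)⟯

variable (I F E) in
/-- The vector field `∂_t`, as a section over the product. -/
abbrev prodDdt (a b : ℝ) :
    Cₛ^∞⟮𝓘(ℝ, ℝ).prod I; (ℝ × (ℝ →L[ℝ] ℝ)) × F,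
      BoxProd 𝓘(ℝ, ℝ) I (GenTangent 𝓘(ℝ, ℝ) (interval a b)) E⟯ := inclFst (ddt a b)

variable (I F E) in
/-- The form `dt`, as a section over the product. -/
abbrev prodDt (a b : ℝ) :
    Cₛ^∞⟮𝓘(ℝ, ℝ).prod I; (ℝ × (ℝ →L[ℝ] ℝ)) × F,
      BoxProd 𝓘(ℝ, ℝ) I (GenTangent 𝓘(ℝ, ℝ) (interval a b)) E⟯ := inclFst (dt a b)

theorem inclFst_add (σ τ : IntervalSection a b) :
    (inclFst (σ + τ) : Cₛ^∞⟮𝓘(ℝ, ℝ).prod I; (ℝ × (ℝ →L[ℝ] ℝ)) × F,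
      BoxProd 𝓘(ℝ, ℝ) I (GenTangent 𝓘(ℝ, ℝ) (interval a b)) E⟯) = inclFst σ + inclFst τ := by
  refine ContMDiffSection.ext fun x => ?_
  exact Prod.ext rfl (add_zero (0 : E x.2)).symm

theorem inclFst_fsmul (f : C^∞⟮𝓘(ℝ, ℝ), interval a b; ℝ⟯) (σ : IntervalSection a b) :
    (inclFst (fsmul f σ) : Cₛ^∞⟮𝓘(ℝ, ℝ).prod I; (ℝ × (ℝ →L[ℝ] ℝ)) × F,
      BoxProd 𝓘(ℝ, ℝ) I (GenTangent 𝓘(ℝ, ℝ) (interval a b)) E⟯) =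
      fsmul (f.comp ContMDiffMap.fst) (inclFst σ) := by
  refine ContMDiffSection.ext fun x => ?_
  exact Prod.ext rfl (smul_zero (A := E x.2) (f x.1)).symm

theorem inclSnd_add (σ τ : Cₛ^∞⟮I; F, E⟯) :
    (inclSnd (σ + τ) : Cₛ^∞⟮𝓘(ℝ, ℝ).prod I; (ℝ × (ℝ →L[ℝ] ℝ)) × F,
      BoxProd 𝓘(ℝ, ℝ) I (GenTangent 𝓘(ℝ, ℝ) (interval a b)) E⟯) = inclSnd σ + inclSnd τ := by
  refine ContMDiffSection.ext fun x => ?_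
  exact Prod.ext (add_zero (0 : GenTangent 𝓘(ℝ, ℝ) (interval a b) x.1)).symm rfl

theorem inclSnd_fsmul (f : C^∞⟮I, N; ℝ⟯) (σ : Cₛ^∞⟮I; F, E⟯) :
    (inclSnd (fsmul f σ) : Cₛ^∞⟮𝓘(ℝ, ℝ).prod I; (ℝ × (ℝ →L[ℝ] ℝ)) × F,
      BoxProd 𝓘(ℝ, ℝ) I (GenTangent 𝓘(ℝ, ℝ) (interval a b)) E⟯) =
      fsmul (f.comp ContMDiffMap.snd) (inclSnd σ) := by
  refine ContMDiffSection.ext fun x => ?_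
  exact Prod.ext (smul_zero (A := GenTangent 𝓘(ℝ, ℝ) (interval a b) x.1) (f x.2)).symm rfl

theorem inclSnd_zero :
    (inclSnd (0 : Cₛ^∞⟮I; F, E⟯) : Cₛ^∞⟮𝓘(ℝ, ℝ).prod I; (ℝ × (ℝ →L[ℝ] ℝ)) × F,
      BoxProd 𝓘(ℝ, ℝ) I (GenTangent 𝓘(ℝ, ℝ) (interval a b)) E⟯) = 0 := rfl

theorem inclSnd_sum {κ : Type*} (t : Finset κ) (σ : κ → Cₛ^∞⟮I; F, E⟯) :
    (inclSnd (∑ i ∈ t, σ i) : Cₛ^∞⟮𝓘(ℝ, ℝ).prod I; (ℝ × (ℝ →L[ℝ] ℝ)) × F,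
      BoxProd 𝓘(ℝ, ℝ) I (GenTangent 𝓘(ℝ, ℝ) (interval a b)) E⟯) = ∑ i ∈ t, inclSnd (σ i) := by
  classical
  induction t using Finset.induction_on with
  | empty => exact inclSnd_zero
  | insert i t hi ih => rw [Finset.sum_insert hi, Finset.sum_insert hi, inclSnd_add, ih]

theorem inclFst_eq (σ : IntervalSection a b) :
    (inclFst σ : Cₛ^∞⟮𝓘(ℝ, ℝ).prod I; (ℝ × (ℝ →L[ℝ] ℝ)) × F,
      BoxProd 𝓘(ℝ, ℝ) I (GenTangent 𝓘(ℝ, ℝ) (interval a b)) E⟯) =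
      fsmul ((vectorCoeff σ).comp ContMDiffMap.fst) (prodDdt I F E a b) +
        fsmul ((formCoeff σ).comp ContMDiffMap.fst) (prodDt I F E a b) := by
  conv_lhs => rw [section_interval_eq σ]
  rw [inclFst_add, inclFst_fsmul, inclFst_fsmul]

theorem inclSnd_eq {ε : ι → Cₛ^∞⟮I; F, E⟯} (hε : ∀ q, IsFrameAt (fun i => ε i) q)
    (τ : Cₛ^∞⟮I; F, E⟯) :
    (inclSnd τ : Cₛ^∞⟮𝓘(ℝ, ℝ).prod I; (ℝ × (ℝ →L[ℝ] ℝ)) × F,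
      BoxProd 𝓘(ℝ, ℝ) I (GenTangent 𝓘(ℝ, ℝ) (interval a b)) E⟯) =
      ∑ i, fsmul ((frameCoeff hε τ i).comp ContMDiffMap.snd) (inclSnd (ε i)) := by
  conv_lhs => rw [← sum_frameCoeff hε τ]
  rw [inclSnd_sum]
  simp only [inclSnd_fsmul]

/-- The frame of the product bundle given by `∂_t`, `dt` and a frame of the second factor. -/
def prodFrame (a b : ℝ) (ε : ι → Cₛ^∞⟮I; F, E⟯) : Fin 2 ⊕ ι →
    Cₛ^∞⟮𝓘(ℝ, ℝ).prod I; (ℝ × (ℝ →L[ℝ] ℝ)) × F,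
      BoxProd 𝓘(ℝ, ℝ) I (GenTangent 𝓘(ℝ, ℝ) (interval a b)) E⟯ :=
  Sum.elim (fun i => inclFst (intervalFrame a b i)) (fun i => inclSnd (ε i))

theorem linearCombination_prodFrame (ε : ι → Cₛ^∞⟮I; F, E⟯) (x : interval a b × N)
    (c : Fin 2 ⊕ ι → ℝ) :
    Fintype.linearCombination ℝ (fun i => prodFrame a b ε i x) c =
      (Fintype.linearCombination ℝ (fun i => intervalFrame a b i x.1) (c ∘ Sum.inl),
        Fintype.linearCombination ℝ (fun i => ε i x.2) (c ∘ Sum.inr)) := by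
  rw [Fintype.linearCombination_apply, Fintype.sum_sum_type]
  have e1 : ∀ f : Fin 2 → ℝ, ∑ i, f i • prodFrame a b ε (Sum.inl i) x =
      (∑ i, f i • intervalFrame a b i x.1, 0) := by
    intro f
    rw [Fin.sum_univ_two, Fin.sum_univ_two]
    refine Prod.ext rfl ?_
    change f 0 • (0 : E x.2) + f 1 • (0 : E x.2) = 0
    simp
  have e2 : ∑ i, c (Sum.inr i) • prodFrame a b ε (Sum.inr i) x =
      (0, ∑ i, c (Sum.inr i) • ε i x.2) := by
    have key : ∀ t : Finset ι, ∑ i ∈ t, c (Sum.inr i) • prodFrame a b ε (Sum.inr i) x =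
        (0, ∑ i ∈ t, c (Sum.inr i) • ε i x.2) := by
      classical
      intro t
      induction t using Finset.induction_on with
      | empty => rfl
      | insert i t hi ih =>
        rw [Finset.sum_insert hi, Finset.sum_insert hi, ih]
        refine Prod.ext ?_ rfl
        change c (Sum.inr i) • (0 : GenTangent 𝓘(ℝ, ℝ) (interval a b) x.1) + 0 = 0
        simp
    exact key _
  rw [e1, e2]
  refine Prod.ext ?_ ?_
  · exact add_zero _
  · exact zero_add _

theorem isFrameAt_prodFrame {ε : ι → Cₛ^∞⟮I; F, E⟯} (hε : ∀ q, IsFrameAt (fun i => ε i) q)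
    (x : interval a b × N) : IsFrameAt (fun i => prodFrame a b ε i) x := by
  constructor
  · intro c c' h
    rw [linearCombination_prodFrame, linearCombination_prodFrame] at h
    have h1 := (isFrameAt_interval x.1).1 (congrArg Prod.fst h)
    have h2 := (hε x.2).1 (congrArg Prod.snd h)
    ext (i | i)
    · exact congrFun h1 i
    · exact congrFun h2 i
  · rintro ⟨v, w⟩
    obtain ⟨c, hc⟩ := (isFrameAt_interval x.1).2 v
    obtain ⟨c', hc'⟩ := (hε x.2).2 w
    exact ⟨Sum.elim c c', (linearCombination_prodFrame ε x _).trans (Prod.ext hc hc')⟩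

end Product

/-! ### Bracket relations for a hyperbolic pair consisting of a section and a gradient. -/

section SplitPair

variable {EB : Type*} [NormedAddCommGroup EB] [NormedSpace ℝ EB]
  {H : Type*} [TopologicalSpace H] {I : ModelWithCorners ℝ EB H}
  {M : Type*} [TopologicalSpace M] [ChartedSpace H M] [IsManifold I ∞ M]
  {F : Type*} [NormedAddCommGroup F] [NormedSpace ℝ F]
  {E : M → Type*} [TopologicalSpace (TotalSpace F E)] [∀ x, AddCommGroup (E x)]
  [∀ x, Module ℝ (E x)] [∀ x, TopologicalSpace (E x)] [FiberBundle F E] [VectorBundle ℝ F E]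
  [ContMDiffVectorBundle ∞ F E I]

/-- `B` is the gradient of `t`, and `A` is an isotropic section with `ρ(A) t = 1`. -/
structure IsSplitPair (C : CourantAlgebroid I F E) (A B : Cₛ^∞⟮I; F, E⟯) (t : C^∞⟮I, M; ℝ⟯) :
    Prop where
  pairing_grad : ∀ x v, C.pairing x (B x) v = mvfderiv I t x (C.anchor x v)
  lie_left : ∀ x, C.lie A t x = 1
  isotropic : ∀ x, C.pairing x (A x) (A x) = 0

/-- The section `σ` is orthogonal to `A` and `B` and commutes with `A`. -/
structure IsTransversal (C : CourantAlgebroid I F E) (A B σ : Cₛ^∞⟮I; F, E⟯) : Prop where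
  left : ∀ x, C.pairing x (A x) (σ x) = 0
  right : ∀ x, C.pairing x (B x) (σ x) = 0
  bracket : C.bracket A σ = 0

/-- In the Leibniz rule for `[A, ·]`, one term vanishes since each section commutes with `A`, the
other since the coefficients are constant along `A`. -/
theorem isTransversal_sum {C : CourantAlgebroid I F E} {A B : Cₛ^∞⟮I; F, E⟯} {ι : Type*} [Fintype ι]
{e : ι → Cₛ^∞⟮I; F, E⟯}
    (he : ∀ i, IsTransversal C A B (e i)) {c : ι → C^∞⟮I, M; ℝ⟯}
    (hc : ∀ i x, C.lie A (c i) x = 0) : IsTransversal C A B (∑ i, fsmul (c i) (e i)) where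
  left x := by simp [(he _).left]
  right x := by simp [(he _).right]
  bracket := by
    rw [map_sum]
    ext x
    simp [C.bracket_fsmul, (he _).bracket, hc]

theorem IsTransversal.lie_pair {C : CourantAlgebroid I F E} {A B σ τ : Cₛ^∞⟮I; F, E⟯}
    (hσ : IsTransversal C A B σ) (hτ : IsTransversal C A B τ) (x : M) :
    C.lie A (C.pair σ τ) x = 0 := by
  rw [C.lie_pair, hσ.bracket, hτ.bracket]
  simp

namespace IsSplitPair

variable {C : CourantAlgebroid I F E} {A B : Cₛ^∞⟮I; F, E⟯} {t : C^∞⟮I, M; ℝ⟯}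

theorem pairing_right_left (h : IsSplitPair C A B t) (x : M) : C.pairing x (B x) (A x) = 1 := by
  rw [h.pairing_grad]; exact h.lie_left x

theorem pairing_left_right (h : IsSplitPair C A B t) (x : M) : C.pairing x (A x) (B x) = 1 := by
  rw [C.pairing_symm, h.pairing_right_left]

theorem left_ne_zero (h : IsSplitPair C A B t) (x : M) : A x ≠ 0 := fun h0 => by
  have := h.pairing_right_left x
  rw [h0, map_zero] at this
  exact zero_ne_one this

/-- Since `⟨A, tB⟩ = t`, the symmetrized bracket of `A` and `tB` is the gradient of `t`. Writing `B`
as a symmetrized bracket is what makes it central on the left and kills its anchor. -/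
theorem right_eq (h : IsSplitPair C A B t) : B = C.bracket A (fsmul t B) + C.bracket (fsmul t B) A := by
  refine ContMDiffSection.ext fun x => C.eq_of_pairing fun v => ?_
  rw [section_add_apply, map_add, LinearMap.add_apply, C.symmetrization', h.pairing_grad]
  congr 2
  ext y
  simp [h.pairing_left_right]

theorem bracket_right (h : IsSplitPair C A B t) (σ : Cₛ^∞⟮I; F, E⟯) : C.bracket B σ = 0 := by
  rw [h.right_eq]; exact C.bracket_symm_bracket _ _ _

theorem lie_right (h : IsSplitPair C A B t) (f : C^∞⟮I, M; ℝ⟯) (x : M) : C.lie B f x = 0 := by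
  rw [h.right_eq]; exact C.lie_symm_bracket (h.left_ne_zero x) _ _ _

theorem pairing_right_right (h : IsSplitPair C A B t) (x : M) : C.pairing x (B x) (B x) = 0 := by
  rw [h.pairing_grad]; exact h.lie_right t x

/-- If `d⟨σ, τ⟩ = f' dt`, then the gradient of `⟨σ, τ⟩` is `f' B`. All brackets below are computed
by exchanging arguments in this way. -/
theorem bracket_symm_of_pairing (h : IsSplitPair C A B t) {σ τ : Cₛ^∞⟮I; F, E⟯} {f' : C^∞⟮I, M; ℝ⟯}
    (hf : ∀ x v, mvfderiv I (C.pair σ τ) x v = f' x * mvfderiv I t x v) :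
    C.bracket σ τ = fsmul f' B - C.bracket τ σ := by
  refine ContMDiffSection.ext fun x => C.eq_of_pairing fun v => ?_
  have h1 := C.symmetrization' σ τ x v
  rw [hf, ← h.pairing_grad] at h1
  simp only [section_sub_apply, fsmul_apply, map_sub, map_smul, LinearMap.sub_apply,
    LinearMap.smul_apply, smul_eq_mul]
  linear_combination h1

theorem bracket_symm_of_const (h : IsSplitPair C A B t) {σ τ : Cₛ^∞⟮I; F, E⟯} {c : ℝ}
    (hc : ∀ x, C.pairing x (σ x) (τ x) = c) : C.bracket σ τ = -C.bracket τ σ := by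
  have h0 := h.bracket_symm_of_pairing (σ := σ) (τ := τ) (f' := 0) (fun x v => by
    have : (C.pair σ τ : M → ℝ) = fun _ => c := funext hc
    rw [this, mvfderiv, mfderiv_const]
    simp)
  rw [h0]
  ext x
  simp

theorem bracket_left_left (h : IsSplitPair C A B t) : C.bracket A A = 0 := by
  have h0 := h.bracket_symm_of_const (σ := A) (τ := A) h.isotropic
  ext x
  have h1 := congrArg (fun σ : Cₛ^∞⟮I; F, E⟯ => σ x) h0
  simp only [section_neg_apply] at h1
  have h2 : (2 : ℝ) • C.bracket A A x = 0 := by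
    rw [two_smul]; exact add_eq_zero_iff_eq_neg.2 h1
  exact (smul_eq_zero.1 h2).resolve_left two_ne_zero

theorem bracket_left_right (h : IsSplitPair C A B t) : C.bracket A B = 0 := by
  rw [h.bracket_symm_of_const h.pairing_left_right, h.bracket_right, neg_zero]

variable {σ τ : Cₛ^∞⟮I; F, E⟯}

theorem bracket_transversal_left (h : IsSplitPair C A B t) (hσ : IsTransversal C A B σ) :
    C.bracket σ A = 0 := by
  rw [h.bracket_symm_of_const (c := 0) (fun x => by rw [C.pairing_symm, hσ.left]), hσ.bracket,
    neg_zero]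

theorem bracket_transversal_right (h : IsSplitPair C A B t) (hσ : IsTransversal C A B σ) :
    C.bracket σ B = 0 := by
  rw [h.bracket_symm_of_const (c := 0) (fun x => by rw [C.pairing_symm, hσ.right]),
    h.bracket_right, neg_zero]

theorem lie_transversal (h : IsSplitPair C A B t) (hσ : IsTransversal C A B σ) {f f' : C^∞⟮I, M; ℝ⟯}
    (hf : ∀ x v, mvfderiv I f x v = f' x * mvfderiv I t x v) (x : M) : C.lie σ f x = 0 := by
  rw [C.lie_apply, hf, ← h.pairing_grad, hσ.right, mul_zero]

/-- Transversal sections are closed under the bracket. -/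
theorem isTransversal_bracket (h : IsSplitPair C A B t) (hσ : IsTransversal C A B σ)
    (hτ : IsTransversal C A B τ) :
    IsTransversal C A B (C.bracket σ τ) where
  left x := by
    have h1 := C.lie_pair σ A τ x
    rw [C.lie_eq_zero_of_eventually_const (c := 0) (Filter.Eventually.of_forall hτ.left),
      h.bracket_transversal_left hσ] at h1
    simpa using h1.symm
  right x := by
    have h1 := C.lie_pair σ B τ x
    rw [C.lie_eq_zero_of_eventually_const (c := 0) (Filter.Eventually.of_forall hτ.right),
      h.bracket_transversal_right hσ] at h1
    simpa using h1.symm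
  bracket := by
    have h1 := C.bracket_bracket A σ τ
    rw [hσ.bracket, hτ.bracket, map_zero, map_zero, LinearMap.zero_apply, sub_zero] at h1
    exact h1.symm

/-- The derivations given by `A` and `σ` commute because `[A, σ] = 0`. -/
theorem lie_left_lie (h : IsSplitPair C A B t) (hσ : IsTransversal C A B σ)
    {f : C^∞⟮I, M; ℝ⟯} (hf : ∀ x, C.lie A f x = 0)
    (x : M) : C.lie A (C.lie σ f) x = 0 := by
  have h1 := C.lie_bracket (h.left_ne_zero x) A σ f
  rw [C.lie_eq_zero_of_eventually_const (c := 0) (Filter.Eventually.of_forall hf), hσ.bracket,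
    sub_zero] at h1
  rw [← h1, C.lie_apply]
  simp

variable {f f' g g' a a' b b' : C^∞⟮I, M; ℝ⟯}

theorem bracket_transversal_span (h : IsSplitPair C A B t) (hσ : IsTransversal C A B σ)
    (hf : ∀ x v, mvfderiv I f x v = f' x * mvfderiv I t x v)
    (hg : ∀ x v, mvfderiv I g x v = g' x * mvfderiv I t x v) :
    C.bracket σ (fsmul f A + fsmul g B) = 0 := by
  rw [map_add, C.bracket_fsmul, C.bracket_fsmul, h.bracket_transversal_left hσ,
    h.bracket_transversal_right hσ]
  ext x
  simp [h.lie_transversal hσ hf, h.lie_transversal hσ hg]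

theorem bracket_span_transversal (h : IsSplitPair C A B t) (hσ : IsTransversal C A B σ)
    (hf : ∀ x v, mvfderiv I f x v = f' x * mvfderiv I t x v)
    (hg : ∀ x v, mvfderiv I g x v = g' x * mvfderiv I t x v) :
    C.bracket (fsmul f A + fsmul g B) σ = 0 := by
  rw [h.bracket_symm_of_const (c := 0) (fun x => by simp [hσ.left, hσ.right]),
    h.bracket_transversal_span hσ hf hg, neg_zero]

theorem lie_span (h : IsSplitPair C A B t) (hf : ∀ x v, mvfderiv I f x v = f' x * mvfderiv I t x v) (x : M) :
    C.lie (fsmul a A + fsmul b B) f x = a x * f' x := by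
  have h1 : C.lie A f x = f' x := by
    rw [C.lie_apply, hf, ← C.lie_apply, h.lie_left, mul_one]
  rw [C.lie_add_section, C.lie_fsmul, C.lie_fsmul, h.lie_right, h1, mul_zero, add_zero]

/-- The bracket on the sections spanned by `A` and `B` over functions of `t`. -/
theorem bracket_span_span (h : IsSplitPair C A B t) (ha : ∀ x v, mvfderiv I a x v = a' x * mvfderiv I t x v)
    (hb : ∀ x v, mvfderiv I b x v = b' x * mvfderiv I t x v)
    (hf : ∀ x v, mvfderiv I f x v = f' x * mvfderiv I t x v)
    (hg : ∀ x v, mvfderiv I g x v = g' x * mvfderiv I t x v) :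
    C.bracket (fsmul a A + fsmul b B) (fsmul f A + fsmul g B) =
      fsmul (a * f' - f * a') A + fsmul (a * g' + g * a') B := by
  have hlie : ∀ {f f' : C^∞⟮I, M; ℝ⟯}, (∀ x v, mvfderiv I f x v = f' x * mvfderiv I t x v) →
      C.lie A f = f' := fun {f f'} hf => by
    ext x
    rw [C.lie_apply, hf, ← C.lie_apply, h.lie_left, mul_one]
  -- The pairing with `A` is `b`, so the correction `b' B` cancels the term `b' B` of `[A, aA + bB]
  -- = a' A + b' B`.
  have hA : C.bracket (fsmul a A + fsmul b B) A = fsmul (-a') A := by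
    rw [h.bracket_symm_of_pairing (f' := b') (fun x v => by
      rw [← hb]; congr 2; ext y; simp [h.isotropic, h.pairing_right_left])]
    rw [map_add, C.bracket_fsmul, C.bracket_fsmul, h.bracket_left_left, h.bracket_left_right,
      hlie ha, hlie hb]
    ext x
    simp
  -- The pairing with `B` is `a`. Since `B` is central on the left, only the correction `a' B`
  -- remains.
  have hB : C.bracket (fsmul a A + fsmul b B) B = fsmul a' B := by
    rw [h.bracket_symm_of_pairing (f' := a') (fun x v => by
      rw [← ha]; congr 2; ext y; simp [h.pairing_right_right, h.pairing_left_right])]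
    rw [h.bracket_right, sub_zero]
  rw [map_add, C.bracket_fsmul, C.bracket_fsmul, hA, hB]
  ext x
  simp only [section_add_apply, fsmul_apply, h.lie_span hf, h.lie_span hg, ContMDiffMap.coe_sub,
    ContMDiffMap.coe_add, ContMDiffMap.coe_mul, ContMDiffMap.coe_neg, Pi.sub_apply, Pi.add_apply,
    Pi.mul_apply, Pi.neg_apply]
  module

/-- Pairing with `B` reads off the coefficient of `A`, and pairing with `A` that of `B`. As the
whole frame commutes with `A`, the bracket `[A, σ]` has as coefficients the derivatives along `A` of
those of `σ`. -/
theorem coeff_of_isTransversal (h : IsSplitPair C A B t) [FiniteDimensional ℝ F] {ι : Type*} [Fintype ι]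
    {s : Fin 2 ⊕ ι → Cₛ^∞⟮I; F, E⟯} (hs : ∀ x, IsFrameAt (fun i => s i) x)
    (hA : s (Sum.inl 0) = A) (hB : s (Sum.inl 1) = B)
    (he : ∀ i, IsTransversal C A B (s (Sum.inr i))) (hσ : IsTransversal C A B σ) :
    (∀ j x, frameCoeff hs σ (Sum.inl j) x = 0) ∧
      ∀ i x, C.lie A (frameCoeff hs σ (Sum.inr i)) x = 0 := by
  constructor
  · intro j x
    have h1 := hσ.left x
    have h2 := hσ.right x
    rw [← sum_frameCoeff_apply hs σ x, Fintype.sum_sum_type, Fin.sum_univ_two, hA, hB] at h1 h2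
    simp only [map_add, map_smul, map_sum, (he _).left, (he _).right, h.isotropic,
      h.pairing_left_right, h.pairing_right_left, h.pairing_right_right, mul_zero,
      Finset.sum_const_zero, add_zero, zero_add, smul_eq_mul, mul_one] at h1 h2
    fin_cases j
    · exact h2
    · exact h1
  · intro i x
    have h0 : ∀ j, C.bracket A (s j) = 0 := by
      rintro (j | j)
      · fin_cases j
        · exact (congrArg _ hA).trans h.bracket_left_left
        · exact (congrArg _ hB).trans h.bracket_left_right
      · exact (he j).bracket
    have h1 := congrArg (fun τ : Cₛ^∞⟮I; F, E⟯ => τ x) hσ.bracket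
    rw [← sum_frameCoeff hs σ] at h1
    simp only [map_sum, C.bracket_fsmul, h0, section_sum_apply, section_add_apply, fsmul_apply,
      section_zero_apply, smul_zero, zero_add] at h1
    have h2 := (hs x).ext (c := fun j => C.lie A (frameCoeff hs σ j) x) (c' := 0)
      (h1.trans (by simp))
    exact congrFun h2 (Sum.inr i)

end IsSplitPair
end SplitPair

/-! ### Courant algebroids on a product bundle whose frame consists of a split pair and transversal
sections. -/

section SplitProduct

variable {a b : ℝ}
  {EB : Type*} [NormedAddCommGroup EB] [NormedSpace ℝ EB] [FiniteDimensional ℝ EB]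
  {H : Type*} [TopologicalSpace H] {I : ModelWithCorners ℝ EB H} [I.Boundaryless]
  {N : Type*} [TopologicalSpace N] [T2Space N] [ChartedSpace H N] [IsManifold I ∞ N]
  {F : Type*} [NormedAddCommGroup F] [NormedSpace ℝ F] [FiniteDimensional ℝ F]
  {E : N → Type*} [TopologicalSpace (TotalSpace F E)] [∀ x, AddCommGroup (E x)]
  [∀ x, Module ℝ (E x)] [∀ x, TopologicalSpace (E x)] [FiberBundle F E]
  [VectorBundle ℝ F E] [ContMDiffVectorBundle ∞ F E I] {ι : Type*} [Fintype ι]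

/-- The coordinate function of an interval. -/
def intervalCoord (a b : ℝ) : C^∞⟮𝓘(ℝ, ℝ), interval a b; ℝ⟯ := ⟨Subtype.val, contMDiff_subtype_val⟩

theorem intervalDeriv_intervalCoord (s : interval a b) : intervalDeriv (intervalCoord a b) s = 1 :=
  mfderiv_opens_val_apply (I := 𝓘(ℝ, ℝ)) (interval a b) s (intervalVectorField a b s)

variable (I N) in
/-- The first coordinate on a product of an interval with a manifold. -/
def prodTime (a b : ℝ) : C^∞⟮𝓘(ℝ, ℝ).prod I, interval a b × N; ℝ⟯ :=
  (intervalCoord a b).comp ContMDiffMap.fst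

theorem mvfderiv_prodTime (x : interval a b × N) (v : TangentSpace (𝓘(ℝ, ℝ).prod I) x) :
    mvfderiv (𝓘(ℝ, ℝ).prod I) (prodTime I N a b) x v = (v : ℝ × EB).1 := by
  refine (mvfderiv_comp_fst _ x v).trans ?_
  rw [intervalDeriv_intervalCoord, mul_one]

theorem mvfderiv_comp_fst_eq (f : C^∞⟮𝓘(ℝ, ℝ), interval a b; ℝ⟯) (x : interval a b × N)
    (v : TangentSpace (𝓘(ℝ, ℝ).prod I) x) :
    mvfderiv (𝓘(ℝ, ℝ).prod I) (f.comp (ContMDiffMap.fst :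
      C^∞⟮𝓘(ℝ, ℝ).prod I, interval a b × N; 𝓘(ℝ, ℝ), interval a b⟯)) x v =
      (intervalDeriv f).comp (ContMDiffMap.fst :
        C^∞⟮𝓘(ℝ, ℝ).prod I, interval a b × N; 𝓘(ℝ, ℝ), interval a b⟯) x *
      mvfderiv (𝓘(ℝ, ℝ).prod I) (prodTime I N a b) x v := by
  rw [mvfderiv_prodTime, mul_comm]
  exact mvfderiv_comp_fst f x v

/-- Courant algebroids on a product bundle for which `∂_t` and `dt` are a split pair, and constant
sections in a frame of the second factor are transversal. -/
structure IsSplitProduct (C : CourantAlgebroid (𝓘(ℝ, ℝ).prod I) ((ℝ × (ℝ →L[ℝ] ℝ)) × F)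
    (BoxProd 𝓘(ℝ, ℝ) I (GenTangent 𝓘(ℝ, ℝ) (interval a b)) E)) (ε : ι → Cₛ^∞⟮I; F, E⟯) : Prop where
  frame : ∀ q, IsFrameAt (fun i => ε i) q
  pair : IsSplitPair C (prodDdt I F E a b) (prodDt I F E a b) (prodTime I N a b)
  anchor_ddt_snd : ∀ x, (C.anchor x (prodDdt I F E a b x) : ℝ × EB).2 = 0
  transversal : ∀ i, IsTransversal C (prodDdt I F E a b) (prodDt I F E a b) (inclSnd (ε i))

namespace IsSplitProduct

variable {C : CourantAlgebroid (𝓘(ℝ, ℝ).prod I) ((ℝ × (ℝ →L[ℝ] ℝ)) × F)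
    (BoxProd 𝓘(ℝ, ℝ) I (GenTangent 𝓘(ℝ, ℝ) (interval a b)) E)} {ε : ι → Cₛ^∞⟮I; F, E⟯}

theorem anchor_ddt (h : IsSplitProduct C ε) (x : interval a b × N) :
    C.anchor x (prodDdt I F E a b x) = ((1 : ℝ), (0 : EB)) := by
  refine Prod.ext ?_ (h.anchor_ddt_snd x)
  have := h.pair.lie_left x
  rwa [C.lie_apply, mvfderiv_prodTime] at this

theorem lie_ddt_comp_snd (h : IsSplitProduct C ε) (f : C^∞⟮I, N; ℝ⟯) (x : interval a b × N) :
    C.lie (prodDdt I F E a b) (f.comp ContMDiffMap.snd) x = 0 := by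
  rw [C.lie_apply]
  refine (mvfderiv_comp_snd f x _).trans ?_
  rw [h.anchor_ddt_snd]
  exact map_zero (mvfderiv I f x.2)

theorem eq_of_lie_ddt_eq_zero (h : IsSplitProduct C ε)
    {g : C^∞⟮𝓘(ℝ, ℝ).prod I, interval a b × N; ℝ⟯}
    (hg : ∀ x, C.lie (prodDdt I F E a b) g x = 0) (s s' : interval a b) (q : N) :
    g (s, q) = g (s', q) := by
  refine eq_of_mvfderiv_fst_eq_zero (fun x => ?_) s s' q
  rw [← h.anchor_ddt x]
  exact hg x

theorem isTransversal_inclSnd (h : IsSplitProduct C ε) (τ : Cₛ^∞⟮I; F, E⟯) :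
    IsTransversal C (prodDdt I F E a b) (prodDt I F E a b) (inclSnd τ) := by
  rw [inclSnd_eq h.frame]
  exact isTransversal_sum h.transversal fun i => h.lie_ddt_comp_snd _

/-- Transversal sections come from the second factor. -/
theorem exists_inclSnd_eq (h : IsSplitProduct C ε) (s₀ : interval a b)
    {σ : Cₛ^∞⟮𝓘(ℝ, ℝ).prod I; (ℝ × (ℝ →L[ℝ] ℝ)) × F,
      BoxProd 𝓘(ℝ, ℝ) I (GenTangent 𝓘(ℝ, ℝ) (interval a b)) E⟯}
    (hσ : IsTransversal C (prodDdt I F E a b) (prodDt I F E a b) σ) :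
    ∃ τ : Cₛ^∞⟮I; F, E⟯, σ = inclSnd τ := by
  have hs := isFrameAt_prodFrame (a := a) (b := b) h.frame
  obtain ⟨h1, h2⟩ := h.pair.coeff_of_isTransversal hs rfl rfl h.transversal hσ
  let j : C^∞⟮I, N; 𝓘(ℝ, ℝ).prod I, interval a b × N⟯ :=
    ⟨fun q => (s₀, q), contMDiff_const.prodMk contMDiff_id⟩
  -- The coefficients do not depend on `t`, so their values on the slice at `s₀` determine them.
  refine ⟨∑ i, fsmul ((frameCoeff hs σ (Sum.inr i)).comp j) (ε i), ?_⟩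
  rw [inclSnd_sum]
  refine ContMDiffSection.ext fun x => ?_
  rw [section_sum_apply, ← sum_frameCoeff_apply hs σ x, Fintype.sum_sum_type]
  simp only [h1, zero_smul, Finset.sum_const_zero, zero_add, inclSnd_fsmul, fsmul_apply]
  refine Finset.sum_congr rfl fun i _ => ?_
  congr 1
  exact h.eq_of_lie_ddt_eq_zero (h2 i) x.1 s₀ x.2

/-- As `dt` is the gradient of the coordinate `t`, pairing with it reads off the `t`-component of
the anchor. -/
theorem anchor_fst_eq (h : IsSplitProduct C ε) (x : interval a b × N) (u) :
    (C.anchor x u : ℝ × EB).1 = C.pairing x (prodDt I F E a b x) u := by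
  rw [h.pair.pairing_grad, mvfderiv_prodTime]

end IsSplitProduct
end SplitProduct

/-! ### Pairing and anchor on the two summands of the product bundle. -/

section SplitProductFactors

variable {a b : ℝ}

theorem exists_genTangent_eq {s : interval a b} (v : GenTangent 𝓘(ℝ, ℝ) (interval a b) s) :
    ∃ r c : ℝ, v = r • ddt a b s + c • dt a b s := by
  obtain ⟨f, hf⟩ := (isFrameAt_interval s).2 v
  refine ⟨f 0, f 1, hf.symm.trans ?_⟩
  rw [Fintype.linearCombination_apply, Fin.sum_univ_two]
  rfl

/-- The pairing of the standard Courant algebroid of an interval. -/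
def genPairing (s : interval a b) (v w : GenTangent 𝓘(ℝ, ℝ) (interval a b) s) : ℝ :=
  w.2 v.1 + v.2 w.1

theorem genPairing_eq (s : interval a b) (r c r' c' : ℝ) :
    genPairing s (r • ddt a b s + c • dt a b s) (r' • ddt a b s + c' • dt a b s) =
      c' * r + c * r' := by
  rw [genTangent_interval_eq, genTangent_interval_eq]
  rfl

theorem genPairing_dt (s : interval a b) (v : GenTangent 𝓘(ℝ, ℝ) (interval a b) s) :
    genPairing s (dt a b s) v = v.1 := by
  have e : genPairing s (dt a b s) v = v.2 0 + (show ℝ from v.1) := rfl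
  rw [e, map_zero]
  exact zero_add _

theorem bilinForm_combination {V : Type*} [AddCommGroup V] [Module ℝ V] (β : LinearMap.BilinForm ℝ V)
    (v w : V) (r c r' c' : ℝ) : β (r • v + c • w) (r' • v + c' • w) =
      r * r' * β v v + r * c' * β v w + c * r' * β w v + c * c' * β w w := by
  simp only [map_add, map_smul, LinearMap.add_apply, LinearMap.smul_apply, smul_eq_mul]
  ring

variable
  {EB : Type*} [NormedAddCommGroup EB] [NormedSpace ℝ EB] [FiniteDimensional ℝ EB]
  {H : Type*} [TopologicalSpace H] {I : ModelWithCorners ℝ EB H} [I.Boundaryless]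
  {N : Type*} [TopologicalSpace N] [T2Space N] [ChartedSpace H N] [IsManifold I ∞ N]
  {F : Type*} [NormedAddCommGroup F] [NormedSpace ℝ F] [FiniteDimensional ℝ F]
  {E : N → Type*} [TopologicalSpace (TotalSpace F E)] [∀ x, AddCommGroup (E x)]
  [∀ x, Module ℝ (E x)] [∀ x, TopologicalSpace (E x)] [FiberBundle F E]
  [VectorBundle ℝ F E] [ContMDiffVectorBundle ∞ F E I] {ι : Type*} [Fintype ι]

variable (I E) in
/-- The inclusion of the second summand of a fibre of the product bundle. -/
def sndVec (x : interval a b × N) : E x.2 →ₗ[ℝ]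
    BoxProd 𝓘(ℝ, ℝ) I (GenTangent 𝓘(ℝ, ℝ) (interval a b)) E x :=
  LinearMap.inr ℝ (GenTangent 𝓘(ℝ, ℝ) (interval a b) x.1) (E x.2)

variable (I E) in
/-- The inclusion of the first summand of a fibre of the product bundle. -/
def fstVec (x : interval a b × N) : GenTangent 𝓘(ℝ, ℝ) (interval a b) x.1 →ₗ[ℝ]
    BoxProd 𝓘(ℝ, ℝ) I (GenTangent 𝓘(ℝ, ℝ) (interval a b)) E x :=
  LinearMap.inl ℝ (GenTangent 𝓘(ℝ, ℝ) (interval a b) x.1) (E x.2)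

theorem boxProd_mk_eq (x : interval a b × N) (v : GenTangent 𝓘(ℝ, ℝ) (interval a b) x.1)
    (w : E x.2) : ((v, w) : BoxProd 𝓘(ℝ, ℝ) I (GenTangent 𝓘(ℝ, ℝ) (interval a b)) E x) =
      fstVec I E x v + sndVec I E x w := by
  refine Prod.ext ?_ ?_
  · exact (add_zero v).symm
  · exact (zero_add w).symm

theorem inclSnd_apply (τ : Cₛ^∞⟮I; F, E⟯) (x : interval a b × N) :
    (inclSnd τ : Cₛ^∞⟮𝓘(ℝ, ℝ).prod I; (ℝ × (ℝ →L[ℝ] ℝ)) × F,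
      BoxProd 𝓘(ℝ, ℝ) I (GenTangent 𝓘(ℝ, ℝ) (interval a b)) E⟯) x = sndVec I E x (τ x.2) := rfl

theorem inclFst_apply (σ : IntervalSection a b) (x : interval a b × N) :
    (inclFst σ : Cₛ^∞⟮𝓘(ℝ, ℝ).prod I; (ℝ × (ℝ →L[ℝ] ℝ)) × F,
      BoxProd 𝓘(ℝ, ℝ) I (GenTangent 𝓘(ℝ, ℝ) (interval a b)) E⟯) x = fstVec I E x (σ x.1) := rfl

namespace IsSplitProduct

variable {C : CourantAlgebroid (𝓘(ℝ, ℝ).prod I) ((ℝ × (ℝ →L[ℝ] ℝ)) × F)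
    (BoxProd 𝓘(ℝ, ℝ) I (GenTangent 𝓘(ℝ, ℝ) (interval a b)) E)} {ε : ι → Cₛ^∞⟮I; F, E⟯}

theorem pairing_fstVec_sndVec (h : IsSplitProduct C ε) (x : interval a b × N)
    (v : GenTangent 𝓘(ℝ, ℝ) (interval a b) x.1) (w : E x.2) :
    C.pairing x (fstVec I E x v) (sndVec I E x w) = 0 := by
  obtain ⟨τ, rfl⟩ := exists_section_apply_eq (F := F) (I := I) w
  obtain ⟨r, c, rfl⟩ := exists_genTangent_eq v
  have hτ := h.isTransversal_inclSnd τ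
  have h1 := hτ.left x
  have h2 := hτ.right x
  rw [inclFst_apply, inclSnd_apply] at h1 h2
  rw [map_add, map_smul, map_smul, map_add, map_smul, map_smul, LinearMap.add_apply,
    LinearMap.smul_apply, LinearMap.smul_apply, h1, h2, smul_zero, smul_zero, add_zero]

theorem pairing_fstVec (h : IsSplitProduct C ε) (x : interval a b × N)
    (v v' : GenTangent 𝓘(ℝ, ℝ) (interval a b) x.1) :
    C.pairing x (fstVec I E x v) (fstVec I E x v') = genPairing x.1 v v' := by
  obtain ⟨r, c, rfl⟩ := exists_genTangent_eq v
  obtain ⟨r', c', rfl⟩ := exists_genTangent_eq v'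
  have h0 := bilinForm_combination ((C.pairing x).compl₁₂ (fstVec I E x) (fstVec I E x))
    (ddt a b x.1) (dt a b x.1) r c r' c'
  have h1 := h.pair.isotropic x
  have h2 := h.pair.pairing_left_right x
  have h3 := h.pair.pairing_right_left x
  have h4 := h.pair.pairing_right_right x
  simp only [LinearMap.compl₁₂_apply] at h0
  rw [genPairing_eq]
  refine h0.trans ?_
  rw [inclFst_apply] at h1 h4
  rw [inclFst_apply, inclFst_apply] at h2 h3
  rw [h1, h2, h3, h4]
  ring

/-- The anchor of `∂_t` has no component along `N` by assumption, and `dt`, being a gradient, has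
zero anchor. -/
theorem anchor_fstVec_snd (h : IsSplitProduct C ε) (x : interval a b × N)
    (v : GenTangent 𝓘(ℝ, ℝ) (interval a b) x.1) :
    (C.anchor x (fstVec I E x v) : ℝ × EB).2 = 0 := by
  obtain ⟨r, c, rfl⟩ := exists_genTangent_eq v
  have h1 := h.anchor_ddt_snd x
  have h2 : C.anchor x (prodDt I F E a b x) = 0 := tangent_ext fun f => by
    rw [map_zero]; exact h.pair.lie_right f x
  rw [inclFst_apply] at h1 h2
  rw [map_add, map_add, map_smul, map_smul, map_smul, map_smul, h2, smul_zero, add_zero]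
  refine (congrArg (fun z : EB => r • z) h1).trans (smul_zero r)

/-- Tested on functions pulled back from `N`: their derivatives along a transversal section are
again constant in `t`. -/
theorem anchor_sndVec_snd (h : IsSplitProduct C ε) (s s' : interval a b) (q : N) (w : E q) :
    (C.anchor (s, q) (sndVec I E (s, q) w) : ℝ × EB).2 =
      (C.anchor (s', q) (sndVec I E (s', q) w) : ℝ × EB).2 := by
  obtain ⟨τ, rfl⟩ := exists_section_apply_eq (F := F) (I := I) w
  refine tangent_ext (I := I) (x := q) fun f => ?_
  have h1 := h.eq_of_lie_ddt_eq_zero (h.pair.lie_left_lie (h.isTransversal_inclSnd τ)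
    (h.lie_ddt_comp_snd f)) s s' q
  rw [C.lie_apply, C.lie_apply] at h1
  exact (mvfderiv_comp_snd f (s, q) _).symm.trans (h1.trans (mvfderiv_comp_snd f (s', q) _))

theorem anchor_fstVec_fst (h : IsSplitProduct C ε) (x : interval a b × N)
    (v : GenTangent 𝓘(ℝ, ℝ) (interval a b) x.1) (w : E x.2) :
    (C.anchor x (fstVec I E x v + sndVec I E x w) : ℝ × EB).1 = v.1 := by
  rw [h.anchor_fst_eq, inclFst_apply, map_add, h.pairing_fstVec, h.pairing_fstVec_sndVec, add_zero]
  exact genPairing_dt x.1 v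

end IsSplitProduct
end SplitProductFactors

/-! ### The Courant-Dorfman bracket in dimension one. -/

section StandardInterval

variable {a b : ℝ}

/-- The Courant-Dorfman bracket on an interval, in coordinates. -/
def stdBracket (σ τ : IntervalSection a b) : IntervalSection a b :=
  fsmul (vectorCoeff σ * intervalDeriv (vectorCoeff τ) -
      vectorCoeff τ * intervalDeriv (vectorCoeff σ)) (ddt a b) +
    fsmul (vectorCoeff σ * intervalDeriv (formCoeff τ) +
      formCoeff τ * intervalDeriv (vectorCoeff σ)) (dt a b)

theorem genPairing_nondegenerate {s : interval a b} {v : GenTangent 𝓘(ℝ, ℝ) (interval a b) s}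
    (h : ∀ w, genPairing s v w = 0) : v = 0 := by
  obtain ⟨r, c, rfl⟩ := exists_genTangent_eq v
  have h1 := h ((1 : ℝ) • ddt a b s + (0 : ℝ) • dt a b s)
  have h2 := h ((0 : ℝ) • ddt a b s + (1 : ℝ) • dt a b s)
  rw [genPairing_eq] at h1 h2
  have hc : c = 0 := by simpa using h1
  have hr : r = 0 := by simpa using h2
  rw [hc, hr, zero_smul, zero_smul, add_zero]

theorem stdBracket_fst (σ τ : IntervalSection a b) (s : interval a b) : (stdBracket σ τ s).1 =
    VectorField.mlieBracket 𝓘(ℝ, ℝ) (fun y => (σ y).1) (fun y => (τ y).1) s := by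
  have h1 := mlieBracket_interval (vectorCoeff σ) (vectorCoeff τ) s
  have e1 : (fun y => (σ y).1) = fun y => vectorCoeff σ y • intervalVectorField a b y :=
    funext (fst_section_interval σ)
  have e2 : (fun y => (τ y).1) = fun y => vectorCoeff τ y • intervalVectorField a b y :=
    funext (fst_section_interval τ)
  rw [e1, e2, h1]
  have e3 := genTangent_interval_eq s
    ((vectorCoeff σ * intervalDeriv (vectorCoeff τ) -
      vectorCoeff τ * intervalDeriv (vectorCoeff σ)) s)
    ((vectorCoeff σ * intervalDeriv (formCoeff τ) +
      formCoeff τ * intervalDeriv (vectorCoeff σ)) s)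
  have e4 : ∀ r : ℝ, r = r • intervalVectorField a b s := fun r => (mul_one r).symm
  exact (congrArg Prod.fst e3).trans (e4 _)

theorem exists_vectorField_eq
    (Z : Cₛ^∞⟮𝓘(ℝ, ℝ); ℝ, (TangentSpace 𝓘(ℝ, ℝ) : interval a b → Type _)⟯) :
    ∃ z : C^∞⟮𝓘(ℝ, ℝ), interval a b; ℝ⟯, ∀ s, Z s = z s • intervalVectorField a b s :=
  ⟨vectorCoeff (pairSection Z 0), fst_section_interval (pairSection Z 0)⟩

theorem intervalDeriv_mul (f g : C^∞⟮𝓘(ℝ, ℝ), interval a b; ℝ⟯) (s : interval a b) :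
    intervalDeriv (f * g) s = f s * intervalDeriv g s + g s * intervalDeriv f s := by
  change mvfderiv 𝓘(ℝ, ℝ) (f * g : C^∞⟮𝓘(ℝ, ℝ), interval a b; ℝ⟯) s (intervalVectorField a b s) = _
  rw [ContMDiffMap.coe_mul, mvfderiv_mul (CourantAlgebroid.mdifferentiableAt_fun f s)
    (CourantAlgebroid.mdifferentiableAt_fun g s)]
  rfl

theorem mvfderiv_interval_smul (f : C^∞⟮𝓘(ℝ, ℝ), interval a b; ℝ⟯) (s : interval a b) (r : ℝ) :
    mvfderiv 𝓘(ℝ, ℝ) f s (r • intervalVectorField a b s) = r * intervalDeriv f s := by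
  rw [map_smul]; rfl

theorem intervalForm_apply (s : interval a b) (g r : ℝ) :
    ((g • intervalForm a b s) (r • intervalVectorField a b s) : ℝ) = g * r :=
  congrArg (fun u => g * u) (mul_one r)

theorem mvfderiv_intervalForm (g z : C^∞⟮𝓘(ℝ, ℝ), interval a b; ℝ⟯) (s : interval a b) (r : ℝ) :
    mvfderiv 𝓘(ℝ, ℝ) (fun y => ((g y • intervalForm a b y) (z y • intervalVectorField a b y) : ℝ)) s
      (r • intervalVectorField a b s) =
      r * (g s * intervalDeriv z s + z s * intervalDeriv g s) := by
  rw [← intervalDeriv_mul, ← mvfderiv_interval_smul]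
  congr 2
  funext y
  exact intervalForm_apply y (g y) (z y)

/-- In coordinates, `L_{f ∂_t} (g dt) = (f g' + g f') dt`, which is the form part of `stdBracket`.
-/
theorem lieDerivForm_interval (f g z : C^∞⟮𝓘(ℝ, ℝ), interval a b; ℝ⟯) (s : interval a b) :
    lieDerivForm 𝓘(ℝ, ℝ) (fun y => f y • intervalVectorField a b y)
      (fun y => g y • intervalForm a b y) (fun y => z y • intervalVectorField a b y) s =
      (f s * intervalDeriv g s + g s * intervalDeriv f s) * z s := by
  have h1 := mvfderiv_intervalForm g z s (f s)
  have h2 := intervalForm_apply s (g s) (f s * intervalDeriv z s - z s * intervalDeriv f s)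
  rw [← mlieBracket_interval] at h2
  refine (congrArg₂ (fun u v : ℝ => u - v) h1 h2).trans ?_
  ring

/-- There are no nonzero 2-forms on a line, so the term `i_Y dα` of the Courant-Dorfman bracket
disappears. -/
theorem extDerivForm_interval (f g z : C^∞⟮𝓘(ℝ, ℝ), interval a b; ℝ⟯) (s : interval a b) :
    extDerivForm 𝓘(ℝ, ℝ) (fun y => f y • intervalForm a b y)
      (fun y => g y • intervalVectorField a b y) (fun y => z y • intervalVectorField a b y) s = 0 := by
  have h1 := mvfderiv_intervalForm f z s (g s)
  have h2 := mvfderiv_intervalForm f g s (z s)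
  have h3 := intervalForm_apply s (f s) (g s * intervalDeriv z s - z s * intervalDeriv g s)
  rw [← mlieBracket_interval] at h3
  refine (congrArg₂ (fun u v : ℝ => u - v) (congrArg₂ (fun u v : ℝ => u - v) h1 h2) h3).trans ?_
  ring

theorem stdBracket_snd (σ τ : IntervalSection a b)
    (Z : Cₛ^∞⟮𝓘(ℝ, ℝ); ℝ, (TangentSpace 𝓘(ℝ, ℝ) : interval a b → Type _)⟯) (s : interval a b) :
    (stdBracket σ τ s).2 (Z s) =
      lieDerivForm 𝓘(ℝ, ℝ) (fun y => (σ y).1) (fun y => (τ y).2) Z s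
        - extDerivForm 𝓘(ℝ, ℝ) (fun y => (σ y).2) (fun y => (τ y).1) Z s := by
  obtain ⟨z, hz⟩ := exists_vectorField_eq Z
  rw [funext (fst_section_interval σ), funext (fst_section_interval τ),
    funext (snd_section_interval σ), funext (snd_section_interval τ),
    show (Z : ∀ s : interval a b, TangentSpace 𝓘(ℝ, ℝ) s) = _ from funext hz,
    lieDerivForm_interval, extDerivForm_interval, sub_zero]
  have e3 := congrArg Prod.snd (genTangent_interval_eq s
    ((vectorCoeff σ * intervalDeriv (vectorCoeff τ) -
      vectorCoeff τ * intervalDeriv (vectorCoeff σ)) s)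
    ((vectorCoeff σ * intervalDeriv (formCoeff τ) +
      formCoeff τ * intervalDeriv (vectorCoeff σ)) s))
  have e4 : (stdBracket σ τ s).2 = (vectorCoeff σ * intervalDeriv (formCoeff τ) +
      formCoeff τ * intervalDeriv (vectorCoeff σ)) s • intervalForm a b s := e3
  rw [e4]
  exact intervalForm_apply s _ _

end StandardInterval

/-! ### The two factors of a split product. -/

section Factors

variable {a b : ℝ}
  {EB : Type*} [NormedAddCommGroup EB] [NormedSpace ℝ EB] [FiniteDimensional ℝ EB]
  {H : Type*} [TopologicalSpace H] {I : ModelWithCorners ℝ EB H} [I.Boundaryless]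
  {N : Type*} [TopologicalSpace N] [T2Space N] [ChartedSpace H N] [IsManifold I ∞ N]
  {F : Type*} [NormedAddCommGroup F] [NormedSpace ℝ F] [FiniteDimensional ℝ F]
  {E : N → Type*} [TopologicalSpace (TotalSpace F E)] [∀ x, AddCommGroup (E x)]
  [∀ x, Module ℝ (E x)] [∀ x, TopologicalSpace (E x)] [FiberBundle F E]
  [VectorBundle ℝ F E] [ContMDiffVectorBundle ∞ F E I] {ι : Type*} [Fintype ι]
  {C : CourantAlgebroid (𝓘(ℝ, ℝ).prod I) ((ℝ × (ℝ →L[ℝ] ℝ)) × F)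
    (BoxProd 𝓘(ℝ, ℝ) I (GenTangent 𝓘(ℝ, ℝ) (interval a b)) E)} {ε : ι → Cₛ^∞⟮I; F, E⟯}

namespace IsSplitProduct

theorem pairing_sndVec (h : IsSplitProduct C ε) (s s' : interval a b) (q : N) (w w' : E q) :
    C.pairing (s, q) (sndVec I E (s, q) w) (sndVec I E (s, q) w') =
      C.pairing (s', q) (sndVec I E (s', q) w) (sndVec I E (s', q) w') := by
  obtain ⟨τ, rfl⟩ := exists_section_apply_eq (F := F) (I := I) w
  obtain ⟨τ', rfl⟩ := exists_section_apply_eq (F := F) (I := I) w'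
  exact h.eq_of_lie_ddt_eq_zero
    ((h.isTransversal_inclSnd τ).lie_pair (h.isTransversal_inclSnd τ')) s s' q

/-- The coefficients are functions of `t` alone, so their differentials are multiples of `dt` and
the formula for the span of a split pair applies. -/
theorem bracket_inclFst (h : IsSplitProduct C ε) (σ τ : IntervalSection a b) :
    C.bracket (inclFst σ) (inclFst τ) = inclFst (stdBracket σ τ) := by
  refine (congrArg₂ (fun u v => C.bracket u v) (inclFst_eq σ) (inclFst_eq τ)).trans ?_
  refine (h.pair.bracket_span_span
    (a' := (intervalDeriv (vectorCoeff σ)).comp ContMDiffMap.fst)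
    (b' := (intervalDeriv (formCoeff σ)).comp ContMDiffMap.fst)
    (f' := (intervalDeriv (vectorCoeff τ)).comp ContMDiffMap.fst)
    (g' := (intervalDeriv (formCoeff τ)).comp ContMDiffMap.fst)
    (mvfderiv_comp_fst_eq _) (mvfderiv_comp_fst_eq _) (mvfderiv_comp_fst_eq _)
    (mvfderiv_comp_fst_eq _)).trans ?_
  rw [stdBracket, inclFst_add, inclFst_fsmul, inclFst_fsmul]
  refine ContMDiffSection.ext fun x => ?_
  rfl

theorem bracket_inclFst_inclSnd (h : IsSplitProduct C ε) (σ : IntervalSection a b)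
    (τ : Cₛ^∞⟮I; F, E⟯) : C.bracket (inclFst σ) (inclSnd τ) = 0 := by
  rw [inclFst_eq σ, h.pair.bracket_span_transversal (h.isTransversal_inclSnd τ)
    (mvfderiv_comp_fst_eq _) (mvfderiv_comp_fst_eq _)]

theorem bracket_inclSnd_inclFst (h : IsSplitProduct C ε) (τ : Cₛ^∞⟮I; F, E⟯)
    (σ : IntervalSection a b) : C.bracket (inclSnd τ) (inclFst σ) = 0 := by
  rw [inclFst_eq σ, h.pair.bracket_transversal_span (h.isTransversal_inclSnd τ)
    (mvfderiv_comp_fst_eq _) (mvfderiv_comp_fst_eq _)]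

theorem contMDiff_sndVec (h : IsSplitProduct C ε) (s₀ : interval a b) :
    ContMDiff (I.prod 𝓘(ℝ, F)) ((𝓘(ℝ, ℝ).prod I).prod 𝓘(ℝ, (ℝ × (ℝ →L[ℝ] ℝ)) × F)) ∞
      (fun v : TotalSpace F E => (⟨(s₀, v.1), sndVec I E (s₀, v.1) v.2⟩ :
        TotalSpace ((ℝ × (ℝ →L[ℝ] ℝ)) × F)
          (BoxProd 𝓘(ℝ, ℝ) I (GenTangent 𝓘(ℝ, ℝ) (interval a b)) E))) := by
  have hf : ContMDiff I (𝓘(ℝ, ℝ).prod I) ∞ (fun q : N => (s₀, q)) :=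
    contMDiff_const.prodMk contMDiff_id
  refine (contMDiff_frameTransport h.frame (fun i => inclSnd (ε i)) hf).congr fun v => ?_
  congr 1
  conv_lhs => rw [← (h.frame v.1).equiv.apply_symm_apply v.2, IsFrameAt.equiv_apply, map_sum]
  simp only [map_smul]
  rfl

theorem contMDiff_fstVec (q₀ : N) :
    ContMDiff (𝓘(ℝ, ℝ).prod 𝓘(ℝ, ℝ × (ℝ →L[ℝ] ℝ)))
      ((𝓘(ℝ, ℝ).prod I).prod 𝓘(ℝ, (ℝ × (ℝ →L[ℝ] ℝ)) × F)) ∞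
      (fun v : TotalSpace (ℝ × (ℝ →L[ℝ] ℝ)) (GenTangent 𝓘(ℝ, ℝ) (interval a b)) =>
        (⟨(v.1, q₀), fstVec I E (v.1, q₀) v.2⟩ : TotalSpace ((ℝ × (ℝ →L[ℝ] ℝ)) × F)
          (BoxProd 𝓘(ℝ, ℝ) I (GenTangent 𝓘(ℝ, ℝ) (interval a b)) E))) := by
  have hf : ContMDiff 𝓘(ℝ, ℝ) (𝓘(ℝ, ℝ).prod I) ∞ (fun s : interval a b => (s, q₀)) :=
    contMDiff_id.prodMk contMDiff_const
  refine (contMDiff_frameTransport isFrameAt_interval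
    (fun i => inclFst (intervalFrame a b i)) hf).congr fun v => ?_
  congr 1
  conv_lhs => rw [← (isFrameAt_interval v.1).equiv.apply_symm_apply v.2, IsFrameAt.equiv_apply,
    map_sum]
  simp only [map_smul]
  rfl

/-- The sections of the second factor form a Courant algebroid. -/
def sndDescent (h : IsSplitProduct C ε) (s₀ : interval a b) : Descent (I' := I) (N := N) C F E where
  emb := ⟨fun q => (s₀, q), contMDiff_const.prodMk contMDiff_id⟩
  retr := ContMDiffMap.snd
  retr_emb _ := rfl
  incl :=
    { toFun := inclSnd
      map_add' := inclSnd_add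
      map_smul' := fun c τ => ContMDiffSection.ext fun x => (sndVec I E x).map_smul c (τ x.2) }
  fib q := sndVec I E (s₀, q)
  contMDiff_fib := h.contMDiff_sndVec s₀
  incl_emb _ _ := rfl
  incl_fsmul f σ := inclSnd_fsmul f σ
  pairing_basic σ τ x := h.eq_of_lie_ddt_eq_zero
    ((h.isTransversal_inclSnd σ).lie_pair (h.isTransversal_inclSnd τ)) x.1 s₀ x.2
  -- The two summands are orthogonal, so a vector of the second that pairs to zero with the second
  -- pairs to zero with everything.
  nondegenerate q v hv := by
    have h0 : sndVec I E (s₀, q) v = 0 := C.pairing_nondegenerate _ _ fun u => by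
      obtain ⟨u, w⟩ := u
      refine (congrArg _ (boxProd_mk_eq (I := I) (s₀, q) u w)).trans ?_
      rw [map_add, C.pairing_symm]
      exact (congrArg₂ (fun r r' : ℝ => r + r') (h.pairing_fstVec_sndVec (s₀, q) u v) (hv w)).trans
        (add_zero _)
    exact congrArg Prod.snd h0
  closed σ τ := h.exists_inclSnd_eq s₀
    (h.pair.isTransversal_bracket (h.isTransversal_inclSnd σ) (h.isTransversal_inclSnd τ))

/-- The sections of the first factor form a Courant algebroid. -/
def fstDescent (h : IsSplitProduct C ε) (q₀ : N) : Descent (I' := 𝓘(ℝ, ℝ)) (N := interval a b) C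
    (ℝ × (ℝ →L[ℝ] ℝ)) (GenTangent 𝓘(ℝ, ℝ) (interval a b)) where
  emb := ⟨fun s => (s, q₀), contMDiff_id.prodMk contMDiff_const⟩
  retr := ContMDiffMap.fst
  retr_emb _ := rfl
  incl :=
    { toFun := inclFst
      map_add' := inclFst_add
      map_smul' := fun c τ => ContMDiffSection.ext fun x => (fstVec I E x).map_smul c (τ x.1) }
  fib s := fstVec I E (s, q₀)
  contMDiff_fib := contMDiff_fstVec q₀
  incl_emb _ _ := rfl
  incl_fsmul f σ := inclFst_fsmul f σ
  pairing_basic σ τ x := (h.pairing_fstVec x (σ x.1) (τ x.1)).trans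
    (h.pairing_fstVec (x.1, q₀) (σ x.1) (τ x.1)).symm
  nondegenerate s v hv := genPairing_nondegenerate fun w =>
    (h.pairing_fstVec (s, q₀) v w).symm.trans (hv w)
  closed σ τ := ⟨_, h.bracket_inclFst σ τ⟩

/-- Injectivity of the inclusion identifies the descended bracket with `stdBracket`. The anchor is
the `t`-component, read off by pairing with `dt`. -/
theorem isStandard (h : IsSplitProduct C ε) (q₀ : N) :
    (h.fstDescent q₀).courantAlgebroid.IsStandard := by
  have hb : ∀ σ τ, (h.fstDescent q₀).courantAlgebroid.bracket σ τ = stdBracket σ τ := fun σ τ =>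
    (h.fstDescent q₀).incl_injective
      (((h.fstDescent q₀).incl_bracket σ τ).trans (h.bracket_inclFst σ τ))
  refine ⟨fun s v => ?_, fun s v w => h.pairing_fstVec (s, q₀) v w, fun σ τ s => ?_,
    fun σ τ Z s => ?_⟩
  · have e : mfderiv (𝓘(ℝ, ℝ).prod I) 𝓘(ℝ, ℝ) (Prod.fst : interval a b × N → interval a b) (s, q₀)
        (C.anchor (s, q₀) (fstVec I E (s, q₀) v)) =
        (C.anchor (s, q₀) (fstVec I E (s, q₀) v) : ℝ × EB).1 := by
      rw [mfderiv_fst]; rfl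
    have e2 := h.anchor_fstVec_fst (s, q₀) v 0
    rw [map_zero, add_zero] at e2
    exact e.trans e2
  · rw [hb]; exact stdBracket_fst σ τ s
  · rw [hb]; exact stdBracket_snd σ τ Z s

/-- The base points `s₀` and `q₀` used to descend do not matter: on each summand, the relevant
anchor component and the pairing are constant in the other variable. -/
theorem isDirectProduct (h : IsSplitProduct C ε) (s₀ : interval a b) (q₀ : N) :
    C.IsDirectProduct (h.fstDescent q₀).courantAlgebroid (h.sndDescent s₀).courantAlgebroid where
  anchor_fst x v w := by
    rw [(h.isStandard q₀).anchor, boxProd_mk_eq, mfderiv_fst]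
    exact h.anchor_fstVec_fst x v w
  anchor_snd x v w := by
    rw [boxProd_mk_eq, mfderiv_snd]
    have e : mfderiv (𝓘(ℝ, ℝ).prod I) I (Prod.snd : interval a b × N → N) (s₀, x.2)
        (C.anchor (s₀, x.2) (sndVec I E (s₀, x.2) w)) =
        (C.anchor (s₀, x.2) (sndVec I E (s₀, x.2) w) : ℝ × EB).2 := by
      rw [mfderiv_snd]; rfl
    refine Eq.trans ?_ ((h.anchor_sndVec_snd x.1 s₀ x.2 w).trans e.symm)
    rw [map_add]
    refine (congrArg₂ (fun u v : EB => u + v) (h.anchor_fstVec_snd x v) rfl).trans ?_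
    exact zero_add _
  pairing x v v' w w' := by
    rw [(h.isStandard q₀).pairing, boxProd_mk_eq, boxProd_mk_eq, map_add, map_add,
      LinearMap.add_apply, LinearMap.add_apply, h.pairing_fstVec_sndVec,
      C.pairing_symm x (sndVec I E x w), h.pairing_fstVec_sndVec, h.pairing_fstVec, add_zero,
      zero_add]
    exact congrArg (fun r : ℝ => genPairing x.1 v v' + r) (h.pairing_sndVec x.1 s₀ x.2 w w')
  bracket_fst σ τ := ((h.fstDescent q₀).incl_bracket σ τ).symm
  bracket_snd σ τ := ((h.sndDescent s₀).incl_bracket σ τ).symm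
  bracket_fst_snd := h.bracket_inclFst_inclSnd
  bracket_snd_fst := h.bracket_inclSnd_inclFst

end IsSplitProduct
end Factors

/-! ### From an adapted global frame to a product decomposition. -/

section Splitting

variable {a b : ℝ}
  {EB : Type*} [NormedAddCommGroup EB] [NormedSpace ℝ EB] [FiniteDimensional ℝ EB]
  {H : Type*} [TopologicalSpace H] {I : ModelWithCorners ℝ EB H} [I.Boundaryless]
  {N : Type*} [TopologicalSpace N] [T2Space N] [ChartedSpace H N] [IsManifold I ∞ N]

variable (I N) in
/-- The constant frame of a trivial bundle. -/
def trivialFrame (k : ℕ) (i : Fin k) :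
    Cₛ^∞⟮I; EuclideanSpace ℝ (Fin k), Bundle.Trivial N (EuclideanSpace ℝ (Fin k))⟯ :=
  ⟨fun _ => EuclideanSpace.single i (1 : ℝ), fun x =>
    (contMDiffAt_section (E := Bundle.Trivial N (EuclideanSpace ℝ (Fin k))) x).2 contMDiffAt_const⟩

theorem isFrameAt_trivialFrame (k : ℕ) (q : N) : IsFrameAt (fun i => trivialFrame I N k i) q := by
  have key : ∀ c : Fin k → ℝ, Fintype.linearCombination ℝ (fun i => trivialFrame I N k i q) c =
      (WithLp.toLp 2 c : EuclideanSpace ℝ (Fin k)) := by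
    intro c
    rw [Fintype.linearCombination_apply]
    change ∑ i, c i • EuclideanSpace.single i (1 : ℝ) = _
    ext j
    simp [Finset.sum_apply, Pi.single_apply]
  have e : Fintype.linearCombination ℝ (fun i => trivialFrame I N k i q) =
      ((WithLp.linearEquiv 2 ℝ (Fin k → ℝ)).symm : (Fin k → ℝ) →ₗ[ℝ] _) :=
    LinearMap.ext key
  unfold IsFrameAt
  rw [e]
  exact (WithLp.linearEquiv 2 ℝ (Fin k → ℝ)).symm.bijective

variable {EB₁ : Type*} [NormedAddCommGroup EB₁] [NormedSpace ℝ EB₁]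
  {H₁ : Type*} [TopologicalSpace H₁] {I₁ : ModelWithCorners ℝ EB₁ H₁}
  {M₁ : Type*} [TopologicalSpace M₁] [ChartedSpace H₁ M₁] [IsManifold I₁ ∞ M₁]
  {F₁ : Type*} [NormedAddCommGroup F₁] [NormedSpace ℝ F₁] [FiniteDimensional ℝ F₁]
  {E₁ : M₁ → Type*} [TopologicalSpace (TotalSpace F₁ E₁)] [∀ x, AddCommGroup (E₁ x)]
  [∀ x, Module ℝ (E₁ x)] [∀ x, TopologicalSpace (E₁ x)] [FiberBundle F₁ E₁]
  [VectorBundle ℝ F₁ E₁] [ContMDiffVectorBundle ∞ F₁ E₁ I₁]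

section Transport

variable {F : Type*} [NormedAddCommGroup F] [NormedSpace ℝ F] [FiniteDimensional ℝ F]
  {E : N → Type*} [TopologicalSpace (TotalSpace F E)] [∀ x, AddCommGroup (E x)]
  [∀ x, Module ℝ (E x)] [∀ x, TopologicalSpace (E x)] [FiberBundle F E]
  [VectorBundle ℝ F E] [ContMDiffVectorBundle ∞ F E I] {ι : Type*} [Fintype ι]
  (C : CourantAlgebroid I₁ F₁ E₁) (Φ : M₁ ≃ₘ^∞⟮I₁, 𝓘(ℝ, ℝ).prod I⟯ (interval a b × N))
  {s : Fin 2 ⊕ ι → Cₛ^∞⟮I₁; F₁, E₁⟯} (hs : ∀ x, IsFrameAt (fun i => s i) x)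
  {ε : ι → Cₛ^∞⟮I; F, E⟯} (hε : ∀ q, IsFrameAt (fun i => ε i) q)

/-- The conditions involve only the frame sections, their pairings, brackets and anchors, and
transport carries one frame to the other. -/
theorem isSplitProduct_transport
    (hpair : IsSplitPair C (s (Sum.inl 0)) (s (Sum.inl 1))
      ((prodTime I N a b).comp ⟨Φ, Φ.contMDiff⟩))
    (hsnd : ∀ x, (mfderiv I₁ (𝓘(ℝ, ℝ).prod I) Φ x (C.anchor x (s (Sum.inl 0) x)) : ℝ × EB).2 = 0)
    (htr : ∀ i, IsTransversal C (s (Sum.inl 0)) (s (Sum.inl 1)) (s (Sum.inr i))) :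
    IsSplitProduct (C.transport hs (isFrameAt_prodFrame (a := a) (b := b) hε) Φ) ε where
  frame := hε
  pair :=
    { pairing_grad := fun y v => by
        refine Eq.trans ?_ (mvfderiv_transportAnchor hs (isFrameAt_prodFrame hε) Φ C
          (prodTime I N a b) y v).symm
        rw [← hpair.pairing_grad]
        have e := frameEquiv_apply_frame (isFrameAt_prodFrame (a := a) (b := b) hε) hs y (Φ.symm y)
          (Sum.inl 1)
        exact congrArg (fun u => C.pairing (Φ.symm y) u _) e
      lie_left := fun y => by
        refine (mvfderiv_transportAnchor hs (isFrameAt_prodFrame hε) Φ C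
          (prodTime I N a b) y _).trans ?_
        have e := frameEquiv_apply_frame (isFrameAt_prodFrame (a := a) (b := b) hε) hs y (Φ.symm y)
          (Sum.inl 0)
        refine Eq.trans ?_ (hpair.lie_left (Φ.symm y))
        exact congrArg (fun u => mvfderiv I₁ _ (Φ.symm y) (C.anchor (Φ.symm y) u)) e
      isotropic := fun y =>
        (C.transport_pairing_frame hs (isFrameAt_prodFrame hε) Φ (Sum.inl 0) (Sum.inl 0) y).trans
          (hpair.isotropic _) }
  anchor_ddt_snd y := by
    have e := frameEquiv_apply_frame (isFrameAt_prodFrame (a := a) (b := b) hε) hs y (Φ.symm y)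
      (Sum.inl 0)
    refine Eq.trans ?_ (hsnd (Φ.symm y))
    exact congrArg (fun u => (mfderiv I₁ (𝓘(ℝ, ℝ).prod I) Φ (Φ.symm y)
      (C.anchor (Φ.symm y) u) : ℝ × EB).2) e
  transversal i :=
    { left := fun y =>
        (C.transport_pairing_frame hs (isFrameAt_prodFrame hε) Φ (Sum.inl 0) (Sum.inr i) y).trans
          ((htr i).left _)
      right := fun y =>
        (C.transport_pairing_frame hs (isFrameAt_prodFrame hε) Φ (Sum.inl 1) (Sum.inr i) y).trans
          ((htr i).right _)
      bracket :=
        (C.transport_bracket_frame hs (isFrameAt_prodFrame hε) Φ (Sum.inl 0) (Sum.inr i)).trans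
          ((congrArg _ (htr i).bracket).trans (map_zero _)) }

end Transport

/-- A Courant algebroid with a suitable global frame is a product. -/
theorem exists_splitting {k : ℕ} (C : CourantAlgebroid I₁ F₁ E₁)
    (Φ : M₁ ≃ₘ^∞⟮I₁, 𝓘(ℝ, ℝ).prod I⟯ (interval a b × N)) (s₀ : interval a b) (q₀ : N)
    {s : Fin 2 ⊕ Fin k → Cₛ^∞⟮I₁; F₁, E₁⟯} (hs : ∀ x, IsFrameAt (fun i => s i) x)
    (hpair : IsSplitPair C (s (Sum.inl 0)) (s (Sum.inl 1))
      ((prodTime I N a b).comp ⟨Φ, Φ.contMDiff⟩))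
    (hsnd : ∀ x, (mfderiv I₁ (𝓘(ℝ, ℝ).prod I) Φ x (C.anchor x (s (Sum.inl 0) x)) : ℝ × EB).2 = 0)
    (htr : ∀ i, IsTransversal C (s (Sum.inl 0)) (s (Sum.inl 1)) (s (Sum.inr i))) :
    ∃ (CI : CourantAlgebroid 𝓘(ℝ, ℝ) (ℝ × (ℝ →L[ℝ] ℝ)) (GenTangent 𝓘(ℝ, ℝ) (interval a b)))
      (C' : CourantAlgebroid I (EuclideanSpace ℝ (Fin k))
        (Bundle.Trivial N (EuclideanSpace ℝ (Fin k))))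
      (CP : CourantAlgebroid (𝓘(ℝ, ℝ).prod I) ((ℝ × (ℝ →L[ℝ] ℝ)) × EuclideanSpace ℝ (Fin k))
        (BoxProd 𝓘(ℝ, ℝ) I (GenTangent 𝓘(ℝ, ℝ) (interval a b))
          (Bundle.Trivial N (EuclideanSpace ℝ (Fin k)))))
      (φ : CourantIso C CP), CI.IsStandard ∧ CP.IsDirectProduct CI C' ∧ ∀ x, φ.base x = Φ x := by
  have hε := isFrameAt_trivialFrame (I := I) (N := N) k
  have h := isSplitProduct_transport C Φ hs hε hpair hsnd htr
  exact ⟨_, _, _, C.transportIso hs (isFrameAt_prodFrame hε) Φ, h.isStandard q₀,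
    h.isDirectProduct s₀ q₀, fun _ => rfl⟩

end Splitting

/-! ### Local gradients and isotropic sections. -/

section LocalGradient

variable {EB : Type*} [NormedAddCommGroup EB] [NormedSpace ℝ EB] [FiniteDimensional ℝ EB]
  {H : Type*} [TopologicalSpace H] {I : ModelWithCorners ℝ EB H}
  {M : Type*} [TopologicalSpace M] [T2Space M] [ChartedSpace H M] [IsManifold I ∞ M]
  {F : Type*} [NormedAddCommGroup F] [NormedSpace ℝ F]
  {E : M → Type*} [TopologicalSpace (TotalSpace F E)] [∀ x, AddCommGroup (E x)]
  [∀ x, Module ℝ (E x)] [∀ x, TopologicalSpace (E x)] [FiberBundle F E] [VectorBundle ℝ F E]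
  [ContMDiffVectorBundle ∞ F E I] {p : M}

theorem exists_function_inv {g : C^∞⟮I, M; ℝ⟯} (hg : g p ≠ 0) :
    ∃ h : C^∞⟮I, M; ℝ⟯, ∀ᶠ x in nhds p, h x * g x = 1 := by
  have hne : ∀ᶠ x in nhds p, g x ≠ 0 := g.contMDiff.continuous.continuousAt.eventually_ne hg
  have hs : ∀ᶠ x in nhds p, ContMDiffAt I 𝓘(ℝ, ℝ) ∞ (fun y => (g y)⁻¹) x :=
    hne.mono fun x hx => (g.contMDiff x).inv₀ hx
  obtain ⟨h, hh⟩ := exists_function_eventuallyEq hs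
  refine ⟨h, ?_⟩
  filter_upwards [hh, hne] with x hx hx'
  rw [hx, inv_mul_cancel₀ hx']

variable (C : CourantAlgebroid I F E)

/-- Nondegeneracy gives a section with nonzero pairing at `p`; it is divided by that pairing. -/
theorem exists_dual_section {α : Cₛ^∞⟮I; F, E⟯} (hα : α p ≠ 0) :
    ∃ γ : Cₛ^∞⟮I; F, E⟯, ∀ᶠ x in nhds p, C.pairing x (α x) (γ x) = 1 := by
  obtain ⟨w, hw⟩ : ∃ w, C.pairing p (α p) w ≠ 0 := by
    by_contra! hcon
    exact hα (C.pairing_nondegenerate p _ hcon)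
  obtain ⟨γ, rfl⟩ := exists_section_apply_eq (F := F) (I := I) w
  obtain ⟨h, hh⟩ := exists_function_inv (g := C.pair α γ) hw
  refine ⟨fsmul h γ, ?_⟩
  filter_upwards [hh] with x hx
  rw [fsmul_apply, map_smul, smul_eq_mul]
  exact hx

/-- Near a point at which a section does not vanish, smooth functions have gradients. -/
theorem exists_gradient {α : Cₛ^∞⟮I; F, E⟯} (hα : α p ≠ 0) (f : C^∞⟮I, M; ℝ⟯) :
    ∃ δ : Cₛ^∞⟮I; F, E⟯, (∀ᶠ x in nhds p, ∀ v, C.pairing x (δ x) v = mvfderiv I f x (C.anchor x v)) ∧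
      (∀ σ, C.bracket δ σ = 0) ∧ ∀ᶠ x in nhds p, ∀ g, C.lie δ g x = 0 := by
  obtain ⟨γ, hγ⟩ := exists_dual_section C hα
  -- Near `p` one has `⟨α, fγ⟩ = f`, so this symmetrized bracket is the gradient of `f`. Centrality
  -- and vanishing anchor hold for every symmetrized bracket.
  refine ⟨C.bracket α (fsmul f γ) + C.bracket (fsmul f γ) α, ?_, C.bracket_symm_bracket α _, ?_⟩
  · filter_upwards [hγ.eventually_nhds] with x hx v
    rw [section_add_apply, map_add, LinearMap.add_apply, C.symmetrization']
    refine mvfderiv_congr (hx.mono fun y hy => ?_) _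
    simp [hy]
  · filter_upwards [hγ] with x hx g
    refine C.lie_symm_bracket (γ := α) (fun h0 => ?_) _ _ _
    rw [h0, map_zero] at hx
    exact zero_ne_one hx

/-- Near a point at which the anchor does not vanish, there is an isotropic section with nonvanishing
anchor. -/
theorem exists_isotropic_section [I.Boundaryless] (hp : C.anchor p ≠ 0) :
    ∃ A : Cₛ^∞⟮I; F, E⟯, (∀ᶠ x in nhds p, C.pairing x (A x) (A x) = 0) ∧ C.anchor p (A p) ≠ 0 := by
  obtain ⟨v, hv⟩ : ∃ v, C.anchor p v ≠ 0 := by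
    by_contra! hcon
    exact hp (LinearMap.ext hcon)
  obtain ⟨e, rfl⟩ := exists_section_apply_eq (F := F) (I := I) v
  have he : e p ≠ 0 := fun h0 => hv (by rw [h0, map_zero])
  obtain ⟨f, hf⟩ : ∃ f : C^∞⟮I, M; ℝ⟯, C.lie e f p ≠ 0 := by
    by_contra! hcon
    exact hv (tangent_ext fun f => (hcon f).trans (map_zero _).symm)
  obtain ⟨δ, hδ, -, hδ0⟩ := exists_gradient C he f
  obtain ⟨h, hh⟩ := exists_function_inv hf
  -- Since `δ` is isotropic and `⟨e, δ⟩ = ρ(e) f`, adding `c δ` changes `⟨e, e⟩` by `2 c ρ(e) f`.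
  -- The choice `c = -⟨e, e⟩ / (2 ρ(e) f)` makes the sum isotropic, and `δ` does not contribute to
  -- the derivative of `f` at `p`.
  refine ⟨e + fsmul (h * C.pair e e) (((-1 / 2 : ℝ)) • δ), ?_, fun h0 => ?_⟩
  · filter_upwards [hδ, hδ0, hh] with x hx hx0 hxh
    have h1 : C.pairing x (δ x) (e x) = C.lie e f x := hx _
    have h2 : C.pairing x (δ x) (δ x) = 0 := (hx _).trans (hx0 f)
    have h3 : C.pairing x (e x) (δ x) = C.lie e f x := by rw [C.pairing_symm, h1]
    have e1 : (((-1 / 2 : ℝ)) • δ) x = (-1 / 2 : ℝ) • δ x := rfl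
    simp only [section_add_apply, fsmul_apply, e1, map_add, map_smul, LinearMap.add_apply,
      LinearMap.smul_apply, smul_eq_mul, h1, h2, h3, ContMDiffMap.coe_mul, Pi.mul_apply,
      CourantAlgebroid.pair_apply]
    linear_combination (-C.pairing x (e x) (e x)) * hxh
  · have h1 := hδ0.self_of_nhds f
    have h2 : mvfderiv I f p (C.anchor p ((e + fsmul (h * C.pair e e) (((-1 / 2 : ℝ)) • δ)) p)) =
        C.lie e f p := by
      have e1 : (((-1 / 2 : ℝ)) • δ) p = (-1 / 2 : ℝ) • δ p := rfl
      rw [C.lie_apply] at h1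
      rw [section_add_apply, fsmul_apply, e1, map_add, map_add, map_smul, map_smul, map_smul,
        map_smul, h1, smul_zero, smul_zero, add_zero]
      rfl
    rw [h0, map_zero] at h2
    exact hf h2.symm

end LocalGradient

/-! ### Straightening vector fields on manifolds. -/

section FlowBoxManifold

variable {V W : Type*} [NormedAddCommGroup V] [NormedSpace ℝ V] [FiniteDimensional ℝ V]
  [NormedAddCommGroup W] [NormedSpace ℝ W] [FiniteDimensional ℝ W]
  {M : Type*} [TopologicalSpace M] [T2Space M] [ChartedSpace V M] [IsManifold 𝓘(ℝ, V) ∞ M]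

/-- Nonvanishing smooth vector fields on manifolds can be straightened. -/
theorem exists_flowBox_manifold (hVW : Module.finrank ℝ (ℝ × W) = Module.finrank ℝ V) {p : M}
    {X : ∀ x : M, TangentSpace 𝓘(ℝ, V) x}
    (hX : ContMDiff 𝓘(ℝ, V) 𝓘(ℝ, V).tangent ∞ (fun x => (⟨x, X x⟩ : TangentBundle 𝓘(ℝ, V) M)))
    (hp : X p ≠ 0) :
    ∃ Ψ : OpenPartialHomeomorph M (ℝ × W), p ∈ Ψ.source ∧ Ψ p = 0 ∧
      ContMDiffOn 𝓘(ℝ, V) 𝓘(ℝ, ℝ × W) ∞ Ψ Ψ.source ∧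
      ContMDiffOn 𝓘(ℝ, ℝ × W) 𝓘(ℝ, V) ∞ Ψ.symm Ψ.target ∧
      ∀ᶠ x in nhds p, mvfderiv 𝓘(ℝ, V) Ψ x (X x) = ((1 : ℝ), (0 : W)) := by
  have I1 : IsManifold 𝓘(ℝ, V) 1 M := IsManifold.of_le (n := ∞) (by simp)
  let e := chartAt V p
  have hpe : p ∈ e.source := mem_chart_source V p
  have he : ContMDiffOn 𝓘(ℝ, V) 𝓘(ℝ, V) ∞ e e.source := contMDiffOn_chart
  have hes : ContMDiffOn 𝓘(ℝ, V) 𝓘(ℝ, V) ∞ e.symm e.target := contMDiffOn_chart_symm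
  obtain ⟨g, hg⟩ := exists_function_eventuallyEq (I := 𝓘(ℝ, V)) (f := e) (x := p) (by
    filter_upwards [e.open_source.mem_nhds hpe] with x hx
    exact he.contMDiffAt (e.open_source.mem_nhds hx))
  -- The coordinate expression of the field near `p`, made global by using a smooth map `g` with the
  -- same germ as the chart.
  let Y : M → V := fun x => mvfderiv 𝓘(ℝ, V) g x (X x)
  have hY : ContMDiff 𝓘(ℝ, V) 𝓘(ℝ, V) ∞ Y := contMDiff_mvfderiv_apply g.contMDiff hX
  have hYe : ∀ᶠ x in nhds p, Y x = mvfderiv 𝓘(ℝ, V) e x (X x) :=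
    hg.eventually_nhds.mono fun x hx => mvfderiv_congr hx _
  obtain ⟨f, hf⟩ := exists_function_eventuallyEq (I := 𝓘(ℝ, V)) (f := Y ∘ e.symm) (x := e p) (by
    filter_upwards [e.open_target.mem_nhds (e.map_source hpe)] with y hy
    exact (hY _).comp y (hes.contMDiffAt (e.open_target.mem_nhds hy)))
  have hfe : ∀ᶠ x in nhds p, f (e x) = mvfderiv 𝓘(ℝ, V) e x (X x) := by
    filter_upwards [hYe, (e.continuousAt hpe).eventually hf, e.open_source.mem_nhds hpe]
      with x hx hx' hxs
    rw [hx', Function.comp_apply, e.left_inv hxs, hx]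
  have hf0 : f (e p) ≠ 0 := by
    rw [hfe.self_of_nhds]
    intro h0
    refine hp ((isInvertible_mfderiv_extChartAt (I := 𝓘(ℝ, V))
      (mem_extChartAt_source p)).injective ?_)
    rw [map_zero]
    exact h0
  obtain ⟨Ψ, hΨp, hΨ0, hΨ, hΨs, hΨf⟩ := exists_flowBox hVW f.contMDiff.contDiff hf0
  have hps : p ∈ (e.trans Ψ).source := by
    rw [OpenPartialHomeomorph.trans_source]; exact ⟨hpe, hΨp⟩
  refine ⟨e.trans Ψ, hps, hΨ0, ?_, ?_, ?_⟩
  · rw [OpenPartialHomeomorph.trans_source]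
    exact hΨ.contMDiffOn.comp (he.mono Set.inter_subset_left) fun x hx => hx.2
  · rw [OpenPartialHomeomorph.trans_target]
    exact hes.comp (hΨs.contMDiffOn.mono Set.inter_subset_left) fun x hx => hx.2
  · filter_upwards [hfe, (e.trans Ψ).open_source.mem_nhds hps] with x hx hxs
    rw [OpenPartialHomeomorph.trans_source] at hxs
    have h1 : DifferentiableAt ℝ Ψ (e x) :=
      (hΨ.contDiffAt (Ψ.open_source.mem_nhds hxs.2)).differentiableAt (by simp)
    have h2 : MDifferentiableAt 𝓘(ℝ, V) 𝓘(ℝ, V) e x :=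
      (he.contMDiffAt (e.open_source.mem_nhds hxs.1)).mdifferentiableAt (by simp)
    have h3 := mfderiv_comp_apply x h1.mdifferentiableAt h2 (X x)
    rw [mfderiv_eq_fderiv] at h3
    refine h3.trans ?_
    rw [← hΨf (e x) hxs.2, hx]
    rfl

end FlowBoxManifold

/-- A hyperbolic pair extends to a basis by vectors orthogonal to it. -/
theorem exists_orthogonal_basis {V : Type*} [AddCommGroup V] [Module ℝ V] [FiniteDimensional ℝ V]
    (g : LinearMap.BilinForm ℝ V) (hg : ∀ v w, g v w = g w v) {a b : V} (haa : g a a = 0)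
    (hbb : g b b = 0) (hab : g a b = 1) :
    ∃ (k : ℕ) (u : Fin k → V), (∀ i, g a (u i) = 0) ∧ (∀ i, g b (u i) = 0) ∧
      Function.Bijective (Fintype.linearCombination ℝ (Sum.elim ![a, b] u)) := by
  let K : Submodule ℝ V := (g a).ker ⊓ (g b).ker
  let β := Module.finBasis ℝ K
  have hba : g b a = 1 := (hg _ _).trans hab
  have hua : ∀ i, g a (β i : V) = 0 := fun i => (β i).2.1
  have hub : ∀ i, g b (β i : V) = 0 := fun i => (β i).2.2
  refine ⟨Module.finrank ℝ K, fun i => β i, hua, hub, ?_, fun v => ?_⟩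
  · rw [injective_iff_map_eq_zero]
    intro c hc
    simp only [Fintype.linearCombination_apply, Fintype.sum_sum_type, Fin.sum_univ_two,
      Sum.elim_inl, Sum.elim_inr, Matrix.cons_val_zero, Matrix.cons_val_one] at hc
    have h1 := congrArg (g a) hc
    have h2 := congrArg (g b) hc
    simp only [map_add, map_smul, map_sum, smul_eq_mul, haa, hab, hba, hbb, hua, hub, mul_zero,
      Finset.sum_const_zero, add_zero, zero_add, mul_one, map_zero] at h1 h2
    have h3 : ∑ i, c (Sum.inr i) • β i = 0 := by
      apply Subtype.ext
      rw [h1, h2, zero_smul, zero_smul, zero_add, zero_add] at hc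
      simpa using hc
    have h4 := Fintype.linearIndependent_iff.1 β.linearIndependent _ h3
    ext (i | i)
    · fin_cases i
      · exact h2
      · exact h1
    · exact h4 i
  · have hv : v - g b v • a - g a v • b ∈ K := by
      constructor
      · simp [haa, hab]
      · simp [hba, hbb]
    refine ⟨Sum.elim ![g b v, g a v] (β.repr ⟨_, hv⟩), ?_⟩
    have h := congrArg (Subtype.val : K → V) (β.sum_repr ⟨_, hv⟩)
    simp only [Submodule.coe_sum, Submodule.coe_smul] at h
    simp only [Fintype.linearCombination_apply, Fintype.sum_sum_type, Fin.sum_univ_two,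
      Sum.elim_inl, Sum.elim_inr, Matrix.cons_val_zero, Matrix.cons_val_one, h]
    abel

/-! ### Local frames orthogonal to a hyperbolic pair. -/

section LocalFrame

variable {EB : Type*} [NormedAddCommGroup EB] [NormedSpace ℝ EB] [FiniteDimensional ℝ EB]
  {H : Type*} [TopologicalSpace H] {I : ModelWithCorners ℝ EB H}
  {M : Type*} [TopologicalSpace M] [T2Space M] [ChartedSpace H M] [IsManifold I ∞ M]
  {F : Type*} [NormedAddCommGroup F] [NormedSpace ℝ F] [FiniteDimensional ℝ F]
  {E : M → Type*} [TopologicalSpace (TotalSpace F E)] [∀ x, AddCommGroup (E x)]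
  [∀ x, Module ℝ (E x)] [∀ x, TopologicalSpace (E x)] [FiberBundle F E] [VectorBundle ℝ F E]
  [ContMDiffVectorBundle ∞ F E I] {p : M} (C : CourantAlgebroid I F E)

/-- `A` and `B` form a hyperbolic pair near `p`, and `B` is central on the left. -/
structure IsHyperbolicNear (A B : Cₛ^∞⟮I; F, E⟯) (p : M) : Prop where
  left : ∀ᶠ x in nhds p, C.pairing x (A x) (A x) = 0
  right : ∀ᶠ x in nhds p, C.pairing x (B x) (B x) = 0
  mixed : ∀ᶠ x in nhds p, C.pairing x (A x) (B x) = 1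
  bracket : ∀ σ, C.bracket B σ = 0

variable {C} {A B : Cₛ^∞⟮I; F, E⟯}

theorem IsHyperbolicNear.exists_frame (h : IsHyperbolicNear C A B p) :
    ∃ (k : ℕ) (f : Fin k → Cₛ^∞⟮I; F, E⟯),
      (∀ i, ∀ᶠ x in nhds p, C.pairing x (A x) (f i x) = 0) ∧
      (∀ i, ∀ᶠ x in nhds p, C.pairing x (B x) (f i x) = 0) ∧
      IsFrameAt (fun i => (Sum.elim ![A, B] f i : Cₛ^∞⟮I; F, E⟯)) p := by
  have : FiniteDimensional ℝ (E p) := ((trivializationAt F E p).linearEquivAt ℝ p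
    (FiberBundle.mem_baseSet_trivializationAt' p)).symm.finiteDimensional
  obtain ⟨k, u, hau, hbu, hu⟩ := exists_orthogonal_basis (C.pairing p) (C.pairing_symm p)
    h.left.self_of_nhds h.right.self_of_nhds h.mixed.self_of_nhds
  choose f hf using fun i => exists_section_apply_eq (F := F) (I := I) (u i)
  -- Arbitrary extensions of the basis vectors are projected to the complement of `A` and `B`. At
  -- `p` the projection changes nothing, so the frame property there is kept.
  refine ⟨k, fun i => f i - fsmul (C.pair B (f i)) A - fsmul (C.pair A (f i)) B, fun i => ?_,
    fun i => ?_, ?_⟩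
  · filter_upwards [h.left, h.mixed] with x h1 h2
    simp [h1, h2]
  · filter_upwards [h.right, h.mixed] with x h1 h2
    rw [C.pairing_symm] at h2
    simp [h1, h2]
  · refine (congrArg (fun t => Function.Bijective (Fintype.linearCombination ℝ t)) ?_).mpr hu
    ext i
    rcases i with i | i
    · fin_cases i <;> rfl
    · simp [hf, hau, hbu]

/-- `2 [A, A]` is the gradient of `⟨A, A⟩`, which vanishes near `p`. -/
theorem IsHyperbolicNear.bracket_left (h : IsHyperbolicNear C A B p) :
    ∀ᶠ x in nhds p, C.bracket A A x = 0 := by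
  filter_upwards [h.left.eventually_nhds] with x hx
  refine C.pairing_nondegenerate x _ fun e => ?_
  obtain ⟨e', rfl⟩ := exists_section_apply_eq (F := F) (I := I) e
  have h1 := C.symmetrization' A A x (e' x)
  have h2 : C.lie e' (C.pair A A) x = 0 := C.lie_eq_zero_of_eventually_const hx e'
  rw [C.lie_apply] at h2
  rw [h2] at h1
  linarith

theorem IsHyperbolicNear.bracket_mixed (h : IsHyperbolicNear C A B p) :
    ∀ᶠ x in nhds p, C.bracket A B x = 0 := by
  filter_upwards [h.mixed.eventually_nhds] with x hx
  refine C.pairing_nondegenerate x _ fun e => ?_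
  obtain ⟨e', rfl⟩ := exists_section_apply_eq (F := F) (I := I) e
  have h1 := C.symmetrization' A B x (e' x)
  have h2 : C.lie e' (C.pair A B) x = 0 := C.lie_eq_zero_of_eventually_const hx e'
  rw [C.lie_apply] at h2
  rw [h2, h.bracket] at h1
  simpa using h1

/-- Differentiating `⟨A, f j⟩ = 0` and `⟨B, f j⟩ = 0` along `A`, with `[A, A] = [A, B] = 0`, shows
that `[A, f j]` is again orthogonal to `A` and `B`; hence it has no components along them. -/
theorem IsHyperbolicNear.exists_bracket_coeff (h : IsHyperbolicNear C A B p) {k : ℕ}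
    {f : Fin k → Cₛ^∞⟮I; F, E⟯} (hA : ∀ i, ∀ᶠ x in nhds p, C.pairing x (A x) (f i x) = 0)
    (hB : ∀ i, ∀ᶠ x in nhds p, C.pairing x (B x) (f i x) = 0)
    (hf : IsFrameAt (fun i => (Sum.elim ![A, B] f i : Cₛ^∞⟮I; F, E⟯)) p) :
    ∃ G : Fin k → Fin k → C^∞⟮I, M; ℝ⟯,
      ∀ᶠ x in nhds p, ∀ j, C.bracket A (f j) x = ∑ i, G j i x • f i x := by
  choose c hc using fun j => hf.exists_coeff (C.bracket A (f j))
  refine ⟨fun j i => c j (Sum.inr i), ?_⟩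
  filter_upwards [Filter.eventually_all.2 hc, h.left, h.right, h.mixed, h.bracket_left,
    h.bracket_mixed, Filter.eventually_all.2 fun i => (hA i).eventually_nhds,
    Filter.eventually_all.2 fun i => (hB i).eventually_nhds]
    with x hcx h1 h2 h3 h4 h5 h6 h7 j
  have h3' : C.pairing x (B x) (A x) = 1 := (C.pairing_symm _ _ _).trans h3
  have e1 := C.lie_pair A A (f j) x
  have e2 := C.lie_pair A B (f j) x
  rw [C.lie_eq_zero_of_eventually_const (h6 j), h4] at e1
  rw [C.lie_eq_zero_of_eventually_const (h7 j), h5] at e2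
  have e3 := hcx j
  simp only [Fintype.sum_sum_type, Fin.sum_univ_two, Sum.elim_inl, Sum.elim_inr,
    Matrix.cons_val_zero, Matrix.cons_val_one] at e3
  rw [e3] at e1 e2
  have h6' : ∀ i, C.pairing x (A x) (f i x) = 0 := fun i => (h6 i).self_of_nhds
  have h7' : ∀ i, C.pairing x (B x) (f i x) = 0 := fun i => (h7 i).self_of_nhds
  simp only [map_add, map_smul, map_sum, smul_eq_mul, h1, h2, h3, h3', h6', h7', mul_zero,
    Finset.sum_const_zero, add_zero, zero_add, mul_one, map_zero, LinearMap.zero_apply] at e1 e2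
  rw [e3, ← e1, ← e2, zero_smul, zero_smul, zero_add, zero_add]

end LocalFrame

/-! ### Frames that commute with a section, by a linear differential equation. -/

section Parallel

variable {V W : Type*} [NormedAddCommGroup V] [NormedSpace ℝ V] [FiniteDimensional ℝ V]
  [NormedAddCommGroup W] [NormedSpace ℝ W] [FiniteDimensional ℝ W]
  {M : Type*} [TopologicalSpace M] [T2Space M] [ChartedSpace V M] [IsManifold 𝓘(ℝ, V) ∞ M]

/-- A local coordinate system, centred at `p`, whose first coordinate vector field is `X` near `p`. -/
structure IsFlowBox (X : ∀ x : M, TangentSpace 𝓘(ℝ, V) x) (Ψ : OpenPartialHomeomorph M (ℝ × W))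
    (p : M) : Prop where
  mem_source : p ∈ Ψ.source
  apply_eq_zero : Ψ p = 0
  contMDiffOn : ContMDiffOn 𝓘(ℝ, V) 𝓘(ℝ, ℝ × W) ∞ Ψ Ψ.source
  contMDiffOn_symm : ContMDiffOn 𝓘(ℝ, ℝ × W) 𝓘(ℝ, V) ∞ Ψ.symm Ψ.target
  mvfderiv_apply : ∀ᶠ x in nhds p, mvfderiv 𝓘(ℝ, V) Ψ x (X x) = ((1 : ℝ), (0 : W))

variable {X : ∀ x : M, TangentSpace 𝓘(ℝ, V) x} {Ψ : OpenPartialHomeomorph M (ℝ × W)} {p : M}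
  {K : Type*} [NormedAddCommGroup K] [NormedSpace ℝ K] [FiniteDimensional ℝ K]

/-- Linear differential equations along a vector field that can be straightened. -/
theorem IsFlowBox.exists_linear_ode (h : IsFlowBox X Ψ p)
    (Γ : C^∞⟮𝓘(ℝ, V), M; 𝓘(ℝ, K →L[ℝ] K), K →L[ℝ] K⟯) (c₀ : K) :
    ∃ c : C^∞⟮𝓘(ℝ, V), M; 𝓘(ℝ, K), K⟯, c p = c₀ ∧
      ∀ᶠ x in nhds p, mvfderiv 𝓘(ℝ, V) c x (X x) = Γ x (c x) := by
  have h0 : (0 : ℝ × W) ∈ Ψ.target := h.apply_eq_zero ▸ Ψ.map_source h.mem_source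
  obtain ⟨Γ', hΓ'⟩ := exists_function_eventuallyEq (I := 𝓘(ℝ, ℝ × W)) (f := Γ ∘ Ψ.symm) (x := 0) (by
    filter_upwards [Ψ.open_target.mem_nhds h0] with y hy
    exact (Γ.contMDiff _).comp y (h.contMDiffOn_symm.contMDiffAt (Ψ.open_target.mem_nhds hy)))
  obtain ⟨c, hc, hc0, hcd⟩ := exists_smooth_linear_ode Γ'.contMDiff.contDiff c₀
  have hΨ : Filter.Tendsto Ψ (nhds p) (nhds 0) := h.apply_eq_zero ▸ Ψ.continuousAt h.mem_source
  have hsrc := Ψ.open_source.mem_nhds h.mem_source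
  obtain ⟨g, hg⟩ := exists_function_eventuallyEq (I := 𝓘(ℝ, V)) (f := c ∘ Ψ) (x := p) (by
    filter_upwards [hsrc, hΨ.eventually hc] with x hx hcx
    exact hcx.contMDiffAt.comp x (h.contMDiffOn.contMDiffAt (Ψ.open_source.mem_nhds hx)))
  refine ⟨g, ?_, ?_⟩
  · rw [hg.self_of_nhds, Function.comp_apply, h.apply_eq_zero, hc0]
  · filter_upwards [hsrc, hg.eventually_nhds, hΨ.eventually hcd, hΨ.eventually hc, hΨ.eventually hΓ',
      h.mvfderiv_apply] with x hx hgx hcdx hcx hΓx hXx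
    have h1 : DifferentiableAt ℝ c (Ψ x) := hcx.differentiableAt (by simp)
    have h2 : MDifferentiableAt 𝓘(ℝ, V) 𝓘(ℝ, ℝ × W) Ψ x :=
      (h.contMDiffOn.contMDiffAt (Ψ.open_source.mem_nhds hx)).mdifferentiableAt (by simp)
    have h3 := mfderiv_comp_apply x h1.mdifferentiableAt h2 (X x)
    rw [mfderiv_eq_fderiv] at h3
    refine (mvfderiv_congr hgx _).trans (h3.trans ?_)
    have h4 : Γ' (Ψ x) = Γ x := by rw [hΓx, Function.comp_apply, Ψ.left_inv hx]
    have h5 : g x = c (Ψ x) := hgx.self_of_nhds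
    rw [h5, ← h4, ← hcdx]
    exact congrArg (fderiv ℝ c (Ψ x)) hXx

variable {F : Type*} [NormedAddCommGroup F] [NormedSpace ℝ F] [FiniteDimensional ℝ F]
  {E : M → Type*} [TopologicalSpace (TotalSpace F E)] [∀ x, AddCommGroup (E x)]
  [∀ x, Module ℝ (E x)] [∀ x, TopologicalSpace (E x)] [FiberBundle F E] [VectorBundle ℝ F E]
  [ContMDiffVectorBundle ∞ F E 𝓘(ℝ, V)] {C : CourantAlgebroid 𝓘(ℝ, V) F E}
  {A B : Cₛ^∞⟮𝓘(ℝ, V); F, E⟯}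

/-- A frame whose span is stable under `[A, ·]` can be replaced by one on which `[A, ·]` vanishes. -/
theorem IsFlowBox.exists_parallel (h : IsFlowBox (fun x => C.anchor x (A x)) Ψ p) {k : ℕ}
    {f : Fin k → Cₛ^∞⟮𝓘(ℝ, V); F, E⟯} {G : Fin k → Fin k → C^∞⟮𝓘(ℝ, V), M; ℝ⟯}
    (hG : ∀ᶠ x in nhds p, ∀ j, C.bracket A (f j) x = ∑ i, G j i x • f i x) :
    ∃ c : Fin k → Fin k → C^∞⟮𝓘(ℝ, V), M; ℝ⟯, (∀ l i, c l i p = if i = l then 1 else 0) ∧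
      ∀ᶠ x in nhds p, ∀ l, C.bracket A (∑ i, fsmul (c l i) (f i)) x = 0 := by
  classical
  let T : Fin k → Fin k → (Fin k → ℝ) →L[ℝ] (Fin k → ℝ) := fun j i =>
    (ContinuousLinearMap.proj j).smulRight (Pi.single i 1)
  -- In `[A, ∑ c_i f_i]` the coefficient of `f_i` is `ρ(A) c_i + ∑_j G j i c_j`. Its vanishing is
  -- the linear equation with this matrix.
  let Γ : C^∞⟮𝓘(ℝ, V), M; 𝓘(ℝ, (Fin k → ℝ) →L[ℝ] (Fin k → ℝ)), (Fin k → ℝ) →L[ℝ] (Fin k → ℝ)⟯ :=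
    ⟨fun x => ∑ j, ∑ i, (-G j i x) • T j i, ContMDiff.sum fun j _ => ContMDiff.sum fun i _ =>
      ((G j i).contMDiff.neg).smul contMDiff_const⟩
  have hΓ : ∀ x v i, Γ x v i = -∑ j, G j i x * v j := by
    intro x v i
    simp [Γ, T, Finset.sum_apply, Pi.single_apply]
  obtain ⟨c, hc0, hc⟩ : ∃ c : Fin k → Fin k → C^∞⟮𝓘(ℝ, V), M; ℝ⟯,
      (∀ l i, c l i p = if i = l then 1 else 0) ∧
      ∀ᶠ x in nhds p, ∀ l i, C.lie A (c l i) x = -∑ j, G j i x * c l j x := by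
    choose c hc0 hc using fun l => h.exists_linear_ode Γ (Pi.single l 1)
    refine ⟨fun l i => ⟨fun x => c l x i, fun x => contMDiffAt_pi_space.1 ((c l).contMDiff x) i⟩,
      fun l i => ?_, ?_⟩
    · change c l p i = _
      rw [hc0, Pi.single_apply]
    · filter_upwards [Filter.eventually_all.2 hc] with x hcx l i
      have h1 := hΓ x (c l x) i
      rw [← hcx l] at h1
      refine Eq.trans ?_ h1
      have h2 : MDifferentiableAt 𝓘(ℝ, V) 𝓘(ℝ, Fin k → ℝ) (c l) x :=
        ((c l).contMDiff x).mdifferentiableAt (by simp)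
      have h3 := mfderiv_comp_apply x (ContinuousLinearMap.proj (R := ℝ) (φ := fun _ : Fin k => ℝ)
        i).differentiableAt.mdifferentiableAt h2 (C.anchor x (A x))
      rw [mfderiv_eq_fderiv, ContinuousLinearMap.fderiv] at h3
      exact h3
  refine ⟨c, hc0, ?_⟩
  filter_upwards [hG, hc] with x hGx hcx l
  rw [map_sum]
  simp only [C.bracket_fsmul, section_sum_apply, section_add_apply, fsmul_apply, hGx, hcx,
    Finset.smul_sum, Finset.sum_add_distrib, neg_smul, Finset.sum_neg_distrib, Finset.sum_smul]
  rw [Finset.sum_comm, ← sub_eq_add_neg, sub_eq_zero]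
  refine Finset.sum_congr rfl fun i _ => Finset.sum_congr rfl fun j _ => ?_
  rw [smul_smul, mul_comm]

end Parallel

/-! ### Existence of an adapted frame near the point. -/

section Adapted

variable {V W : Type*} [NormedAddCommGroup V] [NormedSpace ℝ V] [FiniteDimensional ℝ V]
  [NormedAddCommGroup W] [NormedSpace ℝ W] [FiniteDimensional ℝ W]
  {M : Type*} [TopologicalSpace M] [T2Space M] [ChartedSpace V M] [IsManifold 𝓘(ℝ, V) ∞ M]
  {F : Type*} [NormedAddCommGroup F] [NormedSpace ℝ F] [FiniteDimensional ℝ F]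
  {E : M → Type*} [TopologicalSpace (TotalSpace F E)] [∀ x, AddCommGroup (E x)]
  [∀ x, Module ℝ (E x)] [∀ x, TopologicalSpace (E x)] [FiberBundle F E] [VectorBundle ℝ F E]
  [ContMDiffVectorBundle ∞ F E 𝓘(ℝ, V)] {p : M}

/-- At `x`, the sections `A`, `B`, `e i` form a frame adapted to the coordinates `Ψ`. -/
structure IsAdaptedAt (C : CourantAlgebroid 𝓘(ℝ, V) F E) (Ψ : M → ℝ × W)
    (A B : Cₛ^∞⟮𝓘(ℝ, V); F, E⟯) {k : ℕ} (e : Fin k → Cₛ^∞⟮𝓘(ℝ, V); F, E⟯) (x : M) : Prop where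
  isFrameAt : IsFrameAt (fun i => (Sum.elim ![A, B] e i : Cₛ^∞⟮𝓘(ℝ, V); F, E⟯)) x
  isotropic : C.pairing x (A x) (A x) = 0
  pairing_grad : ∀ v, C.pairing x (B x) v = (mvfderiv 𝓘(ℝ, V) Ψ x (C.anchor x v)).1
  anchor : mvfderiv 𝓘(ℝ, V) Ψ x (C.anchor x (A x)) = ((1 : ℝ), (0 : W))
  left : ∀ i, C.pairing x (A x) (e i x) = 0
  right : ∀ i, C.pairing x (B x) (e i x) = 0
  bracket : ∀ i, C.bracket A (e i) x = 0

/-- Collects the local steps: an isotropic `A`, coordinates straightening its anchor, the gradient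
`B` of the first coordinate, and a frame of their complement made to commute with `A`. -/
theorem exists_adapted_frame (hVW : Module.finrank ℝ (ℝ × W) = Module.finrank ℝ V)
    (C : CourantAlgebroid 𝓘(ℝ, V) F E) (hp : C.anchor p ≠ 0) :
    ∃ (Ψ : OpenPartialHomeomorph M (ℝ × W)) (A B : Cₛ^∞⟮𝓘(ℝ, V); F, E⟯) (k : ℕ)
      (e : Fin k → Cₛ^∞⟮𝓘(ℝ, V); F, E⟯), IsFlowBox (fun x => C.anchor x (A x)) Ψ p ∧
      ∀ᶠ x in nhds p, IsAdaptedAt C Ψ A B e x := by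
  obtain ⟨A, hAA, hA⟩ := exists_isotropic_section C hp
  have hAp : A p ≠ 0 := fun h0 => hA (by rw [h0, map_zero])
  obtain ⟨Ψ, hΨ1, hΨ2, hΨ3, hΨ4, hΨ5⟩ :=
    exists_flowBox_manifold hVW (C.contMDiff_anchor_section A) hA
  have hΨ : IsFlowBox (fun x => C.anchor x (A x)) Ψ p := ⟨hΨ1, hΨ2, hΨ3, hΨ4, hΨ5⟩
  have hsrc := Ψ.open_source.mem_nhds hΨ1
  have hsm : ∀ᶠ x in nhds p, ContMDiffAt 𝓘(ℝ, V) 𝓘(ℝ, ℝ × W) ∞ Ψ x := by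
    filter_upwards [hsrc] with x hx using hΨ3.contMDiffAt (Ψ.open_source.mem_nhds hx)
  obtain ⟨t, ht⟩ := exists_function_eventuallyEq (I := 𝓘(ℝ, V)) (f := fun x => (Ψ x).1) (x := p)
    (hsm.mono fun x hx => contDiff_fst.contMDiff.contMDiffAt.comp x hx)
  have htd : ∀ᶠ x in nhds p, ∀ v, mvfderiv 𝓘(ℝ, V) t x v = (mvfderiv 𝓘(ℝ, V) Ψ x v).1 := by
    filter_upwards [ht.eventually_nhds, hsm] with x hx hsx v
    refine (mvfderiv_congr hx v).trans ?_
    have h3 := mfderiv_comp_apply (g := (Prod.fst : ℝ × W → ℝ)) x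
      differentiableAt_fst.mdifferentiableAt (hsx.mdifferentiableAt (by simp)) v
    rw [mfderiv_eq_fderiv, fderiv_fst] at h3
    exact h3
  obtain ⟨B, hB, hB1, hB2⟩ := exists_gradient C hAp t
  have hAB : ∀ᶠ x in nhds p, C.pairing x (A x) (B x) = 1 := by
    filter_upwards [hB, htd, hΨ5] with x h1 h2 h3
    rw [C.pairing_symm, h1, h2, h3]
  have hBB : ∀ᶠ x in nhds p, C.pairing x (B x) (B x) = 0 := by
    filter_upwards [hB, hB2] with x h1 h2 using (h1 _).trans (h2 t)
  have hyp : IsHyperbolicNear C A B p := ⟨hAA, hBB, hAB, hB1⟩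
  obtain ⟨k, f, hfA, hfB, hf⟩ := hyp.exists_frame
  obtain ⟨G, hG⟩ := hyp.exists_bracket_coeff hfA hfB hf
  obtain ⟨c, hc, hcA⟩ := hΨ.exists_parallel hG
  let e : Fin k → Cₛ^∞⟮𝓘(ℝ, V); F, E⟯ := fun l => ∑ i, fsmul (c l i) (f i)
  -- The initial values at `p` form the identity matrix, so the new sections agree with the old
  -- frame at `p`.
  have he : IsFrameAt (fun i => (Sum.elim ![A, B] e i : Cₛ^∞⟮𝓘(ℝ, V); F, E⟯)) p := by
    refine (congrArg (fun t => Function.Bijective (Fintype.linearCombination ℝ t)) ?_).mpr hf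
    ext i
    rcases i with i | i
    · rfl
    · simp [e, hc]
  refine ⟨Ψ, A, B, k, e, hΨ, ?_⟩
  filter_upwards [he.eventually, hAA, hB, htd, hΨ5, Filter.eventually_all.2 hfA,
    Filter.eventually_all.2 hfB, hcA] with x h1 h2 h3 h4 h5 h6 h7 h8
  refine ⟨h1, h2, fun v => (h3 v).trans (h4 _), h5, fun i => ?_, fun i => ?_, h8⟩
  · simp only [e, section_sum_apply, fsmul_apply, map_sum, map_smul, h6, smul_zero,
      Finset.sum_const_zero]
  · simp only [e, section_sum_apply, fsmul_apply, map_sum, map_smul, h7, smul_zero,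
      Finset.sum_const_zero]

end Adapted

/-! ### The slice through the point as an embedded hypersurface. -/

section Slice

variable {V W : Type*} [NormedAddCommGroup V] [NormedSpace ℝ V]
  [NormedAddCommGroup W] [NormedSpace ℝ W]
  {M : Type*} [TopologicalSpace M] [ChartedSpace V M]

/-- Smooth local coordinates with values in a cylinder. -/
structure IsCylinder (Ψ : OpenPartialHomeomorph M (ℝ × W)) (ε : ℝ) : Prop where
  pos : 0 < ε
  target : Ψ.target = Set.Ioo (-ε) ε ×ˢ Metric.ball 0 ε
  contMDiffOn : ContMDiffOn 𝓘(ℝ, V) 𝓘(ℝ, ℝ × W) ∞ Ψ Ψ.source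
  contMDiffOn_symm : ContMDiffOn 𝓘(ℝ, ℝ × W) 𝓘(ℝ, V) ∞ Ψ.symm Ψ.target

/-- The product norm is the maximum norm, so a small ball around `0` is already a product of an
interval and a ball. -/
theorem IsFlowBox.exists_cylinder {X : ∀ x : M, TangentSpace 𝓘(ℝ, V) x}
    {Ψ : OpenPartialHomeomorph M (ℝ × W)} {p : M} (h : IsFlowBox X Ψ p) {P : M → Prop}
    (hP : ∀ᶠ x in nhds p, P x) :
    ∃ (Ψ' : OpenPartialHomeomorph M (ℝ × W)) (ε : ℝ), IsCylinder (V := V) Ψ' ε ∧ p ∈ Ψ'.source ∧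
      (∀ x ∈ Ψ'.source, P x) ∧ ∀ x, Ψ' x = Ψ x := by
  have h0 : (0 : ℝ × W) ∈ Ψ.target := h.apply_eq_zero ▸ Ψ.map_source h.mem_source
  have hs : Filter.Tendsto Ψ.symm (nhds 0) (nhds p) := by
    have := Ψ.continuousAt_symm h0
    rwa [ContinuousAt, ← h.apply_eq_zero, Ψ.left_inv h.mem_source, h.apply_eq_zero] at this
  have hev : ∀ᶠ y in nhds (0 : ℝ × W), y ∈ Ψ.target ∧ P (Ψ.symm y) :=
    Filter.Eventually.and (Ψ.open_target.mem_nhds h0) (hs.eventually hP)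
  obtain ⟨ε, hε, hb⟩ := Metric.eventually_nhds_iff_ball.1 hev
  have hball : Metric.ball (0 : ℝ × W) ε = Set.Ioo (-ε) ε ×ˢ Metric.ball 0 ε := by
    have := ball_prod_same (0 : ℝ) (0 : W) ε
    rw [Real.ball_eq_Ioo, zero_sub, zero_add] at this
    exact this.symm
  let Ψ' := (Ψ.symm.restrOpen _ (Metric.isOpen_ball (x := (0 : ℝ × W)) (ε := ε))).symm
  have ht : Ψ'.target = Metric.ball 0 ε :=
    Set.inter_eq_right.2 fun y hy => (hb y hy).1
  have hsrc : Ψ'.source ⊆ Ψ.source := fun x hx => by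
    have := Ψ'.map_source hx
    rw [ht] at this
    have h2 := Ψ'.left_inv hx
    rw [← h2]
    exact Ψ.map_target (hb _ this).1
  have hp : p ∈ Ψ'.source := by
    have := Ψ'.map_target (x := 0) (by rw [ht]; exact Metric.mem_ball_self hε)
    have e : Ψ'.symm 0 = p := by
      change Ψ.symm 0 = p
      rw [← h.apply_eq_zero, Ψ.left_inv h.mem_source]
    rwa [e] at this
  refine ⟨Ψ', ε, ⟨hε, ht.trans hball, h.contMDiffOn.mono hsrc,
    h.contMDiffOn_symm.mono fun y hy => ?_⟩, hp, fun x hx => ?_, fun _ => rfl⟩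
  · rw [ht] at hy
    exact (hb y hy).1
  · have := Ψ'.map_source hx
    rw [ht] at this
    have h2 := Ψ'.left_inv hx
    rw [← h2]
    exact (hb _ this).2

/-- A global chart of the slice where the first coordinate vanishes. -/
structure IsSliceChart (Ψ : OpenPartialHomeomorph M (ℝ × W)) (ε : ℝ) {S : Set M} [ChartedSpace W S]
    (e : OpenPartialHomeomorph S W) : Prop where
  source : e.source = Set.univ
  target : e.target = Metric.ball 0 ε
  mem_maximalAtlas : e ∈ IsManifold.maximalAtlas 𝓘(ℝ, W) ∞ S
  mem_source : ∀ s : S, (s : M) ∈ Ψ.source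
  apply_eq : ∀ s : S, Ψ s = (0, e s)

/-- The second component of `Ψ` identifies the slice with the whole ball, because the image of `Ψ`
is a product. A single chart needs no compatibility check. -/
theorem IsCylinder.exists_sliceChart {Ψ : OpenPartialHomeomorph M (ℝ × W)} {ε : ℝ}
    (h : IsCylinder (V := V) Ψ ε) :
    ∃ (_ : ChartedSpace W {x | x ∈ Ψ.source ∧ (Ψ x).1 = 0})
      (_ : IsManifold 𝓘(ℝ, W) ∞ {x | x ∈ Ψ.source ∧ (Ψ x).1 = 0})
      (e : OpenPartialHomeomorph {x | x ∈ Ψ.source ∧ (Ψ x).1 = 0} W), IsSliceChart Ψ ε e := by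
  classical
  let S : Set M := {x | x ∈ Ψ.source ∧ (Ψ x).1 = 0}
  have ht : ∀ y ∈ Metric.ball (0 : W) ε, ((0 : ℝ), y) ∈ Ψ.target := fun y hy => by
    rw [h.target]
    exact ⟨⟨neg_lt_zero.2 h.pos, h.pos⟩, hy⟩
  have hm : ∀ y ∈ Metric.ball (0 : W) ε, Ψ.symm ((0 : ℝ), y) ∈ S := fun y hy =>
    ⟨Ψ.map_target (ht y hy), by rw [Ψ.right_inv (ht y hy)]⟩
  have h0 := hm 0 (Metric.mem_ball_self h.pos)
  -- Outside the ball the value is irrelevant; the centre of the slice is used.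
  let j : W → S := fun y => if hy : y ∈ Metric.ball (0 : W) ε then ⟨_, hm y hy⟩ else ⟨_, h0⟩
  have hj : ∀ y ∈ Metric.ball (0 : W) ε, (j y : M) = Ψ.symm (0, y) := fun y hy => by
    simp only [j, dif_pos hy]
  have hw : ∀ s : S, Ψ s = (0, (Ψ s).2) := fun s => Prod.ext s.2.2 rfl
  have hwb : ∀ s : S, (Ψ s).2 ∈ Metric.ball (0 : W) ε := fun s => by
    have := Ψ.map_source s.2.1
    rw [h.target] at this
    exact this.2
  let e : OpenPartialHomeomorph S W :=
    { toFun := fun s => (Ψ s).2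
      invFun := j
      source := Set.univ
      target := Metric.ball 0 ε
      map_source' := fun s _ => hwb s
      map_target' := fun _ _ => Set.mem_univ _
      left_inv' := fun s _ => Subtype.ext <| by rw [hj _ (hwb s), ← hw, Ψ.left_inv s.2.1]
      right_inv' := fun y hy => by rw [hj y hy, Ψ.right_inv (ht y hy)]
      open_source := isOpen_univ
      open_target := Metric.isOpen_ball
      continuousOn_toFun := continuous_snd.comp_continuousOn
        (Ψ.continuousOn.comp continuous_subtype_val.continuousOn fun s _ => s.2.1)
      continuousOn_invFun := by
        rw [Topology.IsInducing.subtypeVal.continuousOn_iff]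
        refine (Ψ.continuousOn_symm.comp (f := fun y : W => ((0 : ℝ), y))
          (Continuous.prodMk_right _).continuousOn ht).congr fun y hy => ?_
        exact hj y hy }
  let cs : ChartedSpace W S := e.singletonChartedSpace rfl
  have ms : IsManifold 𝓘(ℝ, W) ∞ S := e.isManifold_singleton rfl
  refine ⟨cs, ms, e, rfl, rfl, ?_, fun s => s.2.1, hw⟩
  exact IsManifold.subset_maximalAtlas rfl

variable [IsManifold 𝓘(ℝ, V) ∞ M] {Ψ : OpenPartialHomeomorph M (ℝ × W)} {ε : ℝ}
  {S : Set M} [ChartedSpace W S] {e : OpenPartialHomeomorph S W}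

namespace IsSliceChart

theorem contMDiff (h : IsSliceChart Ψ ε e) : ContMDiff 𝓘(ℝ, W) 𝓘(ℝ, W) ∞ e := by
  have := contMDiffOn_of_mem_maximalAtlas h.mem_maximalAtlas
  rwa [h.source, contMDiffOn_univ] at this

theorem contMDiffOn_symm (h : IsSliceChart Ψ ε e) :
    ContMDiffOn 𝓘(ℝ, W) 𝓘(ℝ, W) ∞ e.symm (Metric.ball 0 ε) := by
  have := contMDiffOn_symm_of_mem_maximalAtlas h.mem_maximalAtlas
  rwa [h.target] at this

theorem apply_mem (h : IsSliceChart Ψ ε e) (s : S) : e s ∈ Metric.ball (0 : W) ε := by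
  rw [← h.target]
  exact e.map_source (by rw [h.source]; trivial)

theorem symm_apply (h : IsSliceChart Ψ ε e) (s : S) : e.symm (e s) = s :=
  e.left_inv (by rw [h.source]; trivial)

theorem apply_symm (h : IsSliceChart Ψ ε e) {y : W} (hy : y ∈ Metric.ball (0 : W) ε) :
    e (e.symm y) = y := e.right_inv (by rwa [h.target])

theorem val_symm (h : IsSliceChart Ψ ε e) {y : W} (hy : y ∈ Metric.ball (0 : W) ε) :
    (e.symm y : M) = Ψ.symm (0, y) := by
  have := h.apply_eq (e.symm y)
  rw [h.apply_symm hy] at this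
  rw [← this, Ψ.left_inv (h.mem_source _)]

/-- In the chart of `M` obtained from `Ψ` by a linear isomorphism `L`, the inclusion reads `y ↦ L
(0, y)`, an immersion with complement `ℝ`. -/
theorem isSmoothEmbedding [FiniteDimensional ℝ V] [FiniteDimensional ℝ W]
    (h : IsSliceChart Ψ ε e) (hΨ : IsCylinder (V := V) Ψ ε)
    (hVW : Module.finrank ℝ (ℝ × W) = Module.finrank ℝ V) :
    Manifold.IsSmoothEmbedding 𝓘(ℝ, W) 𝓘(ℝ, V) ∞ (Subtype.val : S → M) := by
  let L : (ℝ × W) ≃L[ℝ] V := ContinuousLinearEquiv.ofFinrankEq hVW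
  let χ : OpenPartialHomeomorph M V := Ψ.trans L.toHomeomorph.toOpenPartialHomeomorph
  have hχs : χ.source = Ψ.source := by simp [χ]
  have hχt : χ.target = L.symm ⁻¹' Ψ.target := by
    simp only [χ, OpenPartialHomeomorph.trans_target, Homeomorph.toOpenPartialHomeomorph_target,
      Set.univ_inter]
    rfl
  have hχ : χ ∈ IsManifold.maximalAtlas 𝓘(ℝ, V) ∞ M := by
    refine χ.mem_maximalAtlas_of_contMDiffOn ?_ ?_
    · rw [hχs]
      exact L.contDiff.contMDiff.comp_contMDiffOn hΨ.contMDiffOn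
    · rw [hχt]
      exact hΨ.contMDiffOn_symm.comp L.symm.contDiff.contMDiff.contMDiffOn fun _ hy => hy
  refine ⟨Manifold.IsImmersionOfComplement.isImmersion (F := ℝ) fun s => ?_,
    Topology.IsEmbedding.subtypeVal⟩
  refine Manifold.IsImmersionAtOfComplement.mk_of_charts
    ((ContinuousLinearEquiv.prodComm ℝ W ℝ).trans L) e χ (by rw [h.source]; trivial)
    (by rw [hχs]; exact h.mem_source s) h.mem_maximalAtlas hχ
    (fun s _ => by rw [Set.mem_preimage, hχs]; exact h.mem_source s) fun y hy => ?_
  replace hy : y ∈ Metric.ball (0 : W) ε := by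
    rw [← h.target]
    simpa using hy
  change L (Ψ (e.symm y)) = L (0, y)
  rw [h.apply_eq, h.apply_symm hy]

end IsSliceChart
end Slice

/-! ### A coordinate cylinder as the product of an interval and the slice. -/

section Cylinder

variable {V W : Type*} [NormedAddCommGroup V] [NormedSpace ℝ V]
  [NormedAddCommGroup W] [NormedSpace ℝ W]
  {M : Type*} [TopologicalSpace M] [ChartedSpace V M] [IsManifold 𝓘(ℝ, V) ∞ M]

/-- The domain of local coordinates. -/
abbrev coordDomain (Ψ : OpenPartialHomeomorph M (ℝ × W)) : Opens M := ⟨Ψ.source, Ψ.open_source⟩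

variable {Ψ : OpenPartialHomeomorph M (ℝ × W)} {ε : ℝ}

namespace IsCylinder

theorem contMDiff_comp_val (hΨ : IsCylinder (V := V) Ψ ε) :
    ContMDiff 𝓘(ℝ, V) 𝓘(ℝ, ℝ × W) ∞ (fun x : coordDomain Ψ => Ψ x) := fun x =>
  contMDiffAt_subtype_iff.2 (hΨ.contMDiffOn.contMDiffAt (Ψ.open_source.mem_nhds x.2))

theorem fst_mem (hΨ : IsCylinder (V := V) Ψ ε) {x : M} (hx : x ∈ Ψ.source) :
    (Ψ x).1 ∈ interval (-ε) ε := by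
  have := Ψ.map_source hx
  rw [hΨ.target] at this
  exact this.1

theorem snd_mem (hΨ : IsCylinder (V := V) Ψ ε) {x : M} (hx : x ∈ Ψ.source) :
    (Ψ x).2 ∈ Metric.ball (0 : W) ε := by
  have := Ψ.map_source hx
  rw [hΨ.target] at this
  exact this.2

end IsCylinder

variable {S : Set M} [ChartedSpace W S] {e : OpenPartialHomeomorph S W}

theorem IsSliceChart.mk_mem_target (h : IsSliceChart Ψ ε e) (hΨ : IsCylinder (V := V) Ψ ε)
    (q : interval (-ε) ε × S) : ((q.1 : ℝ), e q.2) ∈ Ψ.target := by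
  rw [hΨ.target]
  exact ⟨q.1.2, h.apply_mem q.2⟩

/-- A cylinder is the product of an interval and a slice. -/
def IsSliceChart.diffeomorph (h : IsSliceChart Ψ ε e) (hΨ : IsCylinder (V := V) Ψ ε) :
    coordDomain Ψ ≃ₘ^∞⟮𝓘(ℝ, V), 𝓘(ℝ, ℝ).prod 𝓘(ℝ, W)⟯ (interval (-ε) ε × S) where
  toFun x := (⟨(Ψ x).1, hΨ.fst_mem x.2⟩, e.symm (Ψ x).2)
  invFun q := ⟨Ψ.symm (q.1, e q.2), Ψ.map_target (h.mk_mem_target hΨ q)⟩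
  left_inv x := Subtype.ext <| by
    change Ψ.symm ((Ψ x).1, e (e.symm (Ψ x).2)) = x
    rw [h.apply_symm (hΨ.snd_mem x.2), Ψ.left_inv x.2]
  right_inv q := by
    refine Prod.ext (Subtype.ext ?_) ?_
    · change (Ψ (Ψ.symm (q.1, e q.2))).1 = q.1
      rw [Ψ.right_inv (h.mk_mem_target hΨ q)]
    · change e.symm (Ψ (Ψ.symm (q.1, e q.2))).2 = q.2
      rw [Ψ.right_inv (h.mk_mem_target hΨ q), h.symm_apply]
  contMDiff_toFun := by
    refine ContMDiff.prodMk ?_ ?_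
    · rw [← ContMDiff.subtypeVal_comp_iff]
      exact contDiff_fst.contMDiff.comp hΨ.contMDiff_comp_val
    · have h1 : ContMDiff 𝓘(ℝ, V) 𝓘(ℝ, W) ∞ (fun x : coordDomain Ψ => (Ψ x).2) :=
        contDiff_snd.contMDiff.comp hΨ.contMDiff_comp_val
      rw [← contMDiffOn_univ] at h1 ⊢
      exact h.contMDiffOn_symm.comp h1 fun x _ => hΨ.snd_mem x.2
  contMDiff_invFun := by
    rw [← ContMDiff.subtypeVal_comp_iff]
    have h1 : ContMDiff (𝓘(ℝ, ℝ).prod 𝓘(ℝ, W)) 𝓘(ℝ, ℝ × W) ∞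
        (fun q : interval (-ε) ε × S => ((q.1 : ℝ), e q.2)) :=
      (contMDiff_subtype_val.comp contMDiff_fst).prodMk_space (h.contMDiff.comp contMDiff_snd)
    rw [← contMDiffOn_univ] at h1 ⊢
    exact hΨ.contMDiffOn_symm.comp h1 fun q _ => h.mk_mem_target hΨ q

theorem mvfderiv_prod_fst {EB H : Type*} [NormedAddCommGroup EB] [NormedSpace ℝ EB]
    [TopologicalSpace H] {I : ModelWithCorners ℝ EB H} {N : Type*} [TopologicalSpace N]
    [ChartedSpace H N] {f : N → ℝ × W} {x : N} (hf : MDifferentiableAt I 𝓘(ℝ, ℝ × W) f x)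
    (v : TangentSpace I x) : mvfderiv I (fun y => (f y).1) x v = (mvfderiv I f x v).1 := by
  have h3 := mfderiv_comp_apply (g := (Prod.fst : ℝ × W → ℝ)) x
    differentiableAt_fst.mdifferentiableAt hf v
  rw [mfderiv_eq_fderiv, fderiv_fst] at h3
  exact h3

theorem mvfderiv_prod_snd {EB H : Type*} [NormedAddCommGroup EB] [NormedSpace ℝ EB]
    [TopologicalSpace H] {I : ModelWithCorners ℝ EB H} {N : Type*} [TopologicalSpace N]
    [ChartedSpace H N] {f : N → ℝ × W} {x : N} (hf : MDifferentiableAt I 𝓘(ℝ, ℝ × W) f x)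
    (v : TangentSpace I x) : mvfderiv I (fun y => (f y).2) x v = (mvfderiv I f x v).2 := by
  have h3 := mfderiv_comp_apply (g := (Prod.snd : ℝ × W → W)) x
    differentiableAt_snd.mdifferentiableAt hf v
  rw [mfderiv_eq_fderiv, fderiv_snd] at h3
  exact h3

theorem IsCylinder.mdifferentiableAt (hΨ : IsCylinder (V := V) Ψ ε) {x : M} (hx : x ∈ Ψ.source) :
    MDifferentiableAt 𝓘(ℝ, V) 𝓘(ℝ, ℝ × W) Ψ x :=
  (hΨ.contMDiffOn.contMDiffAt (Ψ.open_source.mem_nhds hx)).mdifferentiableAt (by simp)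

theorem IsCylinder.mdifferentiableAt_symm (hΨ : IsCylinder (V := V) Ψ ε) {y : ℝ × W}
    (hy : y ∈ Ψ.target) : MDifferentiableAt 𝓘(ℝ, ℝ × W) 𝓘(ℝ, V) Ψ.symm y :=
  (hΨ.contMDiffOn_symm.contMDiffAt (Ψ.open_target.mem_nhds hy)).mdifferentiableAt (by simp)

theorem IsSliceChart.mvfderiv_prodTime_comp [FiniteDimensional ℝ W] [T2Space M]
    [IsManifold 𝓘(ℝ, W) ∞ S] (h : IsSliceChart Ψ ε e) (hΨ : IsCylinder (V := V) Ψ ε)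
    (x : coordDomain Ψ) (v : TangentSpace 𝓘(ℝ, V) x) :
    mvfderiv 𝓘(ℝ, V) ((prodTime 𝓘(ℝ, W) S (-ε) ε).comp
      ⟨h.diffeomorph hΨ, (h.diffeomorph hΨ).contMDiff⟩) x v =
      (mvfderiv 𝓘(ℝ, V) Ψ (x : M) (v : V)).1 := by
  have h1 := hΨ.mdifferentiableAt x.2
  exact (mvfderiv_comp_opens_val (f := fun y => (Ψ y).1)
    (differentiableAt_fst.mdifferentiableAt.comp (x : M) h1) v).trans (mvfderiv_prod_fst h1 _)

theorem IsSliceChart.mfderiv_diffeomorph_snd (h : IsSliceChart Ψ ε e)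
    (hΨ : IsCylinder (V := V) Ψ ε) (x : coordDomain Ψ) (v : TangentSpace 𝓘(ℝ, V) x)
    (hv : (mvfderiv 𝓘(ℝ, V) Ψ (x : M) (v : V)).2 = 0) :
    (mfderiv 𝓘(ℝ, V) (𝓘(ℝ, ℝ).prod 𝓘(ℝ, W)) (h.diffeomorph hΨ) x v : ℝ × W).2 = 0 := by
  have h0 : MDifferentiableAt 𝓘(ℝ, V) (𝓘(ℝ, ℝ).prod 𝓘(ℝ, W)) (h.diffeomorph hΨ) x :=
    ((h.diffeomorph hΨ).contMDiff x).mdifferentiableAt (by simp)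
  have h1 := mfderiv_comp_apply (g := (Prod.snd : interval (-ε) ε × S → S)) x
    mdifferentiableAt_snd h0 v
  rw [mfderiv_snd] at h1
  refine h1.symm.trans ?_
  have h2 : MDifferentiableAt 𝓘(ℝ, W) 𝓘(ℝ, W) e.symm (Ψ x).2 :=
    (h.contMDiffOn_symm.contMDiffAt (Metric.isOpen_ball.mem_nhds (hΨ.snd_mem x.2))).mdifferentiableAt
      (by simp)
  have h3 := hΨ.mdifferentiableAt x.2
  have h4 : MDifferentiableAt 𝓘(ℝ, V) 𝓘(ℝ, W) (fun y : coordDomain Ψ => (Ψ y).2) x :=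
    (contDiff_snd.contMDiff.comp hΨ.contMDiff_comp_val x).mdifferentiableAt (by simp)
  have h5 := mfderiv_comp_apply (g := e.symm) x h2 h4 v
  refine h5.trans ?_
  have h6 : mvfderiv 𝓘(ℝ, V) (fun y : coordDomain Ψ => (Ψ y).2) x v = 0 :=
    ((mvfderiv_comp_opens_val (f := fun y => (Ψ y).2)
      (differentiableAt_snd.mdifferentiableAt.comp (x : M) h3) v).trans
        (mvfderiv_prod_snd h3 _)).trans hv
  exact (congrArg (mfderiv 𝓘(ℝ, W) 𝓘(ℝ, W) e.symm (Ψ x).2) h6).trans (map_zero _)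

/-- Tangent vectors on which the first coordinate vanishes are tangent to the slice. -/
theorem IsSliceChart.mem_range_mfderiv_val (h : IsSliceChart Ψ ε e) (hΨ : IsCylinder (V := V) Ψ ε)
    (hS : ContMDiff 𝓘(ℝ, W) 𝓘(ℝ, V) ∞ (Subtype.val : S → M)) (s : S)
    (v : TangentSpace 𝓘(ℝ, V) (s : M)) (hv : (mvfderiv 𝓘(ℝ, V) Ψ (s : M) v).1 = 0) :
    v ∈ (mfderiv 𝓘(ℝ, W) 𝓘(ℝ, V) (Subtype.val : S → M) s).range := by
  obtain ⟨y, hy, rfl⟩ : ∃ y ∈ Metric.ball (0 : W) ε, e.symm y = s :=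
    ⟨e s, h.apply_mem s, h.symm_apply s⟩
  have hs := h.mem_source (e.symm y)
  have hΨy : Ψ (e.symm y) = ((0 : ℝ), y) := by rw [h.apply_eq, h.apply_symm hy]
  have ht : ((0 : ℝ), y) ∈ Ψ.target := hΨy ▸ Ψ.map_source hs
  let w : W := (mvfderiv 𝓘(ℝ, V) Ψ (e.symm y : M) v).2
  have hw : mvfderiv 𝓘(ℝ, V) Ψ (e.symm y : M) v = ((0 : ℝ), w) := Prod.ext hv rfl
  have h2 : MDifferentiableAt 𝓘(ℝ, W) 𝓘(ℝ, W) e.symm y :=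
    (h.contMDiffOn_symm.contMDiffAt (Metric.isOpen_ball.mem_nhds hy)).mdifferentiableAt (by simp)
  have h3 := mfderiv_comp_apply (g := (Subtype.val : S → M)) y
    ((hS _).mdifferentiableAt (by simp)) h2 w
  have hsy := hΨ.mdifferentiableAt_symm ht
  have h4 := mfderiv_comp_apply (g := Ψ.symm) (f := fun y : W => ((0 : ℝ), y)) y hsy
    (ContinuousLinearMap.inr ℝ ℝ W).differentiableAt.mdifferentiableAt w
  have h5 : ((Subtype.val : S → M) ∘ e.symm) =ᶠ[nhds y] Ψ.symm ∘ fun y : W => ((0 : ℝ), y) := by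
    filter_upwards [Metric.isOpen_ball.mem_nhds hy] with z hz using h.val_symm hz
  have h6 : mfderiv 𝓘(ℝ, W) 𝓘(ℝ, ℝ × W) (fun y : W => ((0 : ℝ), y)) y w = ((0 : ℝ), w) := by
    rw [mfderiv_eq_fderiv]
    exact congrArg (fun l => l w) (ContinuousLinearMap.inr ℝ ℝ W).fderiv
  have h7 := mfderiv_comp_apply (g := Ψ.symm) (e.symm y : M)
    (hΨ.mdifferentiableAt_symm (Ψ.map_source hs)) (hΨ.mdifferentiableAt hs) v
  have h8 : (Ψ.symm ∘ Ψ) =ᶠ[nhds (e.symm y : M)] id := by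
    filter_upwards [Ψ.open_source.mem_nhds hs] with z hz using Ψ.left_inv hz
  -- In coordinates `v` is `(0, w)`, so it is the image of `w` under the parametrization `e.symm` of
  -- the slice followed by the inclusion.
  refine ⟨mfderiv 𝓘(ℝ, W) 𝓘(ℝ, W) e.symm y w, h3.symm.trans ?_⟩
  have h9 : mfderiv 𝓘(ℝ, V) 𝓘(ℝ, V) (Ψ.symm ∘ Ψ) (e.symm y : M) v = v := by
    rw [h8.mfderiv_eq, mfderiv_id]
    rfl
  rw [h5.mfderiv_eq]
  refine h4.trans (Eq.trans ?_ (h7.symm.trans h9))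
  rw [hΨy]
  exact congrArg (mfderiv 𝓘(ℝ, ℝ × W) 𝓘(ℝ, V) Ψ.symm ((0 : ℝ), y)) (h6.trans hw.symm)

end Cylinder

/-! ### The adapted frame on the cylinder, and transversality of the slice. -/

section RestrictAdapted

variable {V W : Type*} [NormedAddCommGroup V] [NormedSpace ℝ V] [FiniteDimensional ℝ V]
  [NormedAddCommGroup W] [NormedSpace ℝ W] [FiniteDimensional ℝ W]
  {M : Type*} [TopologicalSpace M] [T2Space M] [ChartedSpace V M] [IsManifold 𝓘(ℝ, V) ∞ M]
  {F : Type*} [NormedAddCommGroup F] [NormedSpace ℝ F] [FiniteDimensional ℝ F]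
  {E : M → Type*} [TopologicalSpace (TotalSpace F E)] [∀ x, AddCommGroup (E x)]
  [∀ x, Module ℝ (E x)] [∀ x, TopologicalSpace (E x)] [FiberBundle F E] [VectorBundle ℝ F E]
  [ContMDiffVectorBundle ∞ F E 𝓘(ℝ, V)] {C : CourantAlgebroid 𝓘(ℝ, V) F E}
  {Ψ : OpenPartialHomeomorph M (ℝ × W)} {ε : ℝ}
  {A B : Cₛ^∞⟮𝓘(ℝ, V); F, E⟯} {k : ℕ} {f : Fin k → Cₛ^∞⟮𝓘(ℝ, V); F, E⟯}
  {S : Set M} [ChartedSpace W S] [IsManifold 𝓘(ℝ, W) ∞ S] {e : OpenPartialHomeomorph S W}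

variable (A B f) in
/-- The restriction of an adapted frame to an open subset. -/
def restrictFrame (U : Opens M) (i : Fin 2 ⊕ Fin k) : Cₛ^∞⟮𝓘(ℝ, V); F, Restrict 𝓘(ℝ, V) U E⟯ :=
  pullbackSection (inclusion 𝓘(ℝ, V) U) (Sum.elim ![A, B] f i)

theorem isSplitPair_restrict (h : IsSliceChart Ψ ε e) (hΨ : IsCylinder (V := V) Ψ ε)
    (hf : ∀ x ∈ Ψ.source, IsAdaptedAt C Ψ A B f x) :
    IsSplitPair (C.restrict (coordDomain Ψ)) (restrictFrame A B f (coordDomain Ψ) (Sum.inl 0))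
      (restrictFrame A B f (coordDomain Ψ) (Sum.inl 1))
      ((prodTime 𝓘(ℝ, W) S (-ε) ε).comp ⟨h.diffeomorph hΨ, (h.diffeomorph hΨ).contMDiff⟩) where
  pairing_grad x v := ((hf x x.2).pairing_grad v).trans
    (h.mvfderiv_prodTime_comp hΨ x (C.anchor (x : M) v)).symm
  lie_left x := (h.mvfderiv_prodTime_comp hΨ x (C.anchor (x : M) (A x))).trans
    (congrArg Prod.fst (hf x x.2).anchor)
  isotropic x := (hf x x.2).isotropic

theorem isTransversal_restrict (hf : ∀ x ∈ Ψ.source, IsAdaptedAt C Ψ A B f x) (i : Fin k) :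
    IsTransversal (C.restrict (coordDomain Ψ)) (restrictFrame A B f (coordDomain Ψ) (Sum.inl 0))
      (restrictFrame A B f (coordDomain Ψ) (Sum.inl 1))
      (restrictFrame A B f (coordDomain Ψ) (Sum.inr i)) where
  left x := (hf x x.2).left i
  right x := (hf x x.2).right i
  bracket := ((C.isRestriction_restrict (coordDomain Ψ)).bracket A (f i)).trans
    (ContMDiffSection.ext fun x => (hf x x.2).bracket i)

/-- Since `dt(ρ(A)) = 1`, subtracting `dt(v) ρ(A)` from a tangent vector `v` leaves a vector tangent
to the slice. -/
theorem isTransverse_slice (h : IsSliceChart Ψ ε e) (hΨ : IsCylinder (V := V) Ψ ε)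
    (hS : ContMDiff 𝓘(ℝ, W) 𝓘(ℝ, V) ∞ (Subtype.val : S → M))
    (hf : ∀ x ∈ Ψ.source, IsAdaptedAt C Ψ A B f x) (s : S) :
    (mfderiv 𝓘(ℝ, W) 𝓘(ℝ, V) (Subtype.val : S → M) s).range ⊔ (C.anchor s.1).range = ⊤ := by
  refine eq_top_iff.2 fun v _ => ?_
  have hA := (hf s (h.mem_source s)).anchor
  let r : ℝ := (mvfderiv 𝓘(ℝ, V) Ψ (s : M) v).1
  have h1 : v - r • C.anchor (s : M) (A s) ∈
      (mfderiv 𝓘(ℝ, W) 𝓘(ℝ, V) (Subtype.val : S → M) s).range := by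
    refine h.mem_range_mfderiv_val hΨ hS s _ ?_
    rw [map_sub, map_smul, hA]
    simp [r]
  have h2 : r • C.anchor (s : M) (A s) ∈ (C.anchor s.1).range := ⟨r • A s, map_smul _ _ _⟩
  have h3 := Submodule.add_mem_sup h1 h2
  rwa [sub_add_cancel] at h3

end RestrictAdapted
end CourantSplitting
end

/-! ### The splitting theorem. -/

theorem mainTheorem2 {n : ℕ} {M : Type*} [TopologicalSpace M] [T2Space M]
    [SecondCountableTopology M] [ChartedSpace (EuclideanSpace ℝ (Fin n)) M]
    [IsManifold (𝓡 n) ∞ M]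
    {F : Type*} [NormedAddCommGroup F] [NormedSpace ℝ F] [FiniteDimensional ℝ F]
    {E : M → Type*} [TopologicalSpace (TotalSpace F E)] [∀ x, AddCommGroup (E x)]
    [∀ x, Module ℝ (E x)] [∀ x, TopologicalSpace (E x)] [FiberBundle F E] [VectorBundle ℝ F E]
    [ContMDiffVectorBundle ∞ F E (𝓡 n)]
    (C : CourantSplitting.CourantAlgebroid (𝓡 n) F E) (p : M) (hp : C.anchor p ≠ 0) :
    ∃ (U : Opens M) (CU : CourantSplitting.CourantAlgebroid (𝓡 n) F
        (CourantSplitting.Restrict (𝓡 n) U E))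
      (a b : ℝ) (CI : CourantSplitting.CourantAlgebroid 𝓘(ℝ, ℝ) (ℝ × (ℝ →L[ℝ] ℝ))
        (CourantSplitting.GenTangent 𝓘(ℝ, ℝ) (CourantSplitting.interval a b)))
      (S : CourantSplitting.Hypersurface n M)
      (k : ℕ) (E' : S.carrier → Type)
      (_ : TopologicalSpace (TotalSpace (EuclideanSpace ℝ (Fin k)) E'))
      (_ : ∀ s, AddCommGroup (E' s)) (_ : ∀ s, Module ℝ (E' s))
      (_ : ∀ s, TopologicalSpace (E' s)) (_ : FiberBundle (EuclideanSpace ℝ (Fin k)) E')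
      (_ : VectorBundle ℝ (EuclideanSpace ℝ (Fin k)) E')
      (_ : ContMDiffVectorBundle ∞ (EuclideanSpace ℝ (Fin k)) E' (𝓡 S.dim))
      (C' : CourantSplitting.CourantAlgebroid (𝓡 S.dim) (EuclideanSpace ℝ (Fin k)) E')
      (CP : CourantSplitting.CourantAlgebroid (𝓘(ℝ, ℝ).prod (𝓡 S.dim))
        ((ℝ × (ℝ →L[ℝ] ℝ)) × EuclideanSpace ℝ (Fin k))
        (CourantSplitting.BoxProd 𝓘(ℝ, ℝ) (𝓡 S.dim)
          (CourantSplitting.GenTangent 𝓘(ℝ, ℝ) (CourantSplitting.interval a b)) E'))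
      (φ : CourantSplitting.CourantIso CU CP) (t₀ : CourantSplitting.interval a b),
      p ∈ U ∧ p ∈ S.carrier ∧ S.carrier ⊆ U ∧ S.IsTransverse C ∧
      C.IsRestriction CU ∧ CI.IsStandard ∧ CP.IsDirectProduct CI C' ∧
      ∀ (s : S.carrier) (x : U), (x : M) = s → φ.base x = (t₀, s) := by
  -- In dimension `0` the tangent space is trivial and the anchor cannot be nonzero.
  obtain ⟨d, rfl⟩ : ∃ d, n = d + 1 := by
    refine Nat.exists_eq_succ_of_ne_zero ?_
    rintro rfl
    have : Subsingleton (TangentSpace (𝓡 0) p) :=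
      inferInstanceAs (Subsingleton (EuclideanSpace ℝ (Fin 0)))
    exact hp (LinearMap.ext fun v => Subsingleton.elim _ _)
  have hVW : Module.finrank ℝ (ℝ × EuclideanSpace ℝ (Fin d)) =
      Module.finrank ℝ (EuclideanSpace ℝ (Fin (d + 1))) := by
    rw [Module.finrank_prod, Module.finrank_self, finrank_euclideanSpace_fin,
      finrank_euclideanSpace_fin, add_comm]
  obtain ⟨Ψ₀, A, B, k, f, hΨ₀, hf₀⟩ :=
    CourantSplitting.exists_adapted_frame (W := EuclideanSpace ℝ (Fin d)) hVW C hp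
  -- The coordinates are shrunk to a cylinder on all of which the frame is adapted; its domain is
  -- `U`.
  obtain ⟨Ψ, ε, hΨ, hpΨ, hf, heq⟩ := hΨ₀.exists_cylinder hf₀
  have hp0 : Ψ p = 0 := (heq p).trans hΨ₀.apply_eq_zero
  rw [← show (Ψ : M → ℝ × EuclideanSpace ℝ (Fin d)) = Ψ₀ from funext heq] at hf
  obtain ⟨cs, ms, e, he⟩ := hΨ.exists_sliceChart
  have hemb := he.isSmoothEmbedding hΨ hVW
  let S : CourantSplitting.Hypersurface (d + 1) M := ⟨_, d, rfl, cs, ms, hemb⟩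
  have hpS : p ∈ S.carrier := ⟨hpΨ, by rw [hp0]; rfl⟩
  obtain ⟨CI, C', CP, φ, hCI, hCP, hφ⟩ := CourantSplitting.exists_splitting
    (C.restrict (CourantSplitting.coordDomain Ψ)) (he.diffeomorph hΨ)
    ⟨0, neg_lt_zero.2 hΨ.pos, hΨ.pos⟩ ⟨p, hpS⟩
    (s := CourantSplitting.restrictFrame A B f (CourantSplitting.coordDomain Ψ))
    (fun x => (hf x x.2).isFrameAt) (CourantSplitting.isSplitPair_restrict he hΨ hf)
    (fun x => he.mfderiv_diffeomorph_snd hΨ x _ (congrArg Prod.snd (hf x x.2).anchor))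
    (CourantSplitting.isTransversal_restrict hf)
  refine ⟨CourantSplitting.coordDomain Ψ, C.restrict _, -ε, ε, CI, S, k, _, _, _, _, _, _, _,
    inferInstance, C', CP, φ, ⟨0, neg_lt_zero.2 hΨ.pos, hΨ.pos⟩, hpΨ, hpS, fun x hx => hx.1,
    CourantSplitting.isTransverse_slice he hΨ hemb.contMDiff hf, C.isRestriction_restrict _, hCI,
    hCP, fun s x hx => (hφ x).trans ?_⟩
  -- The slice is the zero set of the first coordinate, so `t₀ = 0`.
  have h1 : Ψ x = (0, e s) := by rw [hx]; exact he.apply_eq s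
  refine Prod.ext (Subtype.ext (congrArg Prod.fst h1)) ?_
  exact (congrArg e.symm (congrArg Prod.snd h1)).trans (he.symm_apply s)
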